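/- Let $K$ be a number field, $\mathfrak p$ a finite place of $K$, $F=K_{\mathfrak p}$ the completion, $\mathcal O_F$ its ring of integers, $v_F$ its normalized valuation, and $n\ge 1$. For a group $H$ inside a monoid $\Delta$ such that every double coset $HgH$, $g\in\Delta$, is a finite union of right cosets, the Hecke algebra $\mathcal H(H,\Delta)$ is the free $\mathbb Z$-module on the double cosets $HgH$ ($g\in\Delta$). If $HgH=\dot\bigcup_i Hh_i$ and $Hg'H=\dot\bigcup_j Hh'_j$, then the product $HgH\cdot Hg'H$ is $\sum_E c_E\,E$, where for $E=HxH$ the integer $c_E$ is the number of pairs $(i,j)$ with $Hh_ih'_j=Hx$. Let $D$ be a division algebra of finite dimension over $F$ with normalized valuation $v$ extending (up to scaling) that of $F$, and with valuation ring $\mathcal O_D$. Let $r\ge1$, let $A$ be an $F$-algebra identified with $\mathrm{Mat}_r(D)$, and let $\Lambda\subseteq A$ be the maximal order corresponding to $\mathrm{Mat}_r(\mathcal O_D)$. An $N\times N$ matrix $X$ over $D$ has elementary divisor valuations $\hat e=(\hat e_1\le\dots\le\hat e_N)\in\mathbb N_0^N$ if $X=U\,\mathrm{diag}(d_1,\dots,d_N)\,V$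 with $U,V\in \mathrm{GL}_N(\mathcal O_D)$ and $v(d_i)=\hat e_i$. Matrices over $A$ are regarded as block matrices over $D$. Put $\hat e<\hat e'$ if there is an $i$ with $\hat e_i>\hat e'_i$ and $\hat e_j=\hat e'_j$ for all $j<i$. Put $(\hat e,l)<(\hat e',l')$ if $l<l'$, or $l=l'$ and $\hat e<\hat e'$. Consider the following local Hecke algebras and invariants. 1. (Unimodular case.) $H=\mathrm{GL}_n(\Lambda)$, and $\Delta=\mathrm{Inv}_n(\Lambda)$ is the monoid of matrices over $\Lambda$ that are invertible over $A$. The invariant is $\hat e\in\mathbb N_0^{nr}$. 2. (Modular case.) $A$ carries an involution $a\mapsto\bar a$ that fixes $F$ elementwise and preserves $\Lambda$, and $A$ is a quadratic field extension of $F$ with its Galois conjugation, or a quaternion algebra over $F$ (split or not) with its canonical involution, or (the exceptional symplectic case) $A=F$. With $J=\begin{pmatrix}0&I_n\\-I_n&0\end{pmatrix}$ and $M^*=\overline M^{\mathrm{tr}}$, $\Delta=\Delta_n(\Lambda)$ is the monoid of $2n\times 2n$ matrices $M$ over $\Lambda$ with $M^*JM=mJ$ for some $m\in\mathcal O_F\setminus\{0\}$,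 and $H=\mathrm{Sp}_n(\Lambda)$ consists of those with $m\in\mathcal O_F^\times$. The invariant is $(\hat e,l)\in\mathbb N_0^{2nr}\times\mathbb N_0$ with $l=v(m)$. 3. (Split hermitian modular case.) $\Delta=\mathrm{RInv}_{2n}(\mathcal O_F)$ is the monoid of pairs $(M,l)$ with $l\in\mathbb N_0$, $M\in\mathrm{Mat}_{2n}(\mathcal O_F)$ invertible over $F$ and $\mathfrak p^lM^{-1}$ integral, and $H=\mathrm{GL}_{2n}(\mathcal O_F)$ acts on the first component. The invariant is $(\hat e,l)\in\mathbb N_0^{2n}\times\mathbb N_0$, with $\hat e$ the elementary divisor valuations of $M$ with respect to $v_F$. In each case every double coset $HgH$, $g\in\Delta$, is a finite union of right cosets (indeed $\Delta$ is contained in the commensurator of $H$). The invariant of $g\in\Delta$ exists, is unique and depends only on $HgH$, and distinct double cosets have distinct invariants. Write $\hat e(M)$ for the invariant of a double coset $M$ (in cases 2 and 3 it includes $l$), and $R<P$ for $\hat e(R)<\hat e(P)$. Then for any double cosets $M$ and $N$, $$M\cdot N=P+\sum_j R_j,$$ where $P$ is the double coset with $\hat e(P)=\hat e(M)+\hat e(N)$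 and the $R_j$ form a finite (possibly empty) family of double cosets, repetitions allowed, with $R_j<P$ for all $j$. -/

import Mathlib

open scoped Quaternion WithZero HeckeCosetModule Matrix Pointwise

noncomputable section

namespace LocalHecke

/-! ### The Hecke algebra of a group `H` inside a monoid `Δ`

The basis `HeckeCoset Δ H H` (the double cosets `H g H`, `g ∈ Δ`), the free `ℤ`-module
`𝕋 Δ H ℤ` on it and the condition `IsHeckeTriple Δ H H` are those of Mathlib.  The product is
built here from right coset representatives. -/

section Hecke

variable {𝒢 : Type*} [Group 𝒢] {Δ : Submonoid 𝒢} {H : Subgroup 𝒢}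

/-- The double coset `H g H` as a subset of the ambient group. -/
def toSet (C : HeckeCoset Δ H H) : Set 𝒢 :=
  DoubleCoset.doubleCoset ((Quotient.out C : Δ) : 𝒢) (H : Set 𝒢) (H : Set 𝒢)

variable (H) in
/-- The right coset `H x`. -/
def rightCoset (x : 𝒢) : Quotient (QuotientGroup.rightRel H) := Quotient.mk _ x

/-- The set of right cosets `H h_i` whose disjoint union is the given double coset. -/
def rightCosets (C : HeckeCoset Δ H H) : Set (Quotient (QuotientGroup.rightRel H)) :=
  rightCoset H '' toSet C

theorem rightCosets_finite [IsHeckeTriple Δ H H] (C : HeckeCoset Δ H H) :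
    (rightCosets C).Finite := by
  set g : 𝒢 := ((Quotient.out C : Δ) : 𝒢) with hg
  have hmem : g⁻¹ ∈ Subgroup.Commensurable.commensurator H :=
    inv_mem (IsHeckeTriple.mem_commensurator_right H (Quotient.out C : Δ))
  have hfin := ((Subgroup.Commensurable.commensurator_mem_iff H g⁻¹).1 hmem).1
  set S : Subgroup 𝒢 := ConjAct.toConjAct g⁻¹ • H with hS
  have hS' : ∀ x : 𝒢, x ∈ S ↔ g * x * g⁻¹ ∈ H := by
    intro x
    rw [hS, Subgroup.mem_pointwise_smul_iff_inv_smul_mem, ← ConjAct.toConjAct_inv,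
      ConjAct.toConjAct_smul]
    simp
  have hidx : (S.subgroupOf H).index ≠ 0 := hfin
  have : (S.subgroupOf H).FiniteIndex := ⟨hidx⟩
  have hq : Finite (H ⧸ S.subgroupOf H) := Subgroup.finite_quotient_of_finiteIndex
  refine (Set.finite_range (fun q : H ⧸ S.subgroupOf H =>
    rightCoset H (g * ((Quotient.out q : H) : 𝒢)⁻¹))).subset ?_
  rintro _ ⟨x, hx, rfl⟩
  obtain ⟨a, ha, b, hb, rfl⟩ := DoubleCoset.mem_doubleCoset.1 hx
  refine ⟨((⟨b⁻¹, H.inv_mem hb⟩ : H) : H ⧸ S.subgroupOf H), ?_⟩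
  set c : H := Quotient.out ((⟨b⁻¹, H.inv_mem hb⟩ : H) : H ⧸ S.subgroupOf H) with hc
  have h1 : (⟨b⁻¹, H.inv_mem hb⟩ : H)⁻¹ * c ∈ S.subgroupOf H := by
    rw [← QuotientGroup.eq, hc]
    exact (QuotientGroup.out_eq' _).symm
  have h2 : g * (b * (c : 𝒢)) * g⁻¹ ∈ H := by
    have := (hS' _).1 (Subgroup.mem_subgroupOf.1 h1)
    simpa using this
  refine Quotient.sound ?_
  change (QuotientGroup.rightRel H).r _ _
  rw [QuotientGroup.rightRel_apply]
  have := H.mul_mem ha h2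
  simpa [hg, mul_assoc] using this

/-- The multiplicity of the double coset `E = H x H` in the product of `C` and `C'`.  Let `h_i` and
`h'_j` run through systems of representatives of the right cosets in `C` and in `C'`; then this is
the multiplicity of the right coset `H x` in the multiset of all `H h_i h'_j`. -/
def mulCoeff (C C' E : HeckeCoset Δ H H) : ℕ :=
  Nat.card {p : rightCosets C × rightCosets C' //
    rightCoset H (Quotient.out p.1.1 * Quotient.out p.2.1) =
      rightCoset H ((Quotient.out E : Δ) : 𝒢)}

theorem rightCoset_out_injective : Function.Injective
    (fun E : HeckeCoset Δ H H => rightCoset H ((Quotient.out E : Δ) : 𝒢)) := by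
  intro E E' h
  have h1 : (QuotientGroup.rightRel H).r ((Quotient.out E : Δ) : 𝒢) ((Quotient.out E' : Δ) : 𝒢) :=
    Quotient.exact h
  rw [QuotientGroup.rightRel_apply] at h1
  rw [← Quotient.out_eq E, ← Quotient.out_eq E']
  refine Quotient.sound ?_
  change DoubleCoset.doubleCoset _ _ _ = DoubleCoset.doubleCoset _ _ _
  refine (DoubleCoset.doubleCoset_eq_of_mem ?_).symm
  exact DoubleCoset.mem_doubleCoset.2 ⟨_, h1, 1, H.one_mem, by simp⟩

theorem mulCoeff_support_finite [IsHeckeTriple Δ H H] (C C' : HeckeCoset Δ H H) :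
    (Function.support (fun E : HeckeCoset Δ H H => (mulCoeff C C' E : ℤ))).Finite := by
  have := (rightCosets_finite C).to_subtype
  have := (rightCosets_finite C').to_subtype
  have hfin := Set.finite_range (fun p : rightCosets C × rightCosets C' =>
    rightCoset H (Quotient.out p.1.1 * Quotient.out p.2.1))
  refine (hfin.preimage rightCoset_out_injective.injOn).subset ?_
  intro E hE
  have h0 : mulCoeff C C' E ≠ 0 := by simpa using hE
  obtain ⟨⟨p, hp⟩⟩ := (Nat.card_ne_zero.1 h0).1
  exact ⟨p, hp⟩

/-- The product of two double cosets. -/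
def basisMul [IsHeckeTriple Δ H H] (C C' : HeckeCoset Δ H H) : HeckeCoset Δ H H →₀ ℤ :=
  Finsupp.ofSupportFinite _ (mulCoeff_support_finite C C')

/-- The multiplication of the Hecke algebra: the bilinear extension of `basisMul`. -/
instance heckeMul [IsHeckeTriple Δ H H] : Mul (𝕋 Δ H ℤ) where
  mul f g := HeckeCosetModule.of
    ((HeckeCosetModule.of.symm f).sum fun C a =>
      (HeckeCosetModule.of.symm g).sum fun C' b => (a * b) • basisMul C C')

/-- A double coset as a basis element of the Hecke algebra. -/
def basis (C : HeckeCoset Δ H H) : 𝕋 Δ H ℤ := HeckeCosetModule.of (Finsupp.single C 1)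

variable (Δ H) in
/-- Let `HasInv g x` say that `x` is the invariant of `g`, and let `lt` be the order on invariants.
`(H, Δ)` is a Hecke pair, its double cosets may be identified with their invariants `ê`, and
`M N = P + ∑ⱼ Rⱼ` with `ê P = ê M + ê N` and `Rⱼ < P` for all double cosets `M` and `N`.
The first property of `ê` determines it. -/
def LeadingTermLaw {I : Type*} [Add I] (lt : I → I → Prop) (HasInv : 𝒢 → I → Prop) : Prop :=
  ∃ _ : IsHeckeTriple Δ H H, ∃ ê : HeckeCoset Δ H H → I,
    (∀ C, ∀ g ∈ toSet C, ∀ x, HasInv g x ↔ x = ê C) ∧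
    Function.Injective ê ∧
    ∀ M N : HeckeCoset Δ H H, ∃ (P : HeckeCoset Δ H H) (R : Multiset (HeckeCoset Δ H H)),
      basis M * basis N = basis P + (R.map basis).sum ∧
      ê P = ê M + ê N ∧
      ∀ Q ∈ R, lt (ê Q) (ê P)

end Hecke

/-! ### The orderings -/

/-- `e < e'`: at the first index where they differ, `e` has the larger entry. -/
def divLT {N : ℕ} (e e' : Fin N → ℕ) : Prop :=
  ∃ i, e' i < e i ∧ ∀ j < i, e j = e' j

/-- `(e, l) < (e', l')`: compare `l` first, then the elementary divisors. -/
def simDivLT {N : ℕ} (x x' : (Fin N → ℕ) × ℕ) : Prop :=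
  x.2 < x'.2 ∨ (x.2 = x'.2 ∧ divLT x.1 x'.1)

/-! ### Groups and monoids of matrices -/

section Matrices

variable {A : Type*} [Ring A] (κ : Type*) [Fintype κ] [DecidableEq κ]

/-- `GL(Λ)` inside the matrices that are invertible over `A`. -/
def GLOrder (Λ : Subring A) : Subgroup (Matrix κ κ A)ˣ :=
  (Λ.matrix (n := κ)).toSubmonoid.units

/-- `Inv(Λ)`: the matrices over `Λ` that are invertible over `A`. -/
def InvOrder (Λ : Subring A) : Submonoid (Matrix κ κ A)ˣ :=
  (Λ.matrix (n := κ)).toSubmonoid.comap (Units.coeHom (Matrix κ κ A))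

/-- The matrix `J = (0, I; -I, 0)`. -/
def J (A : Type*) [Ring A] (n : ℕ) : Matrix (Fin n ⊕ Fin n) (Fin n ⊕ Fin n) A :=
  Matrix.fromBlocks 0 1 (-1) 0

variable {F : Type*} [Field F] [Algebra F A] [StarRing A] {n : ℕ}

/-- `M* J M = m J`, where `M*` is the conjugate transpose. -/
def HasSimilitude (M : Matrix (Fin n ⊕ Fin n) (Fin n ⊕ Fin n) A) (m : F) : Prop :=
  Mᴴ * J A n * M = m • J A n

theorem HasSimilitude.mul {M N : Matrix (Fin n ⊕ Fin n) (Fin n ⊕ Fin n) A} {m m' : F}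
    (hM : HasSimilitude M m) (hN : HasSimilitude N m') : HasSimilitude (M * N) (m * m') := by
  unfold HasSimilitude at *
  calc (M * N)ᴴ * J A n * (M * N) = Nᴴ * (Mᴴ * J A n * M) * N := by
        rw [Matrix.conjTranspose_mul]; simp only [Matrix.mul_assoc]
    _ = (m * m') • J A n := by
        rw [hM, Matrix.mul_smul, Matrix.smul_mul, hN, smul_smul]

theorem HasSimilitude.one :
    HasSimilitude (1 : Matrix (Fin n ⊕ Fin n) (Fin n ⊕ Fin n) A) (1 : F) := by
  simp [HasSimilitude]

theorem HasSimilitude.inv {M : (Matrix (Fin n ⊕ Fin n) (Fin n ⊕ Fin n) A)ˣ} {m : F} (hm : m ≠ 0)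
    (hM : HasSimilitude M.1 m) : HasSimilitude (M⁻¹).1 m⁻¹ := by
  unfold HasSimilitude at *
  have h1 : M.1 * (M⁻¹).1 = 1 := M.mul_inv
  have h2 : ((M⁻¹).1)ᴴ * (M.1)ᴴ = 1 := by
    rw [← Matrix.conjTranspose_mul, h1, Matrix.conjTranspose_one]
  have h3 : m • (((M⁻¹).1)ᴴ * J A n * (M⁻¹).1) = J A n := by
    calc m • (((M⁻¹).1)ᴴ * J A n * (M⁻¹).1)
        = ((M⁻¹).1)ᴴ * ((M.1)ᴴ * J A n * M.1) * (M⁻¹).1 := by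
          rw [hM, Matrix.mul_smul, Matrix.smul_mul]
      _ = (((M⁻¹).1)ᴴ * (M.1)ᴴ) * J A n * (M.1 * (M⁻¹).1) := by
          simp only [Matrix.mul_assoc]
      _ = J A n := by rw [h1, h2]; simp
  calc ((M⁻¹).1)ᴴ * J A n * (M⁻¹).1
      = m⁻¹ • (m • (((M⁻¹).1)ᴴ * J A n * (M⁻¹).1)) := by rw [inv_smul_smul₀ hm]
    _ = m⁻¹ • J A n := by rw [h3]

variable (n) in
/-- `Δ_n(Λ)`: the matrices over `Λ` with a nonzero similitude `m` in the integers of `F`. -/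
def DeltaOrder (vF : Valuation F ℤᵐ⁰) (Λ : Subring A) :
    Submonoid (Matrix (Fin n ⊕ Fin n) (Fin n ⊕ Fin n) A)ˣ where
  carrier := {M | M.1 ∈ Λ.matrix (n := Fin n ⊕ Fin n) ∧
    ∃ m : F, m ≠ 0 ∧ vF m ≤ 1 ∧ HasSimilitude M.1 m}
  one_mem' := ⟨one_mem _, 1, one_ne_zero, by simp, HasSimilitude.one⟩
  mul_mem' := by
    rintro M N ⟨hM, m, hm0, hm, hMm⟩ ⟨hN, m', hm0', hm', hNm⟩
    refine ⟨mul_mem hM hN, m * m', mul_ne_zero hm0 hm0', ?_, hMm.mul hNm⟩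
    rw [map_mul]
    exact mul_le_one' hm hm'

variable (n) in
/-- `Sp_n(Λ)`: the matrices in `GL_{2n}(Λ)` whose similitude is a unit of the integers of `F`. -/
def SpOrder (vF : Valuation F ℤᵐ⁰) (Λ : Subring A) :
    Subgroup (Matrix (Fin n ⊕ Fin n) (Fin n ⊕ Fin n) A)ˣ where
  carrier := {M | M ∈ GLOrder (Fin n ⊕ Fin n) Λ ∧ ∃ m : F, vF m = 1 ∧ HasSimilitude M.1 m}
  one_mem' := ⟨one_mem _, 1, by simp, HasSimilitude.one⟩
  mul_mem' := by
    rintro M N ⟨hM, m, hm, hMm⟩ ⟨hN, m', hm', hNm⟩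
    exact ⟨mul_mem hM hN, m * m', by rw [map_mul, hm, hm', mul_one], hMm.mul hNm⟩
  inv_mem' := by
    rintro M ⟨hM, m, hm, hMm⟩
    have hm0 : m ≠ 0 := by
      rintro rfl
      simp at hm
    exact ⟨inv_mem hM, m⁻¹, by rw [map_inv₀, hm, inv_one], hMm.inv hm0⟩

/-- `RInv(𝒪_F)`: the pairs `(M, l)` with `M` integral, `l ≥ 0` and `𝔭^l M⁻¹` integral. -/
def RInvOrder (vF : Valuation F ℤᵐ⁰) : Submonoid ((Matrix κ κ F)ˣ × Multiplicative ℤ) where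
  carrier := {x | x.1 ∈ InvOrder κ vF.integer ∧ 0 ≤ x.2.toAdd ∧
    ∀ i j, vF ((x.1⁻¹).1 i j) ≤ WithZero.exp x.2.toAdd}
  one_mem' := by
    refine ⟨one_mem _, le_refl _, fun i j => ?_⟩
    have h : (1 : Matrix κ κ F) ∈ (vF.integer).matrix (n := κ) := one_mem _
    simpa [Valuation.mem_integer_iff] using h i j
  mul_mem' := by
    rintro x y ⟨hx, hx0, hxi⟩ ⟨hy, hy0, hyi⟩
    refine ⟨mul_mem hx hy, add_nonneg hx0 hy0, fun i j => ?_⟩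
    have h : (((x * y).1)⁻¹).1 i j = ∑ k, (y.1⁻¹).1 i k * (x.1⁻¹).1 k j := by
      rw [Prod.fst_mul, mul_inv_rev, Units.val_mul, Matrix.mul_apply]
    rw [h]
    refine vF.map_sum_le fun k _ => ?_
    rw [map_mul, Prod.snd_mul, toAdd_mul, add_comm, WithZero.exp_add]
    exact mul_le_mul' (hyi i k) (hxi k j)

/-- `GL(𝒪_F)`, acting trivially on the second component of `RInv(𝒪_F)`. -/
def GLSplit (vF : Valuation F ℤᵐ⁰) : Subgroup ((Matrix κ κ F)ˣ × Multiplicative ℤ) :=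
  (GLOrder κ vF.integer).prod ⊥

end Matrices

/-! ### Invariants of double cosets -/

section Invariants

variable {D : Type*} [DivisionRing D] (v : Valuation D ℤᵐ⁰)

/-- `X = U [d_1, …, d_N] V` with `U`, `V` invertible over the valuation ring of `D` and `d_i` of
valuation `e_1 ≤ ⋯ ≤ e_N`: the `e_i` are the elementary divisor valuations of `X`. -/
def HasElementaryDivisors {ι : Type*} [Fintype ι] [DecidableEq ι] {N : ℕ}
    (X : Matrix ι ι D) (e : Fin N → ℕ) : Prop :=
  Monotone e ∧ ∃ U ∈ GLOrder ι v.integer, ∃ V ∈ GLOrder ι v.integer,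
    ∃ (s : ι ≃ Fin N) (d : Fin N → D), (∀ i, v (d i) = WithZero.exp (-(e i : ℤ))) ∧
      X = U.1 * Matrix.diagonal (fun i => d (s i)) * V.1

variable {F : Type*} [Field F] [Algebra F D] {A : Type*} [Ring A] [Algebra F A] {r : ℕ}
  (φ : A ≃ₐ[F] Matrix (Fin r) (Fin r) D)

/-- The maximal order of `A` that corresponds to the matrices over the valuation ring of `D`
under an identification of `A` with `Mat_r(D)`. -/
def order : Subring A := (v.integer.matrix (n := Fin r)).comap φ.toRingEquiv.toRingHom

/-- A matrix over `A` as a matrix over `D`, each entry being replaced by an `r × r` block. -/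
def flatten {κ : Type*} (X : Matrix κ κ A) : Matrix (κ × Fin r) (κ × Fin r) D :=
  Matrix.comp κ κ (Fin r) (Fin r) D (X.map φ)

/-- The invariant of a matrix in the unimodular case. -/
def UnimodularInv {n : ℕ} (M : (Matrix (Fin n) (Fin n) A)ˣ) (e : Fin (n * r) → ℕ) : Prop :=
  HasElementaryDivisors v (flatten φ M.1) e

/-- The invariant of a matrix in the modular case: the elementary divisor valuations and the
valuation of the similitude, both with respect to the prime element of `D`. -/
def ModularInv [StarRing A] {n : ℕ} (M : (Matrix (Fin n ⊕ Fin n) (Fin n ⊕ Fin n) A)ˣ)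
    (x : (Fin (2 * n * r) → ℕ) × ℕ) : Prop :=
  HasElementaryDivisors v (flatten φ M.1) x.1 ∧
    ∃ m : F, HasSimilitude M.1 m ∧ v (algebraMap F D m) = WithZero.exp (-(x.2 : ℤ))

/-- The invariant of a pair `(M, l)` in the split hermitian case. -/
def SplitInv {N : ℕ} (vF : Valuation F ℤᵐ⁰) (M : (Matrix (Fin N) (Fin N) F)ˣ × Multiplicative ℤ)
    (x : (Fin N → ℕ) × ℕ) : Prop :=
  HasElementaryDivisors vF M.1.1 x.1 ∧ M.2.toAdd = (x.2 : ℤ)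

end Invariants

/-- The algebras with involution of the modular case: `F` itself, a quadratic field extension
of `F` with its Galois conjugation, or a quaternion algebra over `F` with its canonical
involution. -/
def IsModularAlgebra (F A : Type*) [Field F] [Ring A] [Algebra F A] [StarRing A] : Prop :=
  (∀ x : F, star (algebraMap F A x) = algebraMap F A x) ∧
    (Module.finrank F A = 1 ∨
      (IsField A ∧ Module.finrank F A = 2 ∧ ∃ a : A, star a ≠ a) ∨
      ∃ a b : F, a ≠ 0 ∧ b ≠ 0 ∧ Nonempty (A ≃⋆ₐ[F] ℍ[F,a,b]))

end LocalHecke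

end

/-!
The law is reduced to statements about single matrices by `leadingTermLaw_of`. Let `H` and `Δ` be
given with an invariant that separates double cosets. If every product `g g'` has an invariant `≤
ê(g) + ê(g')`, if equality is attained by some `g h g'` with `h ∈ H`, and if a product of elements
of `H g H` and `H g' H` whose invariant is that sum determines the right coset of its second
factor, then `P = H g h g' H` occurs in `H g H · H g' H` with coefficient one and everything else
that occurs is smaller.

*Matrices over `D`.* A matrix in `GL_N(D)` is brought to diagonal form by clearing the row and the
column of an entry of maximal valuation; the minimal valuation `e₁` of the entries is therefore
the first elementary divisor. For the order `divLT` the law follows by induction on `N` from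
looking at `e₁` alone: the entries of `X Y` have valuation at least `e₁(X) + e₁(Y)`. If equality
holds, then, up to factors in `GL_N(𝒪_D)` on both sides and between `X` and `Y`, both matrices
split off their first elementary divisors (`exists_factors_consDiag`), and the rest is handled by
the induction hypothesis. This gives the bound (`HasIntElementaryDivisors.eq_add_or_lt`) and the
uniqueness of the second factor (`HasIntElementaryDivisors.exists_eq_mul_right_factor`). In all
three cases the bound and the uniqueness are inherited from here, as multipliers and the second
components of pairs are multiplicative. Finiteness comes from the finiteness of the residue rings
of `D`, which is deduced from that of the residue field of `K` at `𝔭`.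

*Similitudes.* It remains to see that two similitudes with the same invariant are in the same
double coset of `Sp_n(Λ)`, and that the sum of two invariants is attained with a factor from
`Sp_n(Λ)`. Both follow from the diagonal form `diag(a, (a*)⁻¹ m)` of a similitude with multiplier
`m` under the integral isometries of a hyperbolic form over `D`
(`exists_hypUnitary_mul_mul_eq_hypDiagonal`): the clearing of a row and a column can be done with
isometries, and then a hyperbolic plane splits off. The elementary divisors are the valuations of
the entries of `a` in increasing order, followed by those of `(a*)⁻¹ m` in increasing order.

*The algebras with involution.* If `A` is a division algebra, then `A = D` and the form is the
skew-hermitian form `J`; the involution preserves the valuation because it preserves the valuation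
ring (`valuation_star_eq`). Otherwise `A = Mat₂(F)`, and the canonical involution is the adjugate,
that is the transpose conjugated by `(0, 1; -1, 0)`. The similitudes of `J` over `A` then become
those of a split symmetric form over `F` (`leadingTermLaw_modular_of_adjugate`), to which the same
diagonalization applies.
-/

noncomputable section

namespace LocalHecke

/-! ### A criterion for the leading term law -/

section Criterion

variable {𝒢 : Type*} [Group 𝒢] {Δ : Submonoid 𝒢} {H : Subgroup 𝒢}

theorem basis_mul_basis [IsHeckeTriple Δ H H] (M N : HeckeCoset Δ H H) :
    basis M * basis N = HeckeCosetModule.of (basisMul M N) := by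
  change HeckeCosetModule.of _ = _
  unfold basis
  rw [Equiv.symm_apply_apply, Equiv.symm_apply_apply, Finsupp.sum_single_index,
    Finsupp.sum_single_index] <;> simp

/-- A nonnegative integral combination of double cosets is the sum of a family of double cosets
with repetitions. -/
theorem exists_multiset_sum_basis (f : HeckeCoset Δ H H →₀ ℕ) :
    ∃ R : Multiset (HeckeCoset Δ H H), (∀ Q ∈ R, f Q ≠ 0) ∧
      (R.map basis).sum =
        HeckeCosetModule.of (f.mapRange (fun n : ℕ => (n : ℤ)) Nat.cast_zero) := by
  classical
  refine ⟨Finsupp.toMultiset f, fun Q hQ => by simpa using hQ, ?_⟩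
  induction f using Finsupp.induction_linear with
  | zero => simp; rfl
  | add f g hf hg =>
    rw [map_add, Multiset.map_add, Multiset.sum_add, hf, hg,
      Finsupp.mapRange_add (fun a b => Nat.cast_add a b)]
    rfl
  | single a n =>
    rw [Finsupp.toMultiset_single, Multiset.map_nsmul, Multiset.sum_nsmul,
      Finsupp.mapRange_single]
    rw [Multiset.map_singleton, Multiset.sum_singleton]
    unfold basis
    change n • (Finsupp.single a (1 : ℤ)) = Finsupp.single a (n : ℤ)
    simp

theorem rightCoset_eq_iff {x y : 𝒢} : rightCoset H x = rightCoset H y ↔ y * x⁻¹ ∈ H := by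
  unfold rightCoset
  rw [Quotient.eq, ← QuotientGroup.rightRel_apply]

theorem exists_out_rightCoset (x : 𝒢) : ∃ h ∈ H, Quotient.out (rightCoset H x) = h * x := by
  have h : rightCoset H x = rightCoset H (Quotient.out (rightCoset H x)) :=
    (Quotient.out_eq (rightCoset H x)).symm
  exact ⟨_, rightCoset_eq_iff.1 h, by simp⟩

theorem exists_out_mk (g : Δ) :
    ∃ h ∈ H, ∃ k ∈ H, ((Quotient.out (HeckeCoset.mk H H g) : Δ) : 𝒢) = h * g * k := by
  have h : (HeckeCoset.setoid Δ H H).r g (Quotient.out (HeckeCoset.mk H H g)) :=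
    Quotient.exact (Quotient.out_eq (HeckeCoset.mk H H g)).symm
  have h2 : DoubleCoset.doubleCoset (g : 𝒢) (H : Set 𝒢) H =
    DoubleCoset.doubleCoset ((Quotient.out (HeckeCoset.mk H H g) : Δ) : 𝒢) H H := h
  have h3 := DoubleCoset.mem_doubleCoset_self H H ((Quotient.out (HeckeCoset.mk H H g) : Δ) : 𝒢)
  rw [← h2] at h3
  obtain ⟨a, ha, b, hb, e⟩ := DoubleCoset.mem_doubleCoset.1 h3
  exact ⟨a, ha, b, hb, e⟩

theorem mul_mem_toSet {C : HeckeCoset Δ H H} {x h k : 𝒢} (hx : x ∈ toSet C) (hh : h ∈ H)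
    (hk : k ∈ H) : h * x * k ∈ toSet C := by
  obtain ⟨a, ha, b, hb, rfl⟩ := DoubleCoset.mem_doubleCoset.1 hx
  exact DoubleCoset.mem_doubleCoset.2
    ⟨h * a, H.mul_mem hh ha, b * k, H.mul_mem hb hk, by simp only [mul_assoc]⟩

theorem out_mem_toSet_of_mem_rightCosets {C : HeckeCoset Δ H H}
    {p : Quotient (QuotientGroup.rightRel H)} (hp : p ∈ rightCosets C) :
    Quotient.out p ∈ toSet C := by
  obtain ⟨y, hy, rfl⟩ := hp
  obtain ⟨h, hh, e⟩ := exists_out_rightCoset (H := H) y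
  rw [e]
  simpa using mul_mem_toSet hy hh H.one_mem

theorem rightCoset_out (p : Quotient (QuotientGroup.rightRel H)) :
    rightCoset H (Quotient.out p) = p :=
  Quotient.out_eq p

/-- The leading term law holds as soon as the invariants separate double cosets, the invariant of
a product is at most the sum of those of its factors, this sum is attained for some
representatives, and a decomposition `z = g g'` for which the invariants add up determines the right
coset `H g'`.  The last condition makes the coefficient of the leading double coset `1`. -/
theorem leadingTermLaw_of {I : Type*} [Add I] {lt : I → I → Prop} {HasInv : 𝒢 → I → Prop}
    (hle : H.toSubmonoid ≤ Δ)
    (hcomm : Δ ≤ (Subgroup.Commensurable.commensurator H).toSubmonoid)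
    (exists_inv : ∀ g ∈ Δ, ∃ x, HasInv g x)
    (inv_unique : ∀ g x y, HasInv g x → HasInv g y → x = y)
    (inv_mul_mul : ∀ g, ∀ h ∈ H, ∀ k ∈ H, ∀ x, HasInv g x → HasInv (h * g * k) x)
    (separates : ∀ g ∈ Δ, ∀ g' ∈ Δ, ∀ x, HasInv g x → HasInv g' x →
      ∃ h ∈ H, ∃ k ∈ H, g' = h * g * k)
    (le_add : ∀ g ∈ Δ, ∀ g' ∈ Δ, ∀ x y z, HasInv g x → HasInv g' y → HasInv (g * g') z →
      z = x + y ∨ lt z (x + y))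
    (attained : ∀ g ∈ Δ, ∀ g' ∈ Δ, ∀ x y, HasInv g x → HasInv g' y →
      ∃ h ∈ H, HasInv (g * h * g') (x + y))
    (coset_unique : ∀ g ∈ Δ, ∀ g' ∈ Δ, ∀ g₁ ∈ Δ, ∀ g₁' ∈ Δ, ∀ x y, HasInv g x → HasInv g' y →
      HasInv g₁ x → HasInv g₁' y → HasInv (g * g') (x + y) → g * g' = g₁ * g₁' →
      g₁' * g'⁻¹ ∈ H) :
    LeadingTermLaw Δ H lt HasInv := by
  have hT : IsHeckeTriple Δ H H := IsHeckeTriple.of_diagonal hle hcomm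
  choose ê₀ hê₀ using fun C : HeckeCoset Δ H H => exists_inv _ (Quotient.out C : Δ).2
  have hset : ∀ C : HeckeCoset Δ H H, ∀ g ∈ toSet C, g ∈ Δ := by
    intro C g hg
    obtain ⟨a, ha, b, hb, rfl⟩ := DoubleCoset.mem_doubleCoset.1 hg
    exact Δ.mul_mem (Δ.mul_mem (hle ha) (Quotient.out C : Δ).2) (hle hb)
  have hinv : ∀ C, ∀ g ∈ toSet C, HasInv g (ê₀ C) := by
    intro C g hg
    obtain ⟨a, ha, b, hb, rfl⟩ := DoubleCoset.mem_doubleCoset.1 hg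
    exact inv_mul_mul _ a ha b hb _ (hê₀ C)
  have hout : ∀ C : HeckeCoset Δ H H, ((Quotient.out C : Δ) : 𝒢) ∈ toSet C := fun C =>
    DoubleCoset.mem_doubleCoset_self H H _
  have hinj : Function.Injective ê₀ := by
    intro C C' h
    obtain ⟨a, ha, b, hb, e⟩ := separates _ (Quotient.out C : Δ).2 _ (Quotient.out C' : Δ).2 _
      (hê₀ C) (h ▸ hê₀ C')
    rw [← Quotient.out_eq C, ← Quotient.out_eq C']
    refine Quotient.sound ?_
    change DoubleCoset.doubleCoset _ _ _ = DoubleCoset.doubleCoset _ _ _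
    refine (DoubleCoset.doubleCoset_eq_of_mem ?_).symm
    exact DoubleCoset.mem_doubleCoset.2 ⟨a, ha, b, hb, e⟩
  refine ⟨hT, ê₀, fun C g hg x => ⟨fun hx => inv_unique g _ _ hx (hinv C g hg), ?_⟩, hinj, ?_⟩
  · rintro rfl
    exact hinv C g hg
  intro M N
  obtain ⟨k, hk, hPinv⟩ := attained _ (Quotient.out M : Δ).2 _ (Quotient.out N : Δ).2 _ _
    (hê₀ M) (hê₀ N)
  set g : 𝒢 := ((Quotient.out M : Δ) : 𝒢) with hg
  set g' : 𝒢 := ((Quotient.out N : Δ) : 𝒢) with hg'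
  let P : HeckeCoset Δ H H := HeckeCoset.mk H H
    ⟨g * k * g', Δ.mul_mem (Δ.mul_mem (Quotient.out M : Δ).2 (hle hk)) (Quotient.out N : Δ).2⟩
  obtain ⟨a, ha, b, hb, hP⟩ := exists_out_mk (H := H)
    (⟨g * k * g', Δ.mul_mem (Δ.mul_mem (Quotient.out M : Δ).2 (hle hk)) (Quotient.out N : Δ).2⟩ : Δ)
  change ((Quotient.out P : Δ) : 𝒢) = a * (g * k * g') * b at hP
  have hPe : ê₀ P = ê₀ M + ê₀ N := by
    refine inv_unique _ _ _ (hê₀ P) ?_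
    rw [hP]
    exact inv_mul_mul _ a ha b hb _ hPinv
  -- the product of a pair of right cosets counted by `mulCoeff M N E` lies in `E`
  have hpair : ∀ E : HeckeCoset Δ H H, ∀ p : rightCosets M × rightCosets N,
      rightCoset H (Quotient.out p.1.1 * Quotient.out p.2.1) =
        rightCoset H ((Quotient.out E : Δ) : 𝒢) →
      ∃ h ∈ H, (h * Quotient.out p.1.1) * Quotient.out p.2.1 = ((Quotient.out E : Δ) : 𝒢) := by
    intro E p hp
    exact ⟨_, rightCoset_eq_iff.1 hp, by group⟩
  have hP1 : mulCoeff M N P = 1 := by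
    unfold mulCoeff
    rw [Nat.card_eq_one_iff_unique]
    constructor
    · constructor
      rintro ⟨p, hp⟩ ⟨p', hp'⟩
      obtain ⟨h, hh, e⟩ := hpair P p hp
      obtain ⟨h', hh', e'⟩ := hpair P p' hp'
      have hm : ∀ (q : rightCosets M × rightCosets N) (h : 𝒢), h ∈ H →
          h * Quotient.out q.1.1 ∈ toSet M := fun q h hh => by
        simpa using mul_mem_toSet (out_mem_toSet_of_mem_rightCosets q.1.2) hh H.one_mem
      have hn : ∀ (q : rightCosets M × rightCosets N), Quotient.out q.2.1 ∈ toSet N :=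
        fun q => out_mem_toSet_of_mem_rightCosets q.2.2
      have h2 : Quotient.out p'.2.1 * (Quotient.out p.2.1)⁻¹ ∈ H := by
        refine coset_unique _ (hset _ _ (hm p h hh)) _ (hset _ _ (hn p)) _
          (hset _ _ (hm p' h' hh')) _ (hset _ _ (hn p')) _ _ (hinv _ _ (hm p h hh))
          (hinv _ _ (hn p)) (hinv _ _ (hm p' h' hh')) (hinv _ _ (hn p')) ?_ (e.trans e'.symm)
        rw [e, ← hPe]
        exact hê₀ P
      have h22 : p.2 = p'.2 := by
        apply Subtype.ext
        rw [← rightCoset_out p.2.1, ← rightCoset_out p'.2.1]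
        exact rightCoset_eq_iff.2 h2
      have h11 : p.1 = p'.1 := by
        apply Subtype.ext
        rw [← rightCoset_out p.1.1, ← rightCoset_out p'.1.1]
        rw [h22] at e
        have h3 : h * Quotient.out p.1.1 = h' * Quotient.out p'.1.1 :=
          mul_right_cancel (e.trans e'.symm)
        have h4 : Quotient.out p'.1.1 = h'⁻¹ * (h * Quotient.out p.1.1) := by rw [h3]; group
        rw [rightCoset_eq_iff, h4]
        convert H.mul_mem (H.inv_mem hh') hh using 1
        group
      exact Subtype.ext (Prod.ext h11 h22)
    · obtain ⟨h₂, hh₂, e₂⟩ := exists_out_rightCoset (H := H) (g' * b)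
      have m₂ : rightCoset H (g' * b) ∈ rightCosets N :=
        ⟨_, by simpa using mul_mem_toSet (hout N) H.one_mem hb, rfl⟩
      have m₁ : rightCoset H (a * g * (k * h₂⁻¹)) ∈ rightCosets M :=
        ⟨_, mul_mem_toSet (hout M) ha (H.mul_mem hk (H.inv_mem hh₂)), rfl⟩
      obtain ⟨h₁, hh₁, e₁⟩ := exists_out_rightCoset (H := H) (a * g * (k * h₂⁻¹))
      refine ⟨⟨(⟨_, m₁⟩, ⟨_, m₂⟩), ?_⟩⟩
      change rightCoset H (Quotient.out (rightCoset H (a * g * (k * h₂⁻¹))) *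
        Quotient.out (rightCoset H (g' * b))) = _
      rw [rightCoset_eq_iff, e₁, e₂, hP]
      convert H.inv_mem hh₁ using 1
      group
  have hlt : ∀ E, E ≠ P → mulCoeff M N E ≠ 0 → lt (ê₀ E) (ê₀ P) := by
    intro E hE h0
    obtain ⟨⟨p, hp⟩⟩ := (Nat.card_ne_zero.1 h0).1
    obtain ⟨h, hh, e⟩ := hpair E p hp
    have m1 : h * Quotient.out p.1.1 ∈ toSet M := by
      simpa using mul_mem_toSet (out_mem_toSet_of_mem_rightCosets p.1.2) hh H.one_mem
    have m2 := out_mem_toSet_of_mem_rightCosets p.2.2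
    have h3 := le_add _ (hset _ _ m1) _ (hset _ _ m2) _ _ (ê₀ E) (hinv _ _ m1)
      (hinv _ _ m2) (by rw [e]; exact hê₀ E)
    rw [← hPe] at h3
    exact h3.resolve_left fun h => hE (hinj h)
  classical
  let f : HeckeCoset Δ H H →₀ ℕ :=
    (Finsupp.ofSupportFinite (mulCoeff M N) (by
      refine (mulCoeff_support_finite M N).subset fun E hE => ?_
      simpa using hE)).erase P
  obtain ⟨R, hR, hsum⟩ := exists_multiset_sum_basis f
  have hfP : f P = 0 := Finsupp.erase_same
  have hfE : ∀ E, E ≠ P → f E = mulCoeff M N E := fun E hE => Finsupp.erase_ne hE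
  refine ⟨P, R, ?_, hPe, fun Q hQ => ?_⟩
  · rw [basis_mul_basis, hsum]
    unfold basis
    change basisMul M N = Finsupp.single P (1 : ℤ) +
      Finsupp.mapRange (fun n : ℕ => (n : ℤ)) Nat.cast_zero f
    ext E
    rw [Finsupp.add_apply, Finsupp.mapRange_apply]
    change (mulCoeff M N E : ℤ) = _
    by_cases hE : E = P
    · rw [hE, hP1, hfP]; simp
    · rw [hfE E hE, Finsupp.single_eq_of_ne hE]; simp
  · have hQP : Q ≠ P := by
      rintro rfl
      exact hR _ hQ hfP
    exact hlt Q hQP (by rw [← hfE Q hQP]; exact hR Q hQ)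

end Criterion

end LocalHecke

end

noncomputable section

namespace LocalHecke

/-! ### Matrices over a valued division ring -/

section ValuedMatrices

variable {D : Type*} [DivisionRing D] {v : Valuation D ℤᵐ⁰}

theorem mem_GLOrder_iff {ι : Type*} [Fintype ι] [DecidableEq ι] {U : (Matrix ι ι D)ˣ} :
    U ∈ GLOrder ι v.integer ↔ (∀ i j, v (U.1 i j) ≤ 1) ∧ ∀ i j, v ((U⁻¹).1 i j) ≤ 1 := by
  rw [GLOrder, Submonoid.mem_units_iff]
  rfl

theorem valuation_mul_apply_le {ι κ μ : Type*} [Fintype κ] {X : Matrix ι κ D} {Y : Matrix κ μ D}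
    {c d : ℤᵐ⁰} (hX : ∀ i j, v (X i j) ≤ c) (hY : ∀ i j, v (Y i j) ≤ d) (i : ι) (j : μ) :
    v ((X * Y) i j) ≤ c * d := by
  rw [Matrix.mul_apply]
  refine v.map_sum_le fun k _ => ?_
  rw [map_mul]
  exact mul_le_mul' (hX i k) (hY k j)

theorem valuation_GLOrder_mul_le {ι : Type*} [Fintype ι] [DecidableEq ι] {U : (Matrix ι ι D)ˣ}
    (hU : U ∈ GLOrder ι v.integer) {X : Matrix ι ι D} {c : ℤᵐ⁰} (hX : ∀ i j, v (X i j) ≤ c)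
    (i j : ι) : v ((U.1 * X) i j) ≤ c := by
  simpa using valuation_mul_apply_le (mem_GLOrder_iff.1 hU).1 hX i j

theorem valuation_mul_GLOrder_le {ι : Type*} [Fintype ι] [DecidableEq ι] {U : (Matrix ι ι D)ˣ}
    (hU : U ∈ GLOrder ι v.integer) {X : Matrix ι ι D} {c : ℤᵐ⁰} (hX : ∀ i j, v (X i j) ≤ c)
    (i j : ι) : v ((X * U.1) i j) ≤ c := by
  simpa using valuation_mul_apply_le hX (mem_GLOrder_iff.1 hU).1 i j

/-- The permutation matrix of `σ` as a unit. -/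
def permUnit {ι : Type*} [Fintype ι] [DecidableEq ι] (σ : Equiv.Perm ι) : (Matrix ι ι D)ˣ where
  val := σ.permMatrix D
  inv := σ⁻¹.permMatrix D
  val_inv := by rw [← Matrix.permMatrix_mul]; simp
  inv_val := by rw [← Matrix.permMatrix_mul]; simp

theorem valuation_permMatrix_le {ι : Type*} [DecidableEq ι] (σ : Equiv.Perm ι) (i j : ι) :
    v (σ.permMatrix D i j) ≤ 1 := by
  rw [Equiv.Perm.permMatrix, PEquiv.toMatrix_apply]
  split_ifs <;> simp

theorem permUnit_mem {ι : Type*} [Fintype ι] [DecidableEq ι] (σ : Equiv.Perm ι) :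
    (permUnit σ : (Matrix ι ι D)ˣ) ∈ GLOrder ι v.integer :=
  mem_GLOrder_iff.2 ⟨valuation_permMatrix_le σ, valuation_permMatrix_le σ⁻¹⟩

theorem permUnit_mul_apply {ι κ : Type*} [Fintype ι] [DecidableEq ι] (σ : Equiv.Perm ι)
    (X : Matrix ι κ D) (i : ι) (j : κ) :
    ((permUnit σ : (Matrix ι ι D)ˣ).1 * X) i j = X (σ i) j := by
  change (σ.permMatrix D * X) i j = _
  rw [Equiv.Perm.permMatrix, PEquiv.toMatrix_toPEquiv_mul]
  rfl

theorem mul_permUnit_apply {ι : Type*} [Fintype ι] [DecidableEq ι] (σ : Equiv.Perm ι)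
    (X : Matrix ι ι D) (i j : ι) :
    (X * (permUnit σ : (Matrix ι ι D)ˣ).1) i j = X i (σ.symm j) := by
  change (X * σ.permMatrix D) i j = _
  rw [Equiv.Perm.permMatrix, PEquiv.mul_toMatrix_toPEquiv]
  rfl

/-- A matrix of square zero `N` gives the unit `1 + N`. -/
def oneAddUnit {ι : Type*} [Fintype ι] [DecidableEq ι] (N : Matrix ι ι D) (hN : N * N = 0) :
    (Matrix ι ι D)ˣ where
  val := 1 + N
  inv := 1 - N
  val_inv := by rw [add_mul, mul_sub, mul_sub, hN]; simp
  inv_val := by rw [sub_mul, mul_add, mul_add, hN]; simp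

theorem oneAddUnit_mem {ι : Type*} [Fintype ι] [DecidableEq ι] {N : Matrix ι ι D} (hN : N * N = 0)
    (h : ∀ i j, v (N i j) ≤ 1) : oneAddUnit N hN ∈ GLOrder ι v.integer := by
  have h1 : ∀ i j, v ((1 : Matrix ι ι D) i j) ≤ 1 := by
    intro i j
    rw [Matrix.one_apply]
    split_ifs <;> simp
  exact mem_GLOrder_iff.2 ⟨fun i j => v.map_add_le (h1 i j) (h i j),
    fun i j => v.map_sub_le (h1 i j) (h i j)⟩

/-- Clearing the column of a pivot by row operations. -/
theorem exists_clear_column {ι κ : Type*} [Fintype ι] [DecidableEq ι] (X : Matrix ι κ D) (i₀ : ι)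
    (j₀ : κ) (h0 : X i₀ j₀ ≠ 0) (h : ∀ i, v (X i j₀) ≤ v (X i₀ j₀)) :
    ∃ U ∈ GLOrder ι v.integer, (∀ i, i ≠ i₀ → (U.1 * X) i j₀ = 0) ∧
      ∀ j, (U.1 * X) i₀ j = X i₀ j := by
  let N : Matrix ι ι D := fun i k => if k = i₀ then (if i = i₀ then 0 else
    -(X i j₀ * (X i₀ j₀)⁻¹)) else 0
  have hN : N * N = 0 := by
    ext i j
    rw [Matrix.mul_apply]
    refine Finset.sum_eq_zero fun k _ => ?_
    by_cases hk : k = i₀ <;> simp [N, hk]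
  have hNX : ∀ i j, (N * X) i j = if i = i₀ then 0 else -(X i j₀ * (X i₀ j₀)⁻¹) * X i₀ j := by
    intro i j
    rw [Matrix.mul_apply, Finset.sum_eq_single i₀]
    · simp only [N, if_true]; split_ifs <;> simp
    · intro k _ hk
      simp [N, hk]
    · simp
  refine ⟨oneAddUnit N hN, oneAddUnit_mem hN fun i j => ?_, fun i hi => ?_, fun j => ?_⟩
  · simp only [N]
    split_ifs
    · simp
    · rw [Valuation.map_neg, map_mul, map_inv₀]
      exact mul_inv_le_one_of_le₀ (h i) zero_le
    · simp
  · change ((1 + N) * X : Matrix ι κ D) i j₀ = 0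
    rw [Matrix.add_mul, Matrix.one_mul, Matrix.add_apply, hNX, if_neg hi]
    simp [h0]
  · change ((1 + N) * X : Matrix ι κ D) i₀ j = _
    rw [Matrix.add_mul, Matrix.one_mul, Matrix.add_apply, hNX]
    simp

/-- Clearing the row of a pivot by column operations. -/
theorem exists_clear_row {ι : Type*} [Fintype ι] [DecidableEq ι] (X : Matrix ι ι D) (i₀ j₀ : ι)
    (h0 : X i₀ j₀ ≠ 0) (h : ∀ j, v (X i₀ j) ≤ v (X i₀ j₀)) :
    ∃ U ∈ GLOrder ι v.integer, (∀ j, j ≠ j₀ → (X * U.1) i₀ j = 0) ∧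
      ∀ i, (X * U.1) i j₀ = X i j₀ := by
  let N : Matrix ι ι D := fun k j => if k = j₀ then (if j = j₀ then 0 else
    -((X i₀ j₀)⁻¹ * X i₀ j)) else 0
  have hN : N * N = 0 := by
    ext i j
    rw [Matrix.mul_apply]
    refine Finset.sum_eq_zero fun k _ => ?_
    by_cases hk : k = j₀ <;> simp [N, hk]
  have hNX : ∀ i j, (X * N) i j = if j = j₀ then 0 else X i j₀ * -((X i₀ j₀)⁻¹ * X i₀ j) := by
    intro i j
    rw [Matrix.mul_apply, Finset.sum_eq_single j₀]
    · simp only [N, if_true]; split_ifs <;> simp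
    · intro k _ hk
      simp [N, hk]
    · simp
  refine ⟨oneAddUnit N hN, oneAddUnit_mem hN fun i j => ?_, fun j hj => ?_, fun i => ?_⟩
  · simp only [N]
    split_ifs
    · simp
    · rw [Valuation.map_neg, map_mul, map_inv₀]
      exact inv_mul_le_one_of_le₀ (h j) zero_le
    · simp
  · change (X * (1 + N)) i₀ j = 0
    rw [mul_add, mul_one, Matrix.add_apply, hNX, if_neg hj]
    simp [h0]
  · change (X * (1 + N)) i j₀ = _
    rw [mul_add, mul_one, Matrix.add_apply, hNX]
    simp

/-- The block diagonal matrix with blocks `a` and `X`. -/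
def consDiag {N : ℕ} (a : D) (X : Matrix (Fin N) (Fin N) D) :
    Matrix (Fin (N + 1)) (Fin (N + 1)) D :=
  fun i j => Fin.cases (Fin.cases a (fun _ => 0) j) (fun i => Fin.cases 0 (fun j => X i j) j) i

section consDiag

variable {N : ℕ}

@[simp] theorem consDiag_zero_zero (a : D) (X : Matrix (Fin N) (Fin N) D) :
    consDiag a X 0 0 = a := rfl

@[simp] theorem consDiag_zero_succ (a : D) (X : Matrix (Fin N) (Fin N) D) (j : Fin N) :
    consDiag a X 0 j.succ = 0 := rfl

@[simp] theorem consDiag_succ_zero (a : D) (X : Matrix (Fin N) (Fin N) D) (i : Fin N) :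
    consDiag a X i.succ 0 = 0 := rfl

@[simp] theorem consDiag_succ_succ (a : D) (X : Matrix (Fin N) (Fin N) D) (i j : Fin N) :
    consDiag a X i.succ j.succ = X i j := rfl

theorem consDiag_mul (a b : D) (X Y : Matrix (Fin N) (Fin N) D) :
    consDiag a X * consDiag b Y = consDiag (a * b) (X * Y) := by
  ext i j
  rw [Matrix.mul_apply, Fin.sum_univ_succ]
  cases i using Fin.cases <;> cases j using Fin.cases <;> simp [Matrix.mul_apply]

theorem consDiag_one_one : consDiag (1 : D) (1 : Matrix (Fin N) (Fin N) D) = 1 := by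
  ext i j
  cases i using Fin.cases <;> cases j using Fin.cases <;> simp [Matrix.one_apply, Fin.succ_ne_zero,
    (Fin.succ_ne_zero _).symm]

theorem consDiag_diagonal (a : D) (d : Fin N → D) :
    consDiag a (Matrix.diagonal d) = Matrix.diagonal (Fin.cons a d : Fin (N + 1) → D) := by
  ext i j
  cases i using Fin.cases <;> cases j using Fin.cases <;> simp [Matrix.diagonal_apply,
    Fin.succ_ne_zero, (Fin.succ_ne_zero _).symm]

theorem consDiag_injective {a b : D} {X Y : Matrix (Fin N) (Fin N) D}
    (h : consDiag a X = consDiag b Y) : a = b ∧ X = Y :=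
  ⟨congr_fun₂ h 0 0, by ext i j; exact congr_fun₂ h i.succ j.succ⟩

theorem eq_consDiag {Y : Matrix (Fin (N + 1)) (Fin (N + 1)) D} (hr : ∀ j, j ≠ 0 → Y 0 j = 0)
    (hc : ∀ i, i ≠ 0 → Y i 0 = 0) : Y = consDiag (Y 0 0) (Y.submatrix Fin.succ Fin.succ) := by
  ext i j
  cases i using Fin.cases <;> cases j using Fin.cases <;> simp [hr, hc, Fin.succ_ne_zero]

/-- `X ↦ diag(1, X)` on invertible matrices. -/
def consDiagUnit : (Matrix (Fin N) (Fin N) D)ˣ →* (Matrix (Fin (N + 1)) (Fin (N + 1)) D)ˣ :=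
  Units.map
    { toFun := consDiag 1
      map_one' := consDiag_one_one
      map_mul' := fun X Y => by rw [consDiag_mul, one_mul] }

theorem consDiagUnit_val (U : (Matrix (Fin N) (Fin N) D)ˣ) :
    (consDiagUnit U).1 = consDiag 1 U.1 := rfl

theorem consDiagUnit_mem {U : (Matrix (Fin N) (Fin N) D)ˣ} (hU : U ∈ GLOrder (Fin N) v.integer) :
    consDiagUnit U ∈ GLOrder (Fin (N + 1)) v.integer := by
  have key : ∀ X : Matrix (Fin N) (Fin N) D, (∀ i j, v (X i j) ≤ 1) →
      ∀ i j, v (consDiag 1 X i j) ≤ 1 := by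
    intro X hX i j
    cases i using Fin.cases <;> cases j using Fin.cases <;> simp [hX]
  rw [mem_GLOrder_iff] at hU ⊢
  exact ⟨key _ hU.1, by rw [← map_inv]; exact key _ hU.2⟩

theorem isUnit_of_isUnit_consDiag {a : D} {X : Matrix (Fin N) (Fin N) D}
    (h : IsUnit (consDiag a X)) : IsUnit X := by
  obtain ⟨u, hu⟩ := h
  have h1 : consDiag a X * (u⁻¹).1 = 1 := by rw [← hu, u.mul_inv]
  have h2 : (u⁻¹).1 * consDiag a X = 1 := by rw [← hu, u.inv_mul]
  refine ⟨⟨X, (u⁻¹).1.submatrix Fin.succ Fin.succ, ?_, ?_⟩, rfl⟩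
  · ext i j
    have := congr_fun₂ h1 i.succ j.succ
    rw [Matrix.mul_apply, Fin.sum_univ_succ] at this
    simpa [Matrix.mul_apply, Matrix.one_apply] using this
  · ext i j
    have := congr_fun₂ h2 i.succ j.succ
    rw [Matrix.mul_apply, Fin.sum_univ_succ] at this
    simpa [Matrix.mul_apply, Matrix.one_apply] using this

end consDiag

/-- Moving an entry of maximal valuation to the top left and clearing its row and column. -/
theorem exists_consDiag_of_pivot {N : ℕ} (X : Matrix (Fin (N + 1)) (Fin (N + 1)) D)
    (i₀ j₀ : Fin (N + 1)) (h0 : X i₀ j₀ ≠ 0) (h : ∀ i j, v (X i j) ≤ v (X i₀ j₀)) :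
    ∃ U ∈ GLOrder (Fin (N + 1)) v.integer, ∃ V ∈ GLOrder (Fin (N + 1)) v.integer, ∃ X',
      U.1 * X * V.1 = consDiag (X i₀ j₀) X' := by
  set P : (Matrix (Fin (N + 1)) (Fin (N + 1)) D)ˣ := permUnit (Equiv.swap 0 i₀)
  set Q : (Matrix (Fin (N + 1)) (Fin (N + 1)) D)ˣ := permUnit (Equiv.swap 0 j₀)
  set Y := P.1 * X * Q.1 with hY
  have hYe : ∀ i j, Y i j = X (Equiv.swap 0 i₀ i) (Equiv.swap 0 j₀ j) := by
    intro i j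
    rw [hY, mul_permUnit_apply, permUnit_mul_apply, Equiv.symm_swap]
  have hY00 : Y 0 0 = X i₀ j₀ := by rw [hYe]; simp
  obtain ⟨U, hU, hU1, hU2⟩ := exists_clear_column (v := v) Y 0 0 (by rwa [hY00])
    (fun i => by rw [hYe, hY00]; exact h _ _)
  obtain ⟨V, hV, hV1, hV2⟩ := exists_clear_row (v := v) (U.1 * Y) 0 0 (by rwa [hU2, hY00])
    (fun j => by rw [hU2, hU2, hYe, hY00]; exact h _ _)
  refine ⟨U * P, mul_mem hU (permUnit_mem _), Q * V, mul_mem (permUnit_mem _) hV,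
    (U.1 * Y * V.1).submatrix Fin.succ Fin.succ, ?_⟩
  have e : (U * P).1 * X * (Q * V).1 = U.1 * Y * V.1 := by
    simp only [hY, Units.val_mul, mul_assoc]
  rw [e]
  have := eq_consDiag hV1 (fun i hi => by rw [hV2, hU1 i hi])
  rwa [hV2, hU2, hY00] at this

variable (v) in
/-- `X = U diag(d₁, …, d_N) V` with `U`, `V` invertible over the valuation ring and `d_i` of
valuation `e₁ ≤ ⋯ ≤ e_N`.  In contrast to `HasElementaryDivisors` the `e_i` may be negative. -/
def HasIntElementaryDivisors {N : ℕ} (X : Matrix (Fin N) (Fin N) D) (e : Fin N → ℤ) : Prop :=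
  Monotone e ∧ ∃ U ∈ GLOrder (Fin N) v.integer, ∃ V ∈ GLOrder (Fin N) v.integer,
    ∃ d : Fin N → D, (∀ i, v (d i) = WithZero.exp (-e i)) ∧ X = U.1 * Matrix.diagonal d * V.1

namespace HasIntElementaryDivisors

variable {N : ℕ}

theorem mul_mul {X : Matrix (Fin N) (Fin N) D} {e : Fin N → ℤ}
    (h : HasIntElementaryDivisors v X e) {U V : (Matrix (Fin N) (Fin N) D)ˣ}
    (hU : U ∈ GLOrder (Fin N) v.integer) (hV : V ∈ GLOrder (Fin N) v.integer) :
    HasIntElementaryDivisors v (U.1 * X * V.1) e := by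
  obtain ⟨he, U', hU', V', hV', d, hd, rfl⟩ := h
  exact ⟨he, U * U', mul_mem hU hU', V' * V, mul_mem hV' hV, d, hd, by
    simp only [Units.val_mul, mul_assoc]⟩

theorem mul_left {X : Matrix (Fin N) (Fin N) D} {e : Fin N → ℤ}
    (h : HasIntElementaryDivisors v X e) {U : (Matrix (Fin N) (Fin N) D)ˣ}
    (hU : U ∈ GLOrder (Fin N) v.integer) : HasIntElementaryDivisors v (U.1 * X) e := by
  simpa using h.mul_mul hU (one_mem _)

theorem mul_right {X : Matrix (Fin N) (Fin N) D} {e : Fin N → ℤ}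
    (h : HasIntElementaryDivisors v X e) {V : (Matrix (Fin N) (Fin N) D)ˣ}
    (hV : V ∈ GLOrder (Fin N) v.integer) : HasIntElementaryDivisors v (X * V.1) e := by
  simpa using h.mul_mul (one_mem _) hV

theorem isUnit {X : Matrix (Fin N) (Fin N) D} {e : Fin N → ℤ}
    (h : HasIntElementaryDivisors v X e) : IsUnit X := by
  obtain ⟨-, U, -, V, -, d, hd, rfl⟩ := h
  refine (U.isUnit.mul ?_).mul V.isUnit
  have h0 : ∀ i, d i ≠ 0 := fun i hi => by simpa [hi] using (hd i).symm
  exact ⟨⟨Matrix.diagonal d, Matrix.diagonal fun i => (d i)⁻¹, by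
    simp [h0, Matrix.diagonal_mul_diagonal], by simp [h0, Matrix.diagonal_mul_diagonal]⟩, rfl⟩

theorem valuation_le {X : Matrix (Fin (N + 1)) (Fin (N + 1)) D} {e : Fin (N + 1) → ℤ}
    (h : HasIntElementaryDivisors v X e) (i j : Fin (N + 1)) : v (X i j) ≤ WithZero.exp (-e 0) := by
  obtain ⟨he, U, hU, V, hV, d, hd, rfl⟩ := h
  refine valuation_mul_GLOrder_le hV (valuation_GLOrder_mul_le hU fun i j => ?_) i j
  rw [Matrix.diagonal_apply]
  split_ifs
  · rw [hd, WithZero.exp_le_exp]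
    exact neg_le_neg (he (Fin.zero_le i))
  · simp

/-- If all entries are bounded by `exp (-c)` then all elementary divisor valuations are at
least `c`. -/
theorem le_of_valuation_le {X : Matrix (Fin N) (Fin N) D} {e : Fin N → ℤ}
    (h : HasIntElementaryDivisors v X e) {c : ℤ} (hc : ∀ i j, v (X i j) ≤ WithZero.exp (-c))
    (i : Fin N) : c ≤ e i := by
  obtain ⟨he, U, hU, V, hV, d, hd, rfl⟩ := h
  have h1 := valuation_GLOrder_mul_le (inv_mem hU) (valuation_mul_GLOrder_le (inv_mem hV) hc) i i
  have h2 : (U⁻¹).1 * (U.1 * Matrix.diagonal d * V.1 * (V⁻¹).1) = Matrix.diagonal d := by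
    rw [mul_assoc _ V.1, V.mul_inv, mul_one, ← mul_assoc, U.inv_mul, one_mul]
  rw [h2, Matrix.diagonal_apply_eq, hd, WithZero.exp_le_exp] at h1
  linarith

theorem consDiag {X : Matrix (Fin N) (Fin N) D} {e : Fin N → ℤ}
    (h : HasIntElementaryDivisors v X e) {a : D} {c : ℤ} (ha : v a = WithZero.exp (-c))
    (hc : ∀ i, c ≤ e i) :
    HasIntElementaryDivisors v (consDiag a X) (Fin.cons c e : Fin (N + 1) → ℤ) := by
  obtain ⟨he, U, hU, V, hV, d, hd, rfl⟩ := h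
  refine ⟨?_, consDiagUnit U, consDiagUnit_mem hU, consDiagUnit V, consDiagUnit_mem hV,
    Fin.cons a d, ?_, ?_⟩
  · intro i j hij
    cases i using Fin.cases with
    | zero => cases j using Fin.cases <;> simp [hc]
    | succ i =>
      cases j using Fin.cases with
      | zero => exact absurd hij (by simp)
      | succ j => simpa using he (Fin.succ_le_succ_iff.1 hij)
  · intro i
    cases i using Fin.cases <;> simp [ha, hd]
  · rw [← consDiag_diagonal, consDiagUnit_val, consDiagUnit_val, consDiag_mul, consDiag_mul]
    simp

end HasIntElementaryDivisors

/-- The elementary divisor theorem over a discretely valued division ring. -/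
theorem exists_hasIntElementaryDivisors {N : ℕ} (X : Matrix (Fin N) (Fin N) D) (hX : IsUnit X) :
    ∃ e, HasIntElementaryDivisors v X e := by
  induction N with
  | zero =>
    exact ⟨0, fun _ _ _ => le_rfl, 1, one_mem _, 1, one_mem _, 0, fun i => i.elim0,
      Subsingleton.elim _ _⟩
  | succ N ih =>
    obtain ⟨p, hp⟩ := Finite.exists_max (fun p : Fin (N + 1) × Fin (N + 1) => v (X p.1 p.2))
    have h0 : X p.1 p.2 ≠ 0 := by
      intro h0
      have : X = 0 := by
        ext i j
        have := hp (i, j)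
        rw [h0, map_zero, le_zero_iff, map_eq_zero] at this
        exact this
      exact hX.ne_zero this
    obtain ⟨U, hU, V, hV, X', e⟩ := exists_consDiag_of_pivot (v := v) X p.1 p.2 h0
      (fun i j => hp (i, j))
    have hX' : IsUnit X' := by
      refine isUnit_of_isUnit_consDiag (a := X p.1 p.2) ?_
      rw [← e]
      exact (U.isUnit.mul hX).mul V.isUnit
    obtain ⟨e', he'⟩ := ih X' hX'
    obtain ⟨c, hc⟩ : ∃ c : ℤ, v (X p.1 p.2) = WithZero.exp (-c) :=
      ⟨-WithZero.log (v (X p.1 p.2)), by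
        rw [neg_neg, WithZero.exp_log (by simpa using h0)]⟩
    have hle : ∀ i, c ≤ e' i := he'.le_of_valuation_le fun i j => by
      have := valuation_mul_GLOrder_le hV (valuation_GLOrder_mul_le hU fun i j => hp (i, j))
        i.succ j.succ
      rwa [e, consDiag_succ_succ, hc] at this
    refine ⟨Fin.cons c e', ?_⟩
    have := (he'.consDiag hc hle).mul_mul (inv_mem hU) (inv_mem hV)
    rw [← e] at this
    have h2 : (U⁻¹).1 * (U.1 * X * V.1) * (V⁻¹).1 = X := by
      rw [mul_assoc, mul_assoc _ V.1, V.mul_inv, mul_one, ← mul_assoc, U.inv_mul, one_mul]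
    rwa [h2] at this

theorem valuation_vecMul_le {ι : Type*} [Fintype ι] [DecidableEq ι] {U : (Matrix ι ι D)ˣ}
    (hU : U ∈ GLOrder ι v.integer) {x : ι → D} {c : ℤᵐ⁰} (hx : ∀ i, v (x i) ≤ c) (j : ι) :
    v ((x ᵥ* U.1) j) ≤ c := by
  refine v.map_sum_le fun k _ => ?_
  rw [map_mul]
  simpa using mul_le_mul' (hx k) ((mem_GLOrder_iff.1 hU).1 k j)

/-- A dimension count: some nonzero row vector `x` vanishes in the coordinates before `i` while
`x U` vanishes in those after `i`; the two diagonal forms stretch `x` by at most `e i` and at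
least `e' i`. -/
theorem HasIntElementaryDivisors.le {N : ℕ} {X : Matrix (Fin N) (Fin N) D} {e e' : Fin N → ℤ}
    (h : HasIntElementaryDivisors v X e) (h' : HasIntElementaryDivisors v X e') (i : Fin N) :
    e i ≤ e' i := by
  obtain ⟨he, U₁, hU₁, V₁, hV₁, d, hd, rfl⟩ := h
  obtain ⟨he', U₂, hU₂, V₂, hV₂, d', hd', h2⟩ := h'
  set U := U₁⁻¹ * U₂ with hU
  set V := V₂ * V₁⁻¹ with hV
  have hUm : U ∈ GLOrder (Fin N) v.integer := mul_mem (inv_mem hU₁) hU₂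
  have hVm : V ∈ GLOrder (Fin N) v.integer := mul_mem hV₂ (inv_mem hV₁)
  have hdd : Matrix.diagonal d = U.1 * Matrix.diagonal d' * V.1 := by
    have : (U₁⁻¹).1 * (U₁.1 * Matrix.diagonal d * V₁.1) * (V₁⁻¹).1 = Matrix.diagonal d := by
      rw [mul_assoc, mul_assoc _ V₁.1, V₁.mul_inv, mul_one, ← mul_assoc, U₁.inv_mul, one_mul]
    rw [← this, h2, hU, hV]
    simp only [Units.val_mul, mul_assoc]
  by_contra! hlt
  let f : (Fin N → D) →ₗ[D] ({j : Fin N // j ≠ i} → D) :=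
    { toFun := fun x j => if j.1 < i then x j else (x ᵥ* U.1) j
      map_add' := fun x y => by
        ext j
        simp only [Matrix.add_vecMul, Pi.add_apply]
        split_ifs <;> rfl
      map_smul' := fun c x => by
        ext j
        simp only [Matrix.smul_vecMul, Pi.smul_apply, RingHom.id_apply]
        split_ifs <;> rfl }
  have hker : LinearMap.ker f ≠ ⊥ := by
    apply LinearMap.ker_ne_bot_of_finrank_lt
    rw [Module.finrank_fintype_fun_eq_card, Module.finrank_fintype_fun_eq_card]
    exact Fintype.card_subtype_lt (x := i) (by simp)
  obtain ⟨x, hx, hx0⟩ := (Submodule.ne_bot_iff _).1 hker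
  have hfx : ∀ j : {j : Fin N // j ≠ i}, (if j.1 < i then x j else (x ᵥ* U.1) j) = 0 :=
    fun j => congr_fun (LinearMap.mem_ker.1 hx) j
  have hx1 : ∀ j, j < i → x j = 0 := fun j hj => by simpa [hj] using hfx ⟨j, hj.ne⟩
  have hx2 : ∀ j, i < j → (x ᵥ* U.1) j = 0 := fun j hj => by
    simpa [hj.not_gt] using hfx ⟨j, hj.ne'⟩
  have : Nonempty (Fin N) := ⟨i⟩
  obtain ⟨i₀, hi₀⟩ := Finite.exists_max (fun j => v (x j))
  set c := v (x i₀) with hc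
  have hc0 : 0 < c := by
    rw [zero_lt_iff]
    intro h0
    refine hx0 (funext fun j => ?_)
    have := hi₀ j
    rw [h0, le_zero_iff, map_eq_zero] at this
    exact this
  -- `y = x diag(d) = x U diag(d') V`
  have hy : ∀ j, v ((x ᵥ* Matrix.diagonal d) j) ≤ c * WithZero.exp (-e i) := by
    intro j
    rw [Matrix.vecMul_diagonal, map_mul, hd]
    by_cases hj : j < i
    · simp [hx1 j hj]
    · refine mul_le_mul' (hi₀ j) ?_
      rw [WithZero.exp_le_exp]
      exact neg_le_neg (he (not_lt.1 hj))
  have hz : (x ᵥ* Matrix.diagonal d) ᵥ* (V⁻¹).1 = (x ᵥ* U.1) ᵥ* Matrix.diagonal d' := by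
    rw [hdd, Matrix.vecMul_vecMul, Matrix.vecMul_vecMul, mul_assoc _ V.1, V.mul_inv, mul_one]
  have hz1 : ∀ j, v ((x ᵥ* U.1) j) ≤ c * WithZero.exp (e' i - e i) := by
    intro j
    by_cases hj : i < j
    · simp [hx2 j hj]
    · have h1 := valuation_vecMul_le (inv_mem hVm) hy j
      rw [hz, Matrix.vecMul_diagonal, map_mul, hd'] at h1
      have h2 : v ((x ᵥ* U.1) j) ≤ c * WithZero.exp (e' j - e i) := by
        calc v ((x ᵥ* U.1) j) = v ((x ᵥ* U.1) j) * WithZero.exp (-e' j) * WithZero.exp (e' j) := by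
              rw [mul_assoc, ← WithZero.exp_add]; simp
          _ ≤ c * WithZero.exp (-e i) * WithZero.exp (e' j) := mul_le_mul' h1 le_rfl
          _ = c * WithZero.exp (e' j - e i) := by
              rw [mul_assoc, ← WithZero.exp_add]; congr 2; ring
      refine h2.trans (mul_le_mul' le_rfl ?_)
      rw [WithZero.exp_le_exp]
      exact sub_le_sub_right (he' (not_lt.1 hj)) _
  have hx3 : (x ᵥ* U.1) ᵥ* (U⁻¹).1 = x := by
    rw [Matrix.vecMul_vecMul, U.mul_inv, Matrix.vecMul_one]
  have h4 := valuation_vecMul_le (inv_mem hUm) hz1 i₀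
  rw [hx3, ← hc] at h4
  have h5 : WithZero.exp (e' i - e i) < 1 := by
    rw [← WithZero.exp_zero, WithZero.exp_lt_exp]
    linarith
  have h6 : c * WithZero.exp (e' i - e i) < c * 1 := mul_lt_mul_of_pos_left h5 hc0
  rw [mul_one] at h6
  exact absurd h4 (not_le.2 h6)

theorem HasIntElementaryDivisors.unique {N : ℕ} {X : Matrix (Fin N) (Fin N) D} {e e' : Fin N → ℤ}
    (h : HasIntElementaryDivisors v X e) (h' : HasIntElementaryDivisors v X e') : e = e' :=
  funext fun i => le_antisymm (h.le h' i) (h'.le h i)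

end ValuedMatrices

end LocalHecke

end

noncomputable section

namespace LocalHecke

/-! ### Elementary divisors of products -/

section Products

variable {D : Type*} [DivisionRing D] {v : Valuation D ℤᵐ⁰}

/-- The diagonal matrix with nonzero entries `d i` as a unit. -/
def diagonalUnit {ι : Type*} [Fintype ι] [DecidableEq ι] (d : ι → D) (hd : ∀ i, d i ≠ 0) :
    (Matrix ι ι D)ˣ where
  val := Matrix.diagonal d
  inv := Matrix.diagonal fun i => (d i)⁻¹
  val_inv := by simp [hd, Matrix.diagonal_mul_diagonal]
  inv_val := by simp [hd, Matrix.diagonal_mul_diagonal]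

theorem diagonalUnit_mem {ι : Type*} [Fintype ι] [DecidableEq ι] {d : ι → D} (hd : ∀ i, d i ≠ 0)
    (h : ∀ i, v (d i) = 1) : diagonalUnit d hd ∈ GLOrder ι v.integer := by
  refine mem_GLOrder_iff.2 ⟨fun i j => ?_, fun i j => ?_⟩
  · change v (Matrix.diagonal d i j) ≤ 1
    rw [Matrix.diagonal_apply]
    split_ifs <;> simp [h]
  · change v (Matrix.diagonal (fun i => (d i)⁻¹) i j) ≤ 1
    rw [Matrix.diagonal_apply]
    split_ifs <;> simp [h]

namespace HasIntElementaryDivisors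

variable {N : ℕ} {e f : Fin N → ℤ}

theorem exists_eq_mul_mul {X Y : Matrix (Fin N) (Fin N) D} (hX : HasIntElementaryDivisors v X e)
    (hY : HasIntElementaryDivisors v Y e) :
    ∃ U ∈ GLOrder (Fin N) v.integer, ∃ V ∈ GLOrder (Fin N) v.integer, Y = U.1 * X * V.1 := by
  obtain ⟨-, U, hU, V, hV, d, hd, rfl⟩ := hX
  obtain ⟨-, U', hU', V', hV', d', hd', rfl⟩ := hY
  have h0 : ∀ i, d i ≠ 0 := fun i hi => by simpa [hi] using (hd i).symm
  have h0' : ∀ i, d' i ≠ 0 := fun i hi => by simpa [hi] using (hd' i).symm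
  let W : (Matrix (Fin N) (Fin N) D)ˣ :=
    diagonalUnit (fun i => d' i * (d i)⁻¹) fun i => mul_ne_zero (h0' i) (inv_ne_zero (h0 i))
  have hW : W ∈ GLOrder (Fin N) v.integer := diagonalUnit_mem _ fun i => by
    rw [map_mul, map_inv₀, hd, hd', mul_inv_cancel₀ WithZero.exp_ne_zero]
  have hWd : W.1 * Matrix.diagonal d = Matrix.diagonal d' := by
    change Matrix.diagonal _ * _ = _
    rw [Matrix.diagonal_mul_diagonal]
    congr 1
    funext i
    rw [mul_assoc, inv_mul_cancel₀ (h0 i), mul_one]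
  refine ⟨U' * W * U⁻¹, mul_mem (mul_mem hU' hW) (inv_mem hU), V⁻¹ * V',
    mul_mem (inv_mem hV) hV', ?_⟩
  calc U'.1 * Matrix.diagonal d' * V'.1
      = U'.1 * W.1 * ((U⁻¹).1 * U.1) * Matrix.diagonal d * (V.1 * (V⁻¹).1) * V'.1 := by
        rw [U.inv_mul, V.mul_inv, mul_one, mul_one, mul_assoc U'.1 W.1, hWd]
    _ = _ := by simp only [Units.val_mul, mul_assoc]

theorem exists_mul_mul_add {X Y : Matrix (Fin N) (Fin N) D} (hX : HasIntElementaryDivisors v X e)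
    (hY : HasIntElementaryDivisors v Y f) :
    ∃ U ∈ GLOrder (Fin N) v.integer, HasIntElementaryDivisors v (X * U.1 * Y) (e + f) := by
  obtain ⟨he, U, hU, V, hV, d, hd, rfl⟩ := hX
  obtain ⟨hf, U', hU', V', hV', d', hd', rfl⟩ := hY
  refine ⟨V⁻¹ * U'⁻¹, mul_mem (inv_mem hV) (inv_mem hU'), he.add hf, U, hU, V', hV',
    fun i => d i * d' i, fun i => ?_, ?_⟩
  · rw [map_mul, hd, hd', ← WithZero.exp_add, Pi.add_apply, neg_add]
  · rw [← Matrix.diagonal_mul_diagonal]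
    calc _ = U.1 * Matrix.diagonal d * (V.1 * (V⁻¹).1) * ((U'⁻¹).1 * U'.1) * Matrix.diagonal d' *
          V'.1 := by simp only [Units.val_mul, mul_assoc]
      _ = _ := by rw [U'.inv_mul, V.mul_inv, mul_one, mul_one]; simp only [mul_assoc]

/-- The lower right block of `diag(a, X)` has the remaining elementary divisors when `a` realizes
the first one. -/
theorem tail {a : D} {X : Matrix (Fin N) (Fin N) D} {e : Fin (N + 1) → ℤ}
    (h : HasIntElementaryDivisors v (LocalHecke.consDiag a X) e)
    (ha : v a = WithZero.exp (-e 0)) : HasIntElementaryDivisors v X (Fin.tail e) := by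
  obtain ⟨e', he'⟩ :=
    exists_hasIntElementaryDivisors (v := v) X (isUnit_of_isUnit_consDiag h.isUnit)
  have h1 := he'.consDiag ha (he'.le_of_valuation_le fun i j => h.valuation_le i.succ j.succ)
  rw [h.unique h1]
  exact he'

end HasIntElementaryDivisors

/-- If `x G` is a multiple of the first basis vector, of the largest valuation that the bounds for
`x` and `G` allow, then `G` splits off a `1 × 1` block after row operations.  A coefficient of `x`
of maximal valuation makes the replacement of a row of `G` by a multiple of `x G` invertible. -/
theorem exists_mul_eq_consDiag {N : ℕ} {x : Fin (N + 1) → D}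
    {G : Matrix (Fin (N + 1)) (Fin (N + 1)) D} {c d : ℤᵐ⁰} (hc : c ≠ 0) (hd : d ≠ 0)
    (hx : ∀ i, v (x i) ≤ c) (hG : ∀ i j, v (G i j) ≤ d)
    (h0 : ∀ j, j ≠ 0 → (x ᵥ* G) j = 0) (hz : v ((x ᵥ* G) 0) = c * d) :
    ∃ U ∈ GLOrder (Fin (N + 1)) v.integer, ∃ b G', U.1 * G = consDiag b G' ∧ v b = d := by
  obtain ⟨i, hi⟩ : ∃ i, c ≤ v (x i) := by
    by_contra! hlt
    have : v ((x ᵥ* G) 0) < c * d := by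
      change v (∑ k, x k * G k 0) < _
      refine v.map_sum_lt (mul_ne_zero hc hd) fun k _ => ?_
      rw [map_mul]
      calc v (x k) * v (G k 0) ≤ v (x k) * d := mul_le_mul' le_rfl (hG k 0)
        _ < c * d := mul_lt_mul_of_pos_right (hlt k) (zero_lt_iff.2 hd)
    exact this.ne hz
  have hxi : v (x i) = c := le_antisymm (hx i) hi
  have hxi0 : x i ≠ 0 := by
    intro h
    rw [h, map_zero] at hxi
    exact hc hxi.symm
  let M : Matrix (Fin (N + 1)) (Fin (N + 1)) D :=
    fun k l => if k = i then (if l = i then 0 else (x i)⁻¹ * x l) else 0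
  have hM : M * M = 0 := by
    ext k l
    rw [Matrix.mul_apply]
    refine Finset.sum_eq_zero fun j _ => ?_
    by_cases hj : j = i <;> simp [M, hj]
  have hR : oneAddUnit M hM ∈ GLOrder (Fin (N + 1)) v.integer := by
    refine oneAddUnit_mem hM fun k l => ?_
    simp only [M]
    split_ifs
    · simp
    · rw [map_mul, map_inv₀, hxi]
      exact inv_mul_le_one_of_le₀ (hx l) zero_le
    · simp
  have hRG : ∀ j, ((oneAddUnit M hM).1 * G) i j = (x i)⁻¹ * (x ᵥ* G) j := by
    intro j
    change ((1 + M) * G) i j = (x i)⁻¹ * ∑ k, x k * G k j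
    rw [add_mul, one_mul, Matrix.add_apply, Matrix.mul_apply, Finset.mul_sum,
      ← Finset.add_sum_erase _ _ (Finset.mem_univ i),
      ← Finset.add_sum_erase _ (fun k => (x i)⁻¹ * (x k * G k j)) (Finset.mem_univ i)]
    simp only [M, if_true, zero_mul, zero_add]
    rw [← mul_assoc, inv_mul_cancel₀ hxi0, one_mul]
    congr 1
    refine Finset.sum_congr rfl fun k hk => ?_
    rw [if_neg (Finset.ne_of_mem_erase hk), mul_assoc]
  set P : (Matrix (Fin (N + 1)) (Fin (N + 1)) D)ˣ := permUnit (Equiv.swap 0 i)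
  set Y := (P * oneAddUnit M hM).1 * G with hY
  have hYb : ∀ k l, v (Y k l) ≤ d :=
    fun k l => valuation_GLOrder_mul_le (mul_mem (permUnit_mem _) hR) hG k l
  have hY0 : ∀ j, Y 0 j = (x i)⁻¹ * (x ᵥ* G) j := by
    intro j
    rw [hY, Units.val_mul, mul_assoc, permUnit_mul_apply, Equiv.swap_apply_left, hRG]
  have hY00 : v (Y 0 0) = d := by
    rw [hY0, map_mul, map_inv₀, hz, hxi, inv_mul_cancel_left₀ hc]
  obtain ⟨U, hU, hU1, hU2⟩ := exists_clear_column (v := v) Y 0 0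
    (by rw [← v.ne_zero_iff, hY00]; exact hd) (fun k => by rw [hY00]; exact hYb k 0)
  refine ⟨U * (P * oneAddUnit M hM), mul_mem hU (mul_mem (permUnit_mem _) hR), Y 0 0,
    (U.1 * Y).submatrix Fin.succ Fin.succ, ?_, hY00⟩
  have := eq_consDiag (Y := U.1 * Y) (fun j hj => by rw [hU2, hY0, h0 j hj, mul_zero]) hU1
  rw [hU2] at this
  rwa [Units.val_mul U, mul_assoc, ← hY]

/-- A factorization of `diag(z, Z)`, where the valuation of `z` is as small as the first
elementary divisors of the factors permit, is block diagonal up to a unit in the middle. -/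
theorem exists_factors_consDiag {N : ℕ} {e f : Fin (N + 1) → ℤ}
    {X Y : Matrix (Fin (N + 1)) (Fin (N + 1)) D} (hX : HasIntElementaryDivisors v X e)
    (hY : HasIntElementaryDivisors v Y f) {z : D} {Z : Matrix (Fin N) (Fin N) D}
    (hXY : X * Y = consDiag z Z) (hz : v z = WithZero.exp (-(e 0 + f 0))) :
    ∃ U ∈ GLOrder (Fin (N + 1)) v.integer, ∃ b, ∃ X' Y' : Matrix (Fin N) (Fin N) D,
      U.1 * Y = consDiag b Y' ∧ v b = WithZero.exp (-f 0) ∧ X' * Y' = Z ∧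
      HasIntElementaryDivisors v X' (Fin.tail e) ∧ HasIntElementaryDivisors v Y' (Fin.tail f) := by
  have hrow : ∀ j, (X 0 ᵥ* Y) j = consDiag z Z 0 j := fun j => by
    rw [← hXY]; rfl
  obtain ⟨U, hU, b, Y', hUY, hb⟩ := exists_mul_eq_consDiag (v := v) (x := X 0) (G := Y)
    (WithZero.exp_ne_zero (a := -e 0)) (WithZero.exp_ne_zero (a := -f 0)) (hX.valuation_le 0)
    hY.valuation_le
    (fun j hj => by
      rw [hrow]
      cases j using Fin.cases with
      | zero => exact absurd rfl hj
      | succ j => rfl)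
    (by rw [hrow, consDiag_zero_zero, hz, ← WithZero.exp_add, neg_add])
  have hb0 : b ≠ 0 := by
    rw [← v.ne_zero_iff, hb]
    exact WithZero.exp_ne_zero
  have hYt := hY.mul_left hU
  rw [hUY] at hYt
  set W := X * (U⁻¹).1 with hW
  have hWt : HasIntElementaryDivisors v W e := hX.mul_right (inv_mem hU)
  have hWY : W * consDiag b Y' = consDiag z Z := by
    rw [← hUY, ← hXY, hW, mul_assoc, ← mul_assoc _ U.1, U.inv_mul, one_mul]
  obtain ⟨u, hu⟩ := isUnit_of_isUnit_consDiag hYt.isUnit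
  have hWdiag : W = consDiag (z * b⁻¹) (Z * (u⁻¹).1) := by
    have h1 : consDiag b Y' * consDiag b⁻¹ (u⁻¹).1 = 1 := by
      rw [consDiag_mul, mul_inv_cancel₀ hb0, ← hu, u.mul_inv, consDiag_one_one]
    rw [← consDiag_mul, ← hWY, mul_assoc, h1, mul_one]
  have hva : v (z * b⁻¹) = WithZero.exp (-e 0) := by
    rw [map_mul, map_inv₀, hz, hb, ← WithZero.exp_neg, ← WithZero.exp_add]
    congr 1
    ring
  rw [hWdiag] at hWt
  exact ⟨U, hU, b, _, Y', hUY, hb, by rw [mul_assoc, ← hu, u.inv_mul, mul_one], hWt.tail hva,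
    hYt.tail hb⟩

/-- The leading term inequality for elementary divisors: at the first place where they differ, the
elementary divisor valuation of the product is larger than the sum of those of the factors. -/
theorem HasIntElementaryDivisors.eq_add_or_lt {N : ℕ} {e f g : Fin N → ℤ}
    {X Y : Matrix (Fin N) (Fin N) D} (hX : HasIntElementaryDivisors v X e)
    (hY : HasIntElementaryDivisors v Y f) (hXY : HasIntElementaryDivisors v (X * Y) g) :
    g = e + f ∨ ∃ i, (e + f) i < g i ∧ ∀ j < i, g j = (e + f) j := by
  induction N with
  | zero => exact Or.inl (Subsingleton.elim _ _)
  | succ N ih =>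
    obtain ⟨hg, U, hU, V, hV, d, hd, h⟩ := hXY
    have hprod : ((U⁻¹).1 * X) * (Y * (V⁻¹).1) =
        LocalHecke.consDiag (d 0) (Matrix.diagonal (Fin.tail d)) := by
      rw [consDiag_diagonal, Fin.cons_self_tail]
      calc _ = (U⁻¹).1 * (X * Y) * (V⁻¹).1 := by simp only [mul_assoc]
        _ = Matrix.diagonal d := by
          rw [h, mul_assoc, mul_assoc _ V.1, V.mul_inv, mul_one, ← mul_assoc, U.inv_mul, one_mul]
    have hX' := hX.mul_left (inv_mem hU)
    have hY' := hY.mul_right (inv_mem hV)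
    have hle : e 0 + f 0 ≤ g 0 := by
      have h1 := valuation_mul_apply_le hX'.valuation_le hY'.valuation_le 0 0
      rw [hprod, consDiag_zero_zero, hd, ← WithZero.exp_add, WithZero.exp_le_exp] at h1
      linarith
    rcases hle.lt_or_eq with hlt | heq
    · exact Or.inr ⟨0, hlt, fun j hj => absurd hj (by simp)⟩
    obtain ⟨W, hW, b, X₁, Y₁, -, -, hp, hX₁, hY₁⟩ :=
      exists_factors_consDiag hX' hY' hprod (by rw [hd, heq])
    have hZ : HasIntElementaryDivisors v (X₁ * Y₁) (Fin.tail g) := by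
      rw [hp]
      exact ⟨fun i j hij => hg (Fin.succ_le_succ_iff.2 hij), 1, one_mem _, 1, one_mem _,
        Fin.tail d, fun i => hd i.succ, by simp⟩
    rcases ih hX₁ hY₁ hZ with h2 | ⟨i, hi, hj⟩
    · left
      funext i
      cases i using Fin.cases with
      | zero => exact heq.symm
      | succ i => exact congr_fun h2 i
    · refine Or.inr ⟨i.succ, hi, fun j hlt => ?_⟩
      cases j using Fin.cases with
      | zero => exact heq.symm
      | succ j => exact hj j (Fin.succ_lt_succ_iff.1 hlt)

/-- If the elementary divisors of a product are the sums of those of the factors, then the product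
and the elementary divisors determine the right factor up to an integral unit on its left.  By
`exists_factors_consDiag` two such factorizations are block diagonal after integral row operations
on the right factors, and the induction hypothesis applies to the lower right blocks. -/
theorem HasIntElementaryDivisors.exists_eq_mul_right_factor {N : ℕ} {e f : Fin N → ℤ}
    {X Y X₁ Y₁ : Matrix (Fin N) (Fin N) D} (hX : HasIntElementaryDivisors v X e)
    (hY : HasIntElementaryDivisors v Y f) (hX₁ : HasIntElementaryDivisors v X₁ e)
    (hY₁ : HasIntElementaryDivisors v Y₁ f) (hXY : HasIntElementaryDivisors v (X * Y) (e + f))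
    (heq : X * Y = X₁ * Y₁) : ∃ U ∈ GLOrder (Fin N) v.integer, Y₁ = U.1 * Y := by
  induction N with
  | zero => exact ⟨1, one_mem _, Subsingleton.elim _ _⟩
  | succ N ih =>
    obtain ⟨hg, U, hU, V, hV, d, hd, h⟩ := hXY
    have hred : ∀ A B : Matrix (Fin (N + 1)) (Fin (N + 1)) D, A * B = X * Y →
        ((U⁻¹).1 * A) * (B * (V⁻¹).1) =
        LocalHecke.consDiag (d 0) (Matrix.diagonal (Fin.tail d)) := by
      intro A B hAB
      rw [consDiag_diagonal, Fin.cons_self_tail]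
      calc _ = (U⁻¹).1 * (A * B) * (V⁻¹).1 := by simp only [mul_assoc]
        _ = Matrix.diagonal d := by
          rw [hAB, h, mul_assoc, mul_assoc _ V.1, V.mul_inv, mul_one, ← mul_assoc, U.inv_mul,
            one_mul]
    obtain ⟨W, hW, b, X', Y', hWY, hb, hp, hX', hY'⟩ :=
      exists_factors_consDiag (hX.mul_left (inv_mem hU)) (hY.mul_right (inv_mem hV))
        (hred X Y rfl) (hd 0)
    obtain ⟨W₁, hW₁, b₁, X₁', Y₁', hWY₁, hb₁, hp₁, hX₁', hY₁'⟩ :=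
      exists_factors_consDiag (hX₁.mul_left (inv_mem hU)) (hY₁.mul_right (inv_mem hV))
        (hred X₁ Y₁ heq.symm) (hd 0)
    obtain ⟨T, hT, hYT⟩ := ih hX' hY' hX₁' hY₁' (by
      rw [hp]
      exact ⟨fun i j hij => hg (Fin.succ_le_succ_iff.2 hij), 1, one_mem _, 1, one_mem _,
        Fin.tail d, fun i => hd i.succ, by simp⟩) (hp.trans hp₁.symm)
    have hb0 : b ≠ 0 := by
      rw [← v.ne_zero_iff, hb]
      exact WithZero.exp_ne_zero
    have hb₁0 : b₁ ≠ 0 := by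
      rw [← v.ne_zero_iff, hb₁]
      exact WithZero.exp_ne_zero
    let c : Fin (N + 1) → D := Fin.cons (b₁ * b⁻¹) (fun _ => 1)
    have hc0 : ∀ i, c i ≠ 0 := fun i => by
      cases i using Fin.cases <;> simp [c, hb0, hb₁0]
    have hc1 : ∀ i, v (c i) = 1 := fun i => by
      cases i using Fin.cases <;> simp [c, hb, hb₁]
    have key : W₁.1 * (Y₁ * (V⁻¹).1) =
        (diagonalUnit c hc0 * consDiagUnit T * W).1 * (Y * (V⁻¹).1) := by
      rw [Units.val_mul, mul_assoc, hWY, hWY₁, Units.val_mul, consDiagUnit_val]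
      change _ = Matrix.diagonal c * _ * _
      rw [← consDiag_diagonal, consDiag_mul, consDiag_mul, mul_one, inv_mul_cancel_right₀ hb0, hYT]
      simp
    refine ⟨W₁⁻¹ * (diagonalUnit c hc0 * consDiagUnit T * W), mul_mem (inv_mem hW₁)
      (mul_mem (mul_mem (diagonalUnit_mem _ hc1) (consDiagUnit_mem hT)) hW), ?_⟩
    have h3 : Y₁ = (W₁⁻¹).1 * (W₁.1 * (Y₁ * (V⁻¹).1)) * V.1 := by
      rw [← mul_assoc, W₁.inv_mul, one_mul, mul_assoc, V.inv_mul, mul_one]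
    rw [h3, key, mul_assoc, mul_assoc _ _ V.1, mul_assoc Y, V.inv_mul, mul_one, ← mul_assoc,
      ← Units.val_mul]

end Products

end LocalHecke

end

noncomputable section

namespace LocalHecke

/-! ### Finiteness of residue rings and the commensurator -/

section Finiteness

/-- An element lies in the commensurator of `H` if `H` has a partition into finitely many parts
such that the quotients within a part are conjugated into `H`, and likewise for the inverse. -/
theorem mem_commensurator_of_finite_range {𝒢 : Type*} [Group 𝒢] {H : Subgroup 𝒢} {g : 𝒢}
    {α : Type*}
    (h : ∀ x, x = g ∨ x = g⁻¹ → ∃ c : H → α, (Set.range c).Finite ∧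
      ∀ h h' : H, c h = c h' → x * ((h : 𝒢)⁻¹ * h') * x⁻¹ ∈ H) :
    g ∈ Subgroup.Commensurable.commensurator H := by
  have key : ∀ x, x = g ∨ x = g⁻¹ → (ConjAct.toConjAct x⁻¹ • H).relIndex H ≠ 0 := by
    intro x hx
    obtain ⟨c, hfin, hc⟩ := h x hx
    set S : Subgroup 𝒢 := ConjAct.toConjAct x⁻¹ • H with hS
    have hS' : ∀ y : 𝒢, y ∈ S ↔ x * y * x⁻¹ ∈ H := by
      intro y
      rw [hS, Subgroup.mem_pointwise_smul_iff_inv_smul_mem, ← ConjAct.toConjAct_inv,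
        ConjAct.toConjAct_smul]
      simp
    have := hfin.to_subtype
    have hq : Finite (H ⧸ S.subgroupOf H) := by
      refine Finite.of_injective
        (fun q : H ⧸ S.subgroupOf H => (⟨c (Quotient.out q), _, rfl⟩ : Set.range c)) ?_
      intro q q' hqq
      have h1 := hc _ _ (congr_arg Subtype.val hqq)
      rw [← QuotientGroup.out_eq' q, ← QuotientGroup.out_eq' q', QuotientGroup.eq,
        Subgroup.mem_subgroupOf, hS']
      exact h1
    exact Subgroup.index_ne_zero_of_finite
  rw [Subgroup.Commensurable.commensurator_mem_iff]
  refine ⟨by simpa using key g⁻¹ (Or.inr rfl), ?_⟩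
  have h1 := key g (Or.inl rfl)
  rw [← Subgroup.relIndex_pointwise_smul (ConjAct.toConjAct g), smul_smul] at h1
  simpa using h1

variable {D : Type*} [DivisionRing D] {v : Valuation D ℤᵐ⁰}

/-- If two integral matrices are congruent modulo a high power of the maximal ideal, then their
quotient is conjugated into `GL(𝒪)` by `g`. The invariant `c` records the residue classes of the
entries. -/
theorem exists_finite_range_conj_mem {ι : Type*} [Fintype ι] [DecidableEq ι]
    (hfin : ∀ k : ℤ, ∃ S : Set D, S.Finite ∧ ∀ x, v x ≤ 1 → ∃ s ∈ S, v (x - s) ≤ WithZero.exp (-k))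
    (g : (Matrix ι ι D)ˣ) : ∃ c : GLOrder ι v.integer → Matrix ι ι D, (Set.range c).Finite ∧
      ∀ h h', c h = c h' → g * ((h : (Matrix ι ι D)ˣ)⁻¹ * h') * g⁻¹ ∈ GLOrder ι v.integer := by
  classical
  have hbd : ∀ X : Matrix ι ι D, ∃ m : ℤ, ∀ i j, v (X i j) ≤ WithZero.exp m := by
    intro X
    obtain ⟨m, hm⟩ := (Finset.univ.image fun p : ι × ι => WithZero.log (v (X p.1 p.2))).bddAbove
    refine ⟨m, fun i j => ?_⟩
    by_cases h0 : v (X i j) = 0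
    · rw [h0]; exact zero_le
    · rw [← WithZero.exp_log h0, WithZero.exp_le_exp]
      exact hm (by simp)
  obtain ⟨m, hm⟩ := hbd g.1
  obtain ⟨m', hm'⟩ := hbd (g⁻¹).1
  obtain ⟨S, hS, hSx⟩ := hfin (m + m')
  choose! s hs hxs using hSx
  have hint := fun h : GLOrder ι v.integer => (mem_GLOrder_iff.1 h.2).1
  refine ⟨fun h => Matrix.of fun i j => s (h.1.1 i j), ?_, ?_⟩
  · refine (Set.Finite.pi' (ι := ι) (t := fun _ => {f : ι → D | ∀ j, f j ∈ S}) fun _ =>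
      Set.Finite.pi' fun _ => hS).subset ?_
    rintro _ ⟨h, rfl⟩ i j
    exact hs _ (hint h i j)
  · have half : ∀ h h' : GLOrder ι v.integer,
        (∀ i j, s (h.1.1 i j) = s (h'.1.1 i j)) → ∀ i j,
        v ((g * ((h : (Matrix ι ι D)ˣ)⁻¹ * h') * g⁻¹).1 i j) ≤ 1 := by
      intro h h' e i j
      have hd : ∀ i j, v ((h'.1.1 - h.1.1) i j) ≤ WithZero.exp (-(m + m')) := by
        intro i j
        have := v.map_sub_le (hxs _ (hint h' i j)) (hxs _ (hint h i j))
        rw [e i j, sub_sub_sub_cancel_right] at this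
        exact this
      have h1 := valuation_mul_apply_le
        (valuation_mul_apply_le hm (valuation_GLOrder_mul_le (inv_mem h.2) hd)) hm' i j
      rw [← WithZero.exp_add, ← WithZero.exp_add] at h1
      have e1 : m + -(m + m') + m' = 0 := by ring
      rw [e1, WithZero.exp_zero] at h1
      have e2 : (g * ((h : (Matrix ι ι D)ˣ)⁻¹ * h') * g⁻¹).1 =
          1 + g.1 * ((h.1⁻¹).1 * (h'.1.1 - h.1.1)) * (g⁻¹).1 := by
        rw [mul_sub, (h.1).inv_mul, mul_sub, sub_mul, mul_one, g.mul_inv]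
        simp
      rw [e2]
      refine v.map_add_le ?_ h1
      rw [Matrix.one_apply]
      split_ifs <;> simp
    intro h h' e
    have e' : ∀ i j, s (h.1.1 i j) = s (h'.1.1 i j) := fun i j => congr_fun₂ e i j
    refine mem_GLOrder_iff.2 ⟨half h h' e', ?_⟩
    have e3 : (g * ((h : (Matrix ι ι D)ˣ)⁻¹ * h') * g⁻¹)⁻¹ =
        g * ((h' : (Matrix ι ι D)ˣ)⁻¹ * h) * g⁻¹ := by group
    rw [e3]
    exact half h' h fun i j => (e' i j).symm

/-- Subgroups of preimages of `GL(𝒪)` that are cut out by conditions stable under conjugation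
are commensurated. -/
theorem mem_commensurator_of_map_GLOrder {ι : Type*} [Fintype ι] [DecidableEq ι]
    (hfin : ∀ k : ℤ, ∃ S : Set D, S.Finite ∧ ∀ x, v x ≤ 1 → ∃ s ∈ S, v (x - s) ≤ WithZero.exp (-k))
    {𝒢 : Type*} [Group 𝒢] (ρ : 𝒢 →* (Matrix ι ι D)ˣ) (H : Subgroup 𝒢) (g : 𝒢)
    (hH : ∀ h ∈ H, ρ h ∈ GLOrder ι v.integer)
    (hconj : ∀ x, x = g ∨ x = g⁻¹ → ∀ h ∈ H, ρ (x * h * x⁻¹) ∈ GLOrder ι v.integer →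
      x * h * x⁻¹ ∈ H) : g ∈ Subgroup.Commensurable.commensurator H := by
  refine mem_commensurator_of_finite_range (α := Matrix ι ι D) fun x hx => ?_
  obtain ⟨c, hc, hcc⟩ := exists_finite_range_conj_mem hfin (ρ x)
  refine ⟨fun h => c ⟨ρ h, hH h h.2⟩, hc.subset ?_, fun h h' e => ?_⟩
  · rintro _ ⟨h, rfl⟩
    exact ⟨_, rfl⟩
  · refine hconj x hx _ (H.mul_mem (H.inv_mem h.2) h'.2) ?_
    simpa using hcc _ _ e

/-- All residue rings `𝒪 / 𝔪ᵏ` are finite if the residue division ring is. -/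
theorem exists_finite_residues_exp (hsurj : Function.Surjective v)
    (hfin : ∃ S : Set D, S.Finite ∧ ∀ x, v x ≤ 1 → ∃ s ∈ S, v (x - s) < 1) (k : ℤ) :
    ∃ S : Set D, S.Finite ∧ ∀ x, v x ≤ 1 → ∃ s ∈ S, v (x - s) ≤ WithZero.exp (-k) := by
  obtain ⟨S, hS, hSx⟩ := hfin
  obtain ⟨ϖ, hϖ⟩ := hsurj (WithZero.exp (-1))
  have hϖ0 : ϖ ≠ 0 := by
    rw [← v.ne_zero_iff, hϖ]; exact WithZero.exp_ne_zero
  have key : ∀ k : ℕ, ∃ S : Set D, S.Finite ∧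
      ∀ x, v x ≤ 1 → ∃ s ∈ S, v (x - s) ≤ WithZero.exp (-(k : ℤ)) := by
    intro k
    induction k with
    | zero => exact ⟨{0}, Set.finite_singleton 0, fun x hx => ⟨0, rfl, by simpa using hx⟩⟩
    | succ k ih =>
      obtain ⟨T, hT, hTx⟩ := ih
      refine ⟨Set.image2 (fun s t => s + ϖ * t) S T, hS.image2 _ hT, fun x hx => ?_⟩
      obtain ⟨s, hs, hxs⟩ := hSx x hx
      have h1 : v (ϖ⁻¹ * (x - s)) ≤ 1 := by
        rw [map_mul, map_inv₀, hϖ]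
        by_cases h0 : v (x - s) = 0
        · simp [h0]
        · rw [← WithZero.exp_log h0, ← WithZero.exp_neg, ← WithZero.exp_add, ← WithZero.exp_zero,
            WithZero.exp_le_exp]
          rw [← WithZero.exp_log h0, ← WithZero.exp_zero, WithZero.exp_lt_exp] at hxs
          omega
      obtain ⟨t, ht, hxt⟩ := hTx _ h1
      refine ⟨s + ϖ * t, ⟨s, hs, t, ht, rfl⟩, ?_⟩
      have e : x - (s + ϖ * t) = ϖ * (ϖ⁻¹ * (x - s) - t) := by
        rw [mul_sub, mul_inv_cancel_left₀ hϖ0]; abel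
      rw [e, map_mul, hϖ]
      refine (mul_le_mul' le_rfl hxt).trans ?_
      rw [← WithZero.exp_add, WithZero.exp_le_exp]
      push_cast
      linarith
  obtain ⟨S', hS', h⟩ := key k.toNat
  refine ⟨S', hS', fun x hx => ?_⟩
  obtain ⟨s, hs, hxs⟩ := h x hx
  refine ⟨s, hs, hxs.trans ?_⟩
  rw [WithZero.exp_le_exp]
  have := Int.self_le_toNat k
  linarith

/-- The residue ring of a finite dimensional division algebra is finite: elements of the valuation
ring that are independent modulo the maximal ideal are linearly independent over `F`. -/
theorem exists_finite_residues_of_finiteDimensional {F : Type*} [Field F] [Algebra F D]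
    [FiniteDimensional F D] {vF : Valuation F ℤᵐ⁰}
    (hv : ∀ x, v (algebraMap F D x) ≤ 1 ↔ vF x ≤ 1)
    (hfin : ∃ S : Set F, S.Finite ∧ ∀ x, vF x ≤ 1 → ∃ s ∈ S, vF (x - s) < 1) :
    ∃ S : Set D, S.Finite ∧ ∀ x, v x ≤ 1 → ∃ s ∈ S, v (x - s) < 1 := by
  have hlt : ∀ x, vF x < 1 → v (algebraMap F D x) < 1 := by
    intro x hx
    by_cases h0 : x = 0
    · simp [h0]
    · have h1 : ¬ v (algebraMap F D x⁻¹) ≤ 1 := by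
        rw [hv, map_inv₀, not_le]
        exact (one_lt_inv₀ (zero_lt_iff.2 (by simpa using h0))).2 hx
      rw [map_inv₀, map_inv₀, not_le] at h1
      exact (one_lt_inv₀ (zero_lt_iff.2 (by simpa using h0))).1 h1
  let Indep : (m : ℕ) → (Fin m → D) → Prop := fun m x => (∀ i, v (x i) ≤ 1) ∧
    ∀ a : Fin m → F, (∀ i, vF (a i) ≤ 1) → v (∑ i, a i • x i) < 1 → ∀ i, vF (a i) < 1
  have hbound : ∀ m x, Indep m x → m ≤ Module.finrank F D := by
    rintro m x ⟨hx, hind⟩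
    have hli : LinearIndependent F x := by
      rw [Fintype.linearIndependent_iff]
      intro a ha
      by_contra! hne
      obtain ⟨i₁, hi₁⟩ := hne
      have : Nonempty (Fin m) := ⟨i₁⟩
      obtain ⟨i₀, hi₀⟩ := Finite.exists_max fun i => vF (a i)
      have h0 : 0 < vF (a i₀) :=
        lt_of_lt_of_le (zero_lt_iff.2 (by simpa using hi₁)) (hi₀ i₁)
      have := hind (fun i => (a i₀)⁻¹ * a i)
        (fun i => by
          rw [map_mul, map_inv₀]
          exact inv_mul_le_one_of_le₀ (hi₀ i) zero_le)
        (by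
          simp only [mul_smul]
          rw [← Finset.smul_sum, ha]
          simp) i₀
      rw [inv_mul_cancel₀ (by simpa using h0.ne'), map_one] at this
      exact lt_irrefl _ this
    simpa using hli.fintype_card_le_finrank
  obtain ⟨m, ⟨x, hx⟩, hmax⟩ : ∃ m, (∃ x, Indep m x) ∧ ¬ ∃ x, Indep (m + 1) x := by
    by_contra! hcon
    have hall : ∀ m, ∃ x, Indep m x := by
      intro m
      induction m with
      | zero => exact ⟨Fin.elim0, fun i => i.elim0, fun _ _ _ i => i.elim0⟩
      | succ m ih => exact hcon m ih
    obtain ⟨x, hx⟩ := hall (Module.finrank F D + 1)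
    have := hbound _ _ hx
    omega
  obtain ⟨S, hS, hSx⟩ := hfin
  refine ⟨(fun s : Fin m → F => ∑ i, s i • x i) '' {s | ∀ i, s i ∈ S},
    (Set.Finite.pi' fun _ => hS).image _, fun y hy => ?_⟩
  have hvle : ∀ (a : F) (z : D), vF a ≤ 1 → v z ≤ 1 → v (a • z) ≤ 1 := by
    intro a z ha hz
    rw [Algebra.smul_def, map_mul]
    exact mul_le_one' ((hv a).2 ha) hz
  have hvlt : ∀ (a : F) (z : D), vF a < 1 → v z ≤ 1 → v (a • z) < 1 := by
    intro a z ha hz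
    rw [Algebra.smul_def, map_mul]
    exact (mul_le_of_le_one_right' hz).trans_lt (hlt a ha)
  obtain ⟨a, ha, hsum, hne⟩ : ∃ a : Fin (m + 1) → F, (∀ i, vF (a i) ≤ 1) ∧
      v (∑ i, a i • (Fin.cons y x : Fin (m + 1) → D) i) < 1 ∧ ¬ ∀ i, vF (a i) < 1 := by
    by_contra! hcon
    refine hmax ⟨Fin.cons y x, fun i => ?_, hcon⟩
    cases i using Fin.cases with
    | zero => exact hy
    | succ i => exact hx.1 i
  rw [Fin.sum_univ_succ] at hsum
  simp only [Fin.cons_zero, Fin.cons_succ] at hsum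
  have ha0 : vF (a 0) = 1 := by
    refine le_antisymm (ha 0) (not_lt.1 fun hlt0 => hne fun i => ?_)
    cases i using Fin.cases with
    | zero => exact hlt0
    | succ i =>
      refine hx.2 (fun i => a i.succ) (fun i => ha _) ?_ i
      have := v.map_sub_lt hsum (hvlt _ _ hlt0 hy)
      rwa [add_sub_cancel_left] at this
  have ha00 : a 0 ≠ 0 := by
    rw [← vF.ne_zero_iff, ha0]; exact one_ne_zero
  have hb : ∀ i : Fin m, ∃ s ∈ S, vF (-((a 0)⁻¹ * a i.succ) - s) < 1 := fun i =>
    hSx _ (by rw [Valuation.map_neg, map_mul, map_inv₀, ha0]; simpa using ha _)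
  choose s hs hbs using hb
  refine ⟨_, ⟨s, hs, rfl⟩, ?_⟩
  have e : y - ∑ i, s i • x i = (a 0)⁻¹ • (a 0 • y + ∑ i, a i.succ • x i) +
      ∑ i : Fin m, (-((a 0)⁻¹ * a i.succ) - s i) • x i := by
    rw [smul_add, smul_smul, inv_mul_cancel₀ ha00, one_smul, Finset.smul_sum, add_assoc,
      ← Finset.sum_add_distrib, sub_eq_add_neg, ← Finset.sum_neg_distrib]
    congr 1
    refine Finset.sum_congr rfl fun i _ => ?_
    rw [smul_smul, ← add_smul, add_sub, add_neg_cancel, zero_sub, neg_smul]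
  rw [e]
  refine v.map_add_lt ?_ (v.map_sum_lt one_ne_zero fun i _ => hvlt _ _ (hbs i) (hx.1 i))
  rw [Algebra.smul_def, map_mul]
  refine (mul_le_of_le_one_left' ?_).trans_lt hsum
  rw [hv, map_inv₀, ha0, inv_one]

/-- The residue field of the completion of a number field at a finite place is finite. -/
theorem exists_finite_residues_adicCompletion {K : Type*} [Field K] [NumberField K]
    (𝔭 : IsDedekindDomain.HeightOneSpectrum (NumberField.RingOfIntegers K)) :
    ∃ S : Set (𝔭.adicCompletion K), S.Finite ∧
      ∀ x, Valued.v x ≤ (1 : ℤᵐ⁰) → ∃ s ∈ S, Valued.v (x - s) < (1 : ℤᵐ⁰) := by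
  have hfin : Finite (NumberField.RingOfIntegers K ⧸ 𝔭.asIdeal) :=
    Ring.HasFiniteQuotients.finiteQuotient 𝔭.ne_bot
  have hval : ∀ y : K, Valued.v (algebraMap K (𝔭.adicCompletion K) y) = 𝔭.valuation K y :=
    fun y => 𝔭.valuedAdicCompletion_eq_valuation' y
  refine ⟨Set.range fun q : NumberField.RingOfIntegers K ⧸ 𝔭.asIdeal =>
    algebraMap K (𝔭.adicCompletion K) (algebraMap _ K (Quotient.out q)),
    Set.finite_range _, fun x hx => ?_⟩
  obtain ⟨y, hy⟩ : ∃ y : K, Valued.v (x - algebraMap K (𝔭.adicCompletion K) y) < (1 : ℤᵐ⁰) := by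
    have hopen : IsOpen {z : 𝔭.adicCompletion K | Valued.v (x - z) < (1 : ℤᵐ⁰)} := by
      have h1 := (Valued.isOpen_ball (𝔭.adicCompletion K) 1).preimage
        (continuous_const.sub continuous_id : Continuous fun z => x - z)
      simpa [Set.preimage, Valuation.restrict_lt_one_iff] using h1
    exact (𝔭.denseRange_algebraMap K).exists_mem_open hopen ⟨x, by simp⟩
  have hy1 : 𝔭.valuation K y ≤ 1 := by
    rw [← hval]
    have := Valued.v.map_sub_le hx hy.le
    rwa [sub_sub_cancel] at this
  obtain ⟨r, hr⟩ := 𝔭.exists_valuation_sub_lt_of_integer hy1 1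
  set q : NumberField.RingOfIntegers K ⧸ 𝔭.asIdeal := Ideal.Quotient.mk _ r with hq
  have hrq : 𝔭.valuation K (algebraMap _ K (r - Quotient.out q)) < 1 := by
    rw [𝔭.valuation_lt_one_iff_mem, ← Ideal.Quotient.eq]
    exact (Ideal.Quotient.mk_out q).symm
  refine ⟨_, ⟨q, rfl⟩, ?_⟩
  rw [map_sub, ← hval] at hrq
  rw [Valuation.map_sub_swap, ← hval] at hr
  have h3 := Valued.v.map_add_lt (Valued.v.map_add_lt hy hr) hrq
  convert h3 using 2
  rw [map_sub, map_sub]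
  abel

end Finiteness

end LocalHecke

end

noncomputable section

namespace LocalHecke

/-! ### Elementary divisors over arbitrary index types and the unimodular case -/

section Reindex

variable {D : Type*} [DivisionRing D] {v : Valuation D ℤᵐ⁰}

/-- Renaming the rows and columns of invertible matrices. -/
def reindexUnits {ι κ : Type*} [Fintype ι] [DecidableEq ι] [Fintype κ] [DecidableEq κ]
    (s : ι ≃ κ) : (Matrix ι ι D)ˣ ≃* (Matrix κ κ D)ˣ :=
  Units.mapEquiv (Matrix.reindexRingEquiv D s).toMulEquiv

theorem reindexUnits_val {ι κ : Type*} [Fintype ι] [DecidableEq ι] [Fintype κ] [DecidableEq κ]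
    (s : ι ≃ κ) (U : (Matrix ι ι D)ˣ) : (reindexUnits s U).1 = Matrix.reindex s s U.1 := rfl

theorem reindexUnits_mem {ι κ : Type*} [Fintype ι] [DecidableEq ι] [Fintype κ] [DecidableEq κ]
    (s : ι ≃ κ) {U : (Matrix ι ι D)ˣ} (hU : U ∈ GLOrder ι v.integer) :
    reindexUnits s U ∈ GLOrder κ v.integer := by
  rw [mem_GLOrder_iff] at hU ⊢
  refine ⟨fun i j => hU.1 _ _, fun i j => ?_⟩
  rw [← map_inv]
  exact hU.2 _ _

theorem reindex_mul_mul {ι κ : Type*} [Fintype ι] [DecidableEq ι] [Fintype κ] [DecidableEq κ]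
    (s : ι ≃ κ) (X Y Z : Matrix ι ι D) : Matrix.reindex s s (X * Y * Z) =
      Matrix.reindex s s X * Matrix.reindex s s Y * Matrix.reindex s s Z := by
  have h := map_mul (Matrix.reindexRingEquiv D s)
  exact (h (X * Y) Z).trans (congr_arg (· * _) (h X Y))

theorem reindex_diagonal {ι κ : Type*} [Fintype ι] [DecidableEq ι] [Fintype κ] [DecidableEq κ]
    (s : ι ≃ κ) (d : ι → D) :
    Matrix.reindex s s (Matrix.diagonal d) = Matrix.diagonal (d ∘ s.symm) := by
  rw [Matrix.reindex_apply, Matrix.submatrix_diagonal_equiv]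

variable {ι : Type*} [Fintype ι] [DecidableEq ι] {N : ℕ}

theorem hasElementaryDivisors_iff (s₀ : ι ≃ Fin N) {X : Matrix ι ι D} {e : Fin N → ℕ} :
    HasElementaryDivisors v X e ↔
      HasIntElementaryDivisors v (Matrix.reindex s₀ s₀ X) (fun i => (e i : ℤ)) := by
  constructor
  · rintro ⟨he, U, hU, V, hV, s, d, hd, rfl⟩
    refine ⟨fun i j hij => Nat.cast_le.2 (he hij), ?_⟩
    let σ : Equiv.Perm (Fin N) := s₀.symm.trans s
    refine ⟨reindexUnits s₀ U * permUnit σ, mul_mem (reindexUnits_mem _ hU) (permUnit_mem _),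
      permUnit σ⁻¹ * reindexUnits s₀ V, mul_mem (permUnit_mem _) (reindexUnits_mem _ hV), d, hd, ?_⟩
    have h1 : (permUnit σ : (Matrix (Fin N) (Fin N) D)ˣ).1 * Matrix.diagonal d *
        (permUnit σ⁻¹ : (Matrix (Fin N) (Fin N) D)ˣ).1 = Matrix.diagonal (d ∘ σ) := by
      ext i j
      rw [mul_permUnit_apply, permUnit_mul_apply, Matrix.diagonal_apply, Matrix.diagonal_apply]
      change (if σ i = σ j then _ else _) = _
      simp
    calc Matrix.reindex s₀ s₀ (U.1 * Matrix.diagonal (fun i => d (s i)) * V.1)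
        = (reindexUnits s₀ U).1 * Matrix.diagonal (d ∘ σ) * (reindexUnits s₀ V).1 := by
          rw [reindex_mul_mul, reindex_diagonal]; rfl
      _ = _ := by rw [← h1]; simp only [Units.val_mul, mul_assoc]
  · rintro ⟨he, U, hU, V, hV, d, hd, h⟩
    refine ⟨fun i j hij => Nat.cast_le.1 (he hij), reindexUnits s₀.symm U, reindexUnits_mem _ hU,
      reindexUnits s₀.symm V, reindexUnits_mem _ hV, s₀, d, hd, ?_⟩
    have h2 : X = Matrix.reindex s₀.symm s₀.symm (Matrix.reindex s₀ s₀ X) := by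
      ext i j; simp
    rw [h2, h, reindex_mul_mul, reindex_diagonal]
    rfl

namespace HasElementaryDivisors

variable {X Y : Matrix ι ι D} {e f : Fin N → ℕ}

theorem unique (hX : HasElementaryDivisors v X e) (hX' : HasElementaryDivisors v X f) : e = f := by
  obtain ⟨-, -, -, -, -, s₀, -⟩ := id hX
  have h := ((hasElementaryDivisors_iff s₀).1 hX).unique ((hasElementaryDivisors_iff s₀).1 hX')
  funext i
  exact Nat.cast_injective (R := ℤ) (congr_fun h i)

theorem mul_mul (h : HasElementaryDivisors v X e) {U V : (Matrix ι ι D)ˣ}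
    (hU : U ∈ GLOrder ι v.integer) (hV : V ∈ GLOrder ι v.integer) :
    HasElementaryDivisors v (U.1 * X * V.1) e := by
  obtain ⟨he, U', hU', V', hV', s, d, hd, rfl⟩ := h
  exact ⟨he, U * U', mul_mem hU hU', V' * V, mul_mem hV' hV, s, d, hd, by
    simp only [Units.val_mul, mul_assoc]⟩

theorem exists_eq_mul_mul (hX : HasElementaryDivisors v X e) (hY : HasElementaryDivisors v Y e) :
    ∃ U ∈ GLOrder ι v.integer, ∃ V ∈ GLOrder ι v.integer, Y = U.1 * X * V.1 := by
  obtain ⟨-, -, -, -, -, s, -⟩ := id hX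
  obtain ⟨U, hU, V, hV, h⟩ := ((hasElementaryDivisors_iff s).1 hX).exists_eq_mul_mul
    ((hasElementaryDivisors_iff s).1 hY)
  refine ⟨reindexUnits s.symm U, reindexUnits_mem _ hU, reindexUnits s.symm V,
    reindexUnits_mem _ hV, ?_⟩
  apply (Matrix.reindex s s).injective
  rw [h, reindex_mul_mul]
  simp [reindexUnits_val]

theorem exists_mul_mul_add (hX : HasElementaryDivisors v X e) (hY : HasElementaryDivisors v Y f) :
    ∃ U ∈ GLOrder ι v.integer, HasElementaryDivisors v (X * U.1 * Y) (e + f) := by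
  obtain ⟨-, -, -, -, -, s, -⟩ := id hX
  obtain ⟨U, hU, h⟩ := ((hasElementaryDivisors_iff s).1 hX).exists_mul_mul_add
    ((hasElementaryDivisors_iff s).1 hY)
  refine ⟨reindexUnits s.symm U, reindexUnits_mem _ hU, ?_⟩
  rw [hasElementaryDivisors_iff s, reindex_mul_mul]
  simpa [reindexUnits_val, funext_iff, Pi.add_def] using h

theorem eq_add_or_divLT {g : Fin N → ℕ} (hX : HasElementaryDivisors v X e)
    (hY : HasElementaryDivisors v Y f) (hXY : HasElementaryDivisors v (X * Y) g) :
    g = e + f ∨ divLT g (e + f) := by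
  obtain ⟨-, -, -, -, -, s, -⟩ := id hX
  rw [hasElementaryDivisors_iff s] at hX hY hXY
  have hm : Matrix.reindex s s (X * Y) = Matrix.reindex s s X * Matrix.reindex s s Y :=
    map_mul (Matrix.reindexRingEquiv D s) X Y
  rw [hm] at hXY
  rcases hX.eq_add_or_lt hY hXY with h | ⟨i, hi, hj⟩
  · left
    funext i
    have := congr_fun h i
    rw [Pi.add_apply] at this
    exact_mod_cast this
  · right
    rw [Pi.add_apply] at hi
    refine ⟨i, by exact_mod_cast hi, fun j hlt => ?_⟩
    have := hj j hlt
    rw [Pi.add_apply] at this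
    exact_mod_cast this

theorem exists_eq_mul_right_factor {X₁ Y₁ : Matrix ι ι D} (hX : HasElementaryDivisors v X e)
    (hY : HasElementaryDivisors v Y f) (hX₁ : HasElementaryDivisors v X₁ e)
    (hY₁ : HasElementaryDivisors v Y₁ f) (hXY : HasElementaryDivisors v (X * Y) (e + f))
    (heq : X * Y = X₁ * Y₁) : ∃ U ∈ GLOrder ι v.integer, Y₁ = U.1 * Y := by
  obtain ⟨-, -, -, -, -, s, -⟩ := id hX
  rw [hasElementaryDivisors_iff s] at hX hY hX₁ hY₁ hXY
  have hm : ∀ X Y : Matrix ι ι D,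
      Matrix.reindex s s (X * Y) = Matrix.reindex s s X * Matrix.reindex s s Y :=
    map_mul (Matrix.reindexRingEquiv D s)
  have hadd : (fun i => (((e + f) i : ℕ) : ℤ)) = (fun i => (e i : ℤ)) + fun i => (f i : ℤ) := by
    funext i; simp
  rw [hm, hadd] at hXY
  obtain ⟨U, hU, h⟩ := hX.exists_eq_mul_right_factor hY hX₁ hY₁ hXY (by rw [← hm, heq, hm])
  refine ⟨reindexUnits s.symm U, reindexUnits_mem _ hU, ?_⟩
  apply (Matrix.reindex s s).injective
  rw [h, hm]
  simp [reindexUnits_val]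

end HasElementaryDivisors

theorem exists_hasElementaryDivisors (s : ι ≃ Fin N) {X : Matrix ι ι D} (hX : IsUnit X)
    (hint : ∀ i j, v (X i j) ≤ 1) : ∃ e : Fin N → ℕ, HasElementaryDivisors v X e := by
  obtain ⟨e, he⟩ := exists_hasIntElementaryDivisors (v := v) (Matrix.reindex s s X)
    (hX.map (Matrix.reindexRingEquiv D s))
  have h0 : ∀ i, 0 ≤ e i := he.le_of_valuation_le fun i j => by simpa using hint _ _
  refine ⟨fun i => (e i).toNat, (hasElementaryDivisors_iff s).2 ?_⟩
  convert he using 2 with i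
  exact Int.toNat_of_nonneg (h0 i)

end Reindex

section Flatten

variable {D : Type*} [DivisionRing D] (v : Valuation D ℤᵐ⁰) {F : Type*} [Field F] [Algebra F D]
  {A : Type*} [Ring A] [Algebra F A] {r : ℕ} (φ : A ≃ₐ[F] Matrix (Fin r) (Fin r) D)
  (κ : Type*) [Fintype κ] [DecidableEq κ]

/-- `flatten` as an isomorphism of rings. -/
def flattenRingEquiv : Matrix κ κ A ≃+* Matrix (κ × Fin r) (κ × Fin r) D :=
  φ.toRingEquiv.mapMatrix.trans (Matrix.compRingEquiv κ (Fin r) D)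

/-- `flatten` on invertible matrices. -/
def flattenUnits : (Matrix κ κ A)ˣ ≃* (Matrix (κ × Fin r) (κ × Fin r) D)ˣ :=
  Units.mapEquiv (flattenRingEquiv φ κ).toMulEquiv

variable {κ}

variable {v} {φ} in
theorem mem_order_matrix_iff {M : Matrix κ κ A} :
    M ∈ (order v φ).matrix (n := κ) ↔ ∀ i j, v (flatten φ M i j) ≤ 1 := by
  constructor
  · intro h i j
    exact h i.1 j.1 i.2 j.2
  · intro h i j a b
    exact h (i, a) (j, b)

variable {v} {φ} in
theorem mem_GLOrder_order_iff {M : (Matrix κ κ A)ˣ} :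
    M ∈ GLOrder κ (order v φ) ↔ flattenUnits φ κ M ∈ GLOrder (κ × Fin r) v.integer := by
  rw [mem_GLOrder_iff, GLOrder, Submonoid.mem_units_iff]
  refine and_congr mem_order_matrix_iff ?_
  rw [← map_inv]
  exact mem_order_matrix_iff

variable {v} {φ} in
/-- The leading term law in the unimodular case. -/
theorem leadingTermLaw_unimodular
    (hfin : ∀ k : ℤ, ∃ S : Set D, S.Finite ∧ ∀ x, v x ≤ 1 → ∃ s ∈ S, v (x - s) ≤ WithZero.exp (-k))
    (n : ℕ) : LeadingTermLaw (InvOrder (Fin n) (order v φ)) (GLOrder (Fin n) (order v φ)) divLT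
      (UnimodularInv v φ) := by
  set ρ := flattenUnits φ (Fin n) with hρ
  have hval : ∀ M : (Matrix (Fin n) (Fin n) A)ˣ, flatten φ M.1 = (ρ M).1 := fun M => rfl
  have hlift : ∀ U ∈ GLOrder (Fin n × Fin r) v.integer, ρ.symm U ∈ GLOrder (Fin n) (order v φ) :=
    fun U hU => mem_GLOrder_order_iff.2 (by rwa [← hρ, MulEquiv.apply_symm_apply])
  refine leadingTermLaw_of ?_ ?_ ?_ ?_ ?_ ?_ ?_ ?_ ?_
  · intro M hM
    exact (Submonoid.mem_units_iff _ _).1 hM |>.1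
  · intro M hM
    refine mem_commensurator_of_map_GLOrder hfin ρ.toMonoidHom _ _
      (fun h hh => mem_GLOrder_order_iff.1 hh) fun x hx h hh hm => mem_GLOrder_order_iff.2 hm
  · intro M hM
    exact exists_hasElementaryDivisors finProdFinEquiv (ρ M).isUnit (mem_order_matrix_iff.1 hM)
  · exact fun M x y hx hy => hx.unique hy
  · intro M h hh k hk x hx
    unfold UnimodularInv at *
    rw [hval] at hx ⊢
    rw [map_mul, map_mul]
    exact hx.mul_mul (mem_GLOrder_order_iff.1 hh) (mem_GLOrder_order_iff.1 hk)
  · intro M hM M' hM' x hx hx'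
    obtain ⟨U, hU, V, hV, h⟩ := hx.exists_eq_mul_mul hx'
    refine ⟨_, hlift U hU, _, hlift V hV, ρ.injective ?_⟩
    rw [map_mul, map_mul, MulEquiv.apply_symm_apply, MulEquiv.apply_symm_apply]
    exact Units.ext h
  · intro M hM M' hM' x y z hx hy hz
    unfold UnimodularInv at hz
    rw [hval, map_mul] at hz
    exact hx.eq_add_or_divLT hy hz
  · intro M hM M' hM' x y hx hy
    obtain ⟨U, hU, h⟩ := hx.exists_mul_mul_add hy
    refine ⟨_, hlift U hU, ?_⟩
    unfold UnimodularInv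
    rw [hval, map_mul, map_mul, MulEquiv.apply_symm_apply]
    exact h
  · intro M hM M' hM' M₁ hM₁ M₁' hM₁' x y hx hy hx₁ hy₁ hxy heq
    unfold UnimodularInv at hxy
    rw [hval, map_mul] at hxy
    obtain ⟨U, hU, h⟩ := hx.exists_eq_mul_right_factor hy hx₁ hy₁ hxy (by
      have := congr_arg (fun M => (ρ M).1) heq
      simp only [map_mul] at this
      exact this)
    have h2 : ρ M₁' = U * ρ M' := Units.ext h
    rw [mem_GLOrder_order_iff, ← hρ, map_mul, map_inv, h2, mul_inv_cancel_right]
    exact hU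

end Flatten

end LocalHecke

end

noncomputable section

namespace LocalHecke

/-! ### The split hermitian case -/

section Split

variable {F : Type*} [Field F] {vF : Valuation F ℤᵐ⁰}

theorem mem_GLSplit_iff {N : ℕ} {x : (Matrix (Fin N) (Fin N) F)ˣ × Multiplicative ℤ} :
    x ∈ GLSplit (Fin N) vF ↔ x.1 ∈ GLOrder (Fin N) vF.integer ∧ x.2 = 1 := by
  rw [GLSplit, Subgroup.mem_prod, Subgroup.mem_bot]

/-- The leading term law in the split hermitian case. -/
theorem leadingTermLaw_split
    (hfin : ∀ k : ℤ, ∃ S : Set F, S.Finite ∧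
      ∀ x, vF x ≤ 1 → ∃ s ∈ S, vF (x - s) ≤ WithZero.exp (-k)) (N : ℕ) :
    LeadingTermLaw (RInvOrder (Fin N) vF) (GLSplit (Fin N) vF) simDivLT (SplitInv vF) := by
  refine leadingTermLaw_of ?_ ?_ ?_ ?_ ?_ ?_ ?_ ?_ ?_
  · intro x hx
    obtain ⟨h1, h2⟩ := mem_GLSplit_iff.1 hx
    refine ⟨(mem_GLOrder_iff.1 h1).1, by simp [h2], fun i j => ?_⟩
    rw [h2]
    simpa using (mem_GLOrder_iff.1 h1).2 i j
  · intro g _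
    refine mem_commensurator_of_map_GLOrder hfin (MonoidHom.fst _ _) _ _
      (fun h hh => (mem_GLSplit_iff.1 hh).1) fun x _ h hh hm => mem_GLSplit_iff.2 ⟨hm, ?_⟩
    rw [Prod.snd_mul, Prod.snd_mul, (mem_GLSplit_iff.1 hh).2]
    simp
  · intro x hx
    obtain ⟨e, he⟩ := exists_hasElementaryDivisors (v := vF) (Equiv.refl _) x.1.isUnit hx.1
    exact ⟨(e, x.2.toAdd.toNat), he, (Int.toNat_of_nonneg hx.2.1).symm⟩
  · rintro g ⟨e, l⟩ ⟨f, m⟩ ⟨h1, h2⟩ ⟨h1', h2'⟩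
    exact Prod.ext (h1.unique h1') (Nat.cast_injective (R := ℤ) (h2.symm.trans h2'))
  · rintro g h hh k hk x ⟨h1, h2⟩
    refine ⟨h1.mul_mul (mem_GLSplit_iff.1 hh).1 (mem_GLSplit_iff.1 hk).1, ?_⟩
    rw [Prod.snd_mul, Prod.snd_mul, (mem_GLSplit_iff.1 hh).2, (mem_GLSplit_iff.1 hk).2, one_mul,
      mul_one, h2]
  · rintro g - g' - x ⟨h1, h2⟩ ⟨h1', h2'⟩
    obtain ⟨U, hU, V, hV, h⟩ := h1.exists_eq_mul_mul h1'
    refine ⟨(U, 1), mem_GLSplit_iff.2 ⟨hU, rfl⟩, (V, 1), mem_GLSplit_iff.2 ⟨hV, rfl⟩,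
      Prod.ext (Units.ext h) ?_⟩
    rw [Prod.snd_mul, Prod.snd_mul, one_mul, mul_one]
    exact Multiplicative.toAdd.injective (h2'.trans h2.symm)
  · rintro g - g' - x y z ⟨h1, h2⟩ ⟨h1', h2'⟩ ⟨h1'', h2''⟩
    have hl : z.2 = x.2 + y.2 := by
      rw [Prod.snd_mul, toAdd_mul, h2, h2'] at h2''
      exact_mod_cast h2''.symm
    rcases h1.eq_add_or_divLT h1' h1'' with h | h
    · exact Or.inl (Prod.ext h hl)
    · exact Or.inr (Or.inr ⟨hl, h⟩)
  · rintro g - g' - x y ⟨h1, h2⟩ ⟨h1', h2'⟩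
    obtain ⟨U, hU, h⟩ := h1.exists_mul_mul_add h1'
    refine ⟨(U, 1), mem_GLSplit_iff.2 ⟨hU, rfl⟩, h, ?_⟩
    rw [Prod.snd_mul, Prod.snd_mul, mul_one, toAdd_mul, h2, h2', Prod.snd_add, Nat.cast_add]
  · rintro g - g' - g₁ - g₁' - x y ⟨h1, h2⟩ ⟨h1', h2'⟩ ⟨h3, h4⟩ ⟨h3', h4'⟩ ⟨h5, h6⟩ heq
    obtain ⟨U, hU, h⟩ := h1.exists_eq_mul_right_factor h1' h3 h3' h5
      (congr_arg (fun z => z.1.1) heq)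
    have h7 : g₁'.1 = U * g'.1 := Units.ext h
    refine mem_GLSplit_iff.2 ⟨?_, ?_⟩
    · rw [Prod.fst_mul, Prod.fst_inv, h7, mul_inv_cancel_right]
      exact hU
    · rw [Prod.snd_mul, Prod.snd_inv, mul_inv_eq_one]
      exact Multiplicative.toAdd.injective (h4'.trans h2'.symm)

end Split

end LocalHecke

end

noncomputable section

namespace LocalHecke

/-! ### Similitudes of hyperbolic hermitian and skew-hermitian forms -/

section Hyperbolic

variable {D : Type*} [DivisionRing D] (η : D)

/-- The Gram matrix `(0, 1; η, 0)` of a hyperbolic space. -/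
def hypForm (ι : Type*) [DecidableEq ι] : Matrix (ι ⊕ ι) (ι ⊕ ι) D :=
  Matrix.fromBlocks 0 1 (η • (1 : Matrix ι ι D)) 0

/-- `M` is a similitude with multiplier `m` of the form `hypForm η`. -/
def IsHypSimilitude [StarRing D] {ι : Type*} [Fintype ι] [DecidableEq ι]
    (M : Matrix (ι ⊕ ι) (ι ⊕ ι) D) (m : D) : Prop :=
  Mᴴ * hypForm η ι * M = m • hypForm η ι

variable {η} {ι : Type*} [Fintype ι] [DecidableEq ι]

theorem hypForm_mul_inl (M : Matrix (ι ⊕ ι) (ι ⊕ ι) D) (i : ι) (j : ι ⊕ ι) :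
    (hypForm η ι * M) (Sum.inl i) j = M (Sum.inr i) j := by
  simp [hypForm, Matrix.mul_apply, Fintype.sum_sum_type, Matrix.one_apply]

theorem hypForm_mul_inr (M : Matrix (ι ⊕ ι) (ι ⊕ ι) D) (i : ι) (j : ι ⊕ ι) :
    (hypForm η ι * M) (Sum.inr i) j = η * M (Sum.inl i) j := by
  simp [hypForm, Matrix.mul_apply, Fintype.sum_sum_type, Matrix.one_apply]

theorem hypForm_mul_self : hypForm η ι * hypForm η ι = η • 1 := by
  rw [hypForm, Matrix.fromBlocks_multiply, ← Matrix.fromBlocks_one, Matrix.fromBlocks_smul]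
  simp

variable [StarRing D]

theorem hypForm_conjTranspose {κ : Type*} [DecidableEq κ] (hη : η = 1 ∨ η = -1) :
    (hypForm η κ)ᴴ = η • hypForm η κ := by
  rw [hypForm, Matrix.fromBlocks_conjTranspose, Matrix.fromBlocks_smul]
  rcases hη with rfl | rfl <;> simp

theorem conjTranspose_mul_hypForm_mul_apply (M : Matrix (ι ⊕ ι) (ι ⊕ ι) D) (j k : ι ⊕ ι) :
    (Mᴴ * hypForm η ι * M) j k = ∑ i, star (M (Sum.inl i) j) * M (Sum.inr i) k +
      ∑ i, star (M (Sum.inr i) j) * (η * M (Sum.inl i) k) := by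
  rw [mul_assoc, Matrix.mul_apply, Fintype.sum_sum_type]
  simp only [hypForm_mul_inl, hypForm_mul_inr, Matrix.conjTranspose_apply]

namespace IsHypSimilitude

theorem mul {M N : Matrix (ι ⊕ ι) (ι ⊕ ι) D} {m m' : D} (hm : m ∈ Subring.center D)
    (hM : IsHypSimilitude η M m) (hN : IsHypSimilitude η N m') :
    IsHypSimilitude η (M * N) (m * m') := by
  unfold IsHypSimilitude at *
  have hc : ∀ X : Matrix (ι ⊕ ι) (ι ⊕ ι) D, X * (m • hypForm η ι) = m • (X * hypForm η ι) := by
    intro X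
    ext i j
    simp only [Matrix.mul_apply, Matrix.smul_apply, smul_eq_mul, Finset.mul_sum]
    refine Finset.sum_congr rfl fun k _ => ?_
    rw [← mul_assoc, ← mul_assoc, (Subring.mem_center_iff.1 hm)]
  calc (M * N)ᴴ * hypForm η ι * (M * N) = Nᴴ * (Mᴴ * hypForm η ι * M) * N := by
        rw [Matrix.conjTranspose_mul]; simp only [mul_assoc]
    _ = (m * m') • hypForm η ι := by
        rw [hM, hc, Matrix.smul_mul, hN, smul_smul]

theorem mul_of_one {M N : Matrix (ι ⊕ ι) (ι ⊕ ι) D} {m : D}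
    (hM : IsHypSimilitude η M m) (hN : IsHypSimilitude η N 1) (hm : m ∈ Subring.center D) :
    IsHypSimilitude η (M * N) m := by
  simpa using hM.mul hm hN

/-- The conjugate transpose of an invertible similitude is a similitude with the same
multiplier. -/
theorem conjTranspose (hη : η = 1 ∨ η = -1) {M : Matrix (ι ⊕ ι) (ι ⊕ ι) D} (hu : IsUnit M) {m : D}
    (hm : m ∈ Subring.center D) (hM : IsHypSimilitude η M m) : IsHypSimilitude η Mᴴ m := by
  obtain ⟨u, rfl⟩ := hu
  have hηη : η * η = 1 := by rcases hη with rfl | rfl <;> simp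
  have hηc : η ∈ Subring.center D := by
    rcases hη with rfl | rfl
    · exact one_mem _
    · exact neg_mem (one_mem _)
  have hc : ∀ c ∈ Subring.center D, ∀ X Y : Matrix (ι ⊕ ι) (ι ⊕ ι) D,
      X * (c • Y) = c • (X * Y) := by
    intro c hcc X Y
    ext i j
    simp only [Matrix.mul_apply, Matrix.smul_apply, smul_eq_mul, Finset.mul_sum]
    refine Finset.sum_congr rfl fun k _ => ?_
    rw [← mul_assoc, ← mul_assoc, (Subring.mem_center_iff.1 hcc)]
  unfold IsHypSimilitude at *
  rw [Matrix.conjTranspose_conjTranspose]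
  set Jf := hypForm η ι with hJ
  have hJJ : Jf * Jf = η • 1 := hypForm_mul_self
  have h1 : u.1 * (Jf * ((u.1)ᴴ * Jf * u.1)) * (u⁻¹).1 = (m * η) • 1 := by
    rw [hM, hc m hm, hJJ, smul_smul, hc _ (mul_mem hm hηc), mul_one, Matrix.smul_mul, u.mul_inv]
  have h2 : u.1 * Jf * (u.1)ᴴ * Jf = (m * η) • 1 := by
    rw [← h1]
    simp only [← mul_assoc]
    rw [mul_assoc _ u.1, u.mul_inv, mul_one]
  have h3 : u.1 * Jf * (u.1)ᴴ * Jf * Jf = (m * η) • Jf := by rw [h2, Matrix.smul_mul, one_mul]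
  rw [mul_assoc _ Jf Jf, hJJ, hc η hηc, mul_one] at h3
  have h4 := congr_arg (fun X => η • X) h3
  simp only [smul_smul] at h4
  rw [hηη, one_smul, ← Subring.mem_center_iff.1 hηc, mul_assoc m, hηη, mul_one] at h4
  exact h4

end IsHypSimilitude

variable (η) in
/-- The isometries of `hypForm η` that are invertible over the valuation ring. -/
def hypUnitary (ι : Type*) [Fintype ι] [DecidableEq ι] (v : Valuation D ℤᵐ⁰) :
    Subgroup (Matrix (ι ⊕ ι) (ι ⊕ ι) D)ˣ where
  carrier := {U | U ∈ GLOrder (ι ⊕ ι) v.integer ∧ IsHypSimilitude η U.1 1}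
  one_mem' := ⟨one_mem _, by simp [IsHypSimilitude]⟩
  mul_mem' := by
    rintro U V ⟨hU, hU'⟩ ⟨hV, hV'⟩
    exact ⟨mul_mem hU hV, hU'.mul_of_one hV' (one_mem _)⟩
  inv_mem' := by
    rintro U ⟨hU, hU'⟩
    refine ⟨inv_mem hU, ?_⟩
    unfold IsHypSimilitude at *
    rw [one_smul] at *
    have h2 : ((U⁻¹).1)ᴴ * (U.1)ᴴ = 1 := by
      rw [← Matrix.conjTranspose_mul, U.mul_inv, Matrix.conjTranspose_one]
    calc ((U⁻¹).1)ᴴ * hypForm η ι * (U⁻¹).1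
        = ((U⁻¹).1)ᴴ * ((U.1)ᴴ * hypForm η ι * U.1) * (U⁻¹).1 := by rw [hU']
      _ = (((U⁻¹).1)ᴴ * (U.1)ᴴ) * hypForm η ι * (U.1 * (U⁻¹).1) := by simp only [mul_assoc]
      _ = hypForm η ι := by rw [h2, U.mul_inv, one_mul, mul_one]

variable {v : Valuation D ℤᵐ⁰}

theorem star_mem_GLOrder (hstar : ∀ x : D, v (star x) = v x) {κ : Type*} [Fintype κ]
    [DecidableEq κ] {U : (Matrix κ κ D)ˣ} (hU : U ∈ GLOrder κ v.integer) :
    star U ∈ GLOrder κ v.integer := by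
  rw [mem_GLOrder_iff] at hU ⊢
  refine ⟨fun i j => ?_, fun i j => ?_⟩
  · change v (star (U.1 j i)) ≤ 1
    rw [hstar]; exact hU.1 j i
  · change v (star ((U⁻¹).1 j i)) ≤ 1
    rw [hstar]; exact hU.2 j i

theorem star_mem_hypUnitary (hη : η = 1 ∨ η = -1) (hstar : ∀ x : D, v (star x) = v x)
    {U : (Matrix (ι ⊕ ι) (ι ⊕ ι) D)ˣ} (hU : U ∈ hypUnitary η ι v) : star U ∈ hypUnitary η ι v :=
  ⟨star_mem_GLOrder hstar hU.1, hU.2.conjTranspose hη U.isUnit (one_mem _)⟩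

/-- The Gram matrix as an isometry: it interchanges the two isotropic summands. -/
def hypSwap (hη : η = 1 ∨ η = -1) : (Matrix (ι ⊕ ι) (ι ⊕ ι) D)ˣ where
  val := hypForm η ι
  inv := η • hypForm η ι
  val_inv := by
    rcases hη with rfl | rfl
    · rw [one_smul, hypForm_mul_self, one_smul]
    · rw [neg_smul, one_smul, mul_neg, hypForm_mul_self, neg_smul, one_smul, neg_neg]
  inv_val := by
    rcases hη with rfl | rfl
    · rw [one_smul, hypForm_mul_self, one_smul]
    · rw [neg_smul, one_smul, neg_mul, hypForm_mul_self, neg_smul, one_smul, neg_neg]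

theorem hypSwap_mem (hη : η = 1 ∨ η = -1) : hypSwap hη ∈ hypUnitary η ι v := by
  have hη1 : v η = 1 := by rcases hη with rfl | rfl <;> simp
  have h1 : ∀ i j, v (hypForm η ι i j) ≤ 1 := by
    rintro (i | i) (j | j) <;> simp only [hypForm, Matrix.fromBlocks_apply₁₁,
      Matrix.fromBlocks_apply₁₂, Matrix.fromBlocks_apply₂₁, Matrix.fromBlocks_apply₂₂,
      Matrix.smul_apply, Matrix.one_apply, Matrix.zero_apply] <;> (try split_ifs) <;> simp [hη1]
  refine ⟨mem_GLOrder_iff.2 ⟨h1, fun i j => ?_⟩, ?_⟩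
  · change v (η * hypForm η ι i j) ≤ 1
    rw [map_mul, hη1, one_mul]
    exact h1 i j
  · change (hypForm η ι)ᴴ * hypForm η ι * hypForm η ι = _
    rw [hypForm_conjTranspose hη, Matrix.smul_mul, hypForm_mul_self, smul_smul, Matrix.smul_mul,
      one_mul]
    rcases hη with rfl | rfl <;> simp

/-- The isometry `diag(U, (U⁻¹)*)`. -/
def hypLevi (U : (Matrix ι ι D)ˣ) : (Matrix (ι ⊕ ι) (ι ⊕ ι) D)ˣ where
  val := Matrix.fromBlocks U.1 0 0 ((U⁻¹).1)ᴴ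
  inv := Matrix.fromBlocks (U⁻¹).1 0 0 (U.1)ᴴ
  val_inv := by
    rw [Matrix.fromBlocks_multiply, ← Matrix.conjTranspose_mul, U.mul_inv]
    simp
  inv_val := by
    rw [Matrix.fromBlocks_multiply, ← Matrix.conjTranspose_mul, U.inv_mul]
    simp

theorem hypLevi_mem (hη : η = 1 ∨ η = -1) (hstar : ∀ x : D, v (star x) = v x) {U : (Matrix ι ι D)ˣ}
    (hU : U ∈ GLOrder ι v.integer) : hypLevi U ∈ hypUnitary η ι v := by
  obtain ⟨h1, h2⟩ := mem_GLOrder_iff.1 hU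
  refine ⟨mem_GLOrder_iff.2 ⟨?_, ?_⟩, ?_⟩
  · rintro (i | i) (j | j) <;> simp [hypLevi, h1, hstar, h2]
  · change ∀ i j, v (Matrix.fromBlocks (U⁻¹).1 0 0 (U.1)ᴴ i j) ≤ 1
    rintro (i | i) (j | j) <;> simp [h1, hstar, h2]
  · change (Matrix.fromBlocks U.1 0 0 ((U⁻¹).1)ᴴ)ᴴ * _ * Matrix.fromBlocks U.1 0 0 ((U⁻¹).1)ᴴ = _
    rw [hypForm, Matrix.fromBlocks_conjTranspose, Matrix.fromBlocks_multiply,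
      Matrix.fromBlocks_multiply, one_smul]
    rcases hη with rfl | rfl <;> simp [← Matrix.conjTranspose_mul]

/-- The isometry `(1, 0; S, 1)`. -/
def hypUnipotent (S : Matrix ι ι D) : (Matrix (ι ⊕ ι) (ι ⊕ ι) D)ˣ where
  val := Matrix.fromBlocks 1 0 S 1
  inv := Matrix.fromBlocks 1 0 (-S) 1
  val_inv := by rw [Matrix.fromBlocks_multiply]; simp
  inv_val := by rw [Matrix.fromBlocks_multiply]; simp

theorem hypUnipotent_mem {S : Matrix ι ι D} (hS : S + η • Sᴴ = 0) (hv : ∀ i j, v (S i j) ≤ 1)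
    (hη : η = 1 ∨ η = -1) : hypUnipotent S ∈ hypUnitary η ι v := by
  have h1 : ∀ i j, v ((1 : Matrix ι ι D) i j) ≤ 1 := by
    intro i j
    rw [Matrix.one_apply]
    split_ifs <;> simp
  refine ⟨mem_GLOrder_iff.2 ⟨?_, ?_⟩, ?_⟩
  · rintro (i | i) (j | j) <;> simp [hypUnipotent, hv, h1]
  · change ∀ i j, v (Matrix.fromBlocks 1 0 (-S) 1 i j) ≤ 1
    rintro (i | i) (j | j) <;> simp [hv, h1]
  · change (Matrix.fromBlocks 1 0 S 1)ᴴ * _ * Matrix.fromBlocks 1 0 S 1 = _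
    rw [hypForm, Matrix.fromBlocks_conjTranspose, Matrix.fromBlocks_multiply,
      Matrix.fromBlocks_multiply, one_smul]
    have : Sᴴ * (η • 1) + S = 0 := by
      rw [← hS, add_comm]
      rcases hη with rfl | rfl <;> simp
    simp [this]

theorem hypLevi_mul_inl (U : (Matrix ι ι D)ˣ) (M : Matrix (ι ⊕ ι) (ι ⊕ ι) D) (i : ι)
    (j : ι ⊕ ι) : ((hypLevi U).1 * M) (Sum.inl i) j = ∑ k, U.1 i k * M (Sum.inl k) j := by
  simp [hypLevi, Matrix.mul_apply, Fintype.sum_sum_type]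

/-- Integral isometries move any row to any place in the first isotropic summand. -/
theorem exists_hypUnitary_move_row (hη : η = 1 ∨ η = -1) (hstar : ∀ x : D, v (star x) = v x)
    (i₀ : ι) (i : ι ⊕ ι) : ∃ U ∈ hypUnitary η ι v,
      ∀ (M : Matrix (ι ⊕ ι) (ι ⊕ ι) D) (j), (U.1 * M) (Sum.inl i₀) j = M i j := by
  have hperm : ∀ (i' : ι) (M : Matrix (ι ⊕ ι) (ι ⊕ ι) D) (j),
      ((hypLevi (permUnit (Equiv.swap i₀ i') : (Matrix ι ι D)ˣ)).1 * M) (Sum.inl i₀) j =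
        M (Sum.inl i') j := by
    intro i' M j
    rw [hypLevi_mul_inl]
    have := permUnit_mul_apply (Equiv.swap i₀ i') (M.submatrix Sum.inl id)
      i₀ j
    rwa [Matrix.mul_apply, Equiv.swap_apply_left] at this
  rcases i with i | i
  · exact ⟨_, hypLevi_mem hη hstar (permUnit_mem _), fun M j => hperm i M j⟩
  · refine ⟨hypLevi (permUnit (Equiv.swap i₀ i)) * hypSwap hη,
      mul_mem (hypLevi_mem hη hstar (permUnit_mem _)) (hypSwap_mem hη), fun M j => ?_⟩
    rw [Units.val_mul, mul_assoc, hperm]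
    exact hypForm_mul_inl M i j

/-- Clearing the column of a pivot of a similitude by isometries.  The column is isotropic, so the
first isotropic summand is cleared by row operations and the second one by a unipotent isometry. -/
theorem exists_hypUnitary_clear_column (hη : η = 1 ∨ η = -1) (hstar : ∀ x : D, v (star x) = v x)
    {M : Matrix (ι ⊕ ι) (ι ⊕ ι) D} {m : D} (hM : IsHypSimilitude η M m) (i₀ : ι)
    (h0 : M (Sum.inl i₀) (Sum.inl i₀) ≠ 0)
    (hmax : ∀ i j, v (M i j) ≤ v (M (Sum.inl i₀) (Sum.inl i₀))) :
    ∃ U ∈ hypUnitary η ι v, (∀ i, i ≠ Sum.inl i₀ → (U.1 * M) i (Sum.inl i₀) = 0) ∧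
      ∀ j, (U.1 * M) (Sum.inl i₀) j = M (Sum.inl i₀) j := by
  have hη1 : v η = 1 := by rcases hη with rfl | rfl <;> simp
  obtain ⟨U, hU, hU1, hU2⟩ := exists_clear_column (v := v)
    (M.submatrix Sum.inl id) i₀ (Sum.inl i₀) h0
    fun i => hmax (Sum.inl i) (Sum.inl i₀)
  have hL := hypLevi_mem (v := v) hη hstar hU
  set N := (hypLevi U).1 * M with hN
  have hNm : IsHypSimilitude η N m := by simpa using hL.2.mul (one_mem _) hM
  set a := M (Sum.inl i₀) (Sum.inl i₀) with ha
  have hNrow : ∀ j, N (Sum.inl i₀) j = M (Sum.inl i₀) j := fun j => by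
    rw [hN, hypLevi_mul_inl]
    exact hU2 j
  have hN0 : N (Sum.inl i₀) (Sum.inl i₀) = a := hNrow _
  have hN1 : ∀ i, i ≠ i₀ → N (Sum.inl i) (Sum.inl i₀) = 0 := fun i hi => by
    rw [hN, hypLevi_mul_inl]
    exact hU1 i hi
  let b : ι → D := fun i => N (Sum.inr i) (Sum.inl i₀) * a⁻¹
  have hb : ∀ i, v (b i) ≤ 1 := fun i => by
    simp only [b]
    rw [map_mul, map_inv₀]
    exact mul_inv_le_one_of_le₀ (valuation_GLOrder_mul_le hL.1 hmax _ _) zero_le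
  have hb0 : b i₀ + η * star (b i₀) = 0 := by
    have h1 := congr_fun₂ hNm (Sum.inl i₀) (Sum.inl i₀)
    rw [conjTranspose_mul_hypForm_mul_apply, Finset.sum_eq_single i₀, Finset.sum_eq_single i₀,
      hN0] at h1
    · have h2 : star a * N (Sum.inr i₀) (Sum.inl i₀) +
          star (N (Sum.inr i₀) (Sum.inl i₀)) * (η * a) = 0 := by
        rw [h1]; simp [hypForm]
      have h3 : (star a)⁻¹ * (star a * N (Sum.inr i₀) (Sum.inl i₀) +
          star (N (Sum.inr i₀) (Sum.inl i₀)) * (η * a)) * a⁻¹ = 0 := by rw [h2]; simp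
      rw [mul_add, inv_mul_cancel_left₀ (by simpa using h0), add_mul] at h3
      rw [← h3]
      congr 1
      simp only [b, star_mul, star_inv₀]
      rcases hη with rfl | rfl <;> simp [mul_assoc, h0]
    · intro i _ hi
      rw [hN1 i hi]; simp
    · simp
    · intro i _ hi
      rw [hN1 i hi]; simp
    · simp
  obtain ⟨S, hSe⟩ : ∃ S : Matrix ι ι D, ∀ i j,
      S i j = if j = i₀ then -b i else if i = i₀ then η * star (b j) else 0 :=
    ⟨Matrix.of fun i j => _, fun i j => rfl⟩
  have hS : S + η • Sᴴ = 0 := by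
    ext i j
    simp only [Matrix.add_apply, Matrix.smul_apply, Matrix.conjTranspose_apply, smul_eq_mul,
      Matrix.zero_apply, hSe]
    by_cases hi : i = i₀ <;> by_cases hj : j = i₀
    · subst hi hj
      rw [if_pos rfl, star_neg, mul_neg, ← neg_add, hb0, neg_zero]
    · rw [if_neg hj, if_pos hi, if_pos hi, star_neg, mul_neg, add_neg_cancel]
    · rw [if_pos hj, if_neg hi, if_pos hj, star_mul, star_star]
      rcases hη with rfl | rfl <;> simp
    · simp [hi, hj]
  have hSv : ∀ i j, v (S i j) ≤ 1 := by
    intro i j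
    rw [hSe]
    split_ifs
    · rw [Valuation.map_neg]; exact hb i
    · rw [map_mul, hη1, one_mul, hstar]; exact hb j
    · simp
  have hSN1 : ∀ i j, ((hypUnipotent S).1 * N) (Sum.inl i) j = N (Sum.inl i) j := fun i j => by
    simp [hypUnipotent, Matrix.mul_apply, Fintype.sum_sum_type, Matrix.one_apply]
  refine ⟨hypUnipotent S * hypLevi U, mul_mem (hypUnipotent_mem hS hSv hη) hL, ?_, fun j => ?_⟩
  · rintro (i | i) hi
    · rw [Units.val_mul, mul_assoc, ← hN, hSN1, hN1 i fun h => hi (by rw [h])]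
    · rw [Units.val_mul, mul_assoc, ← hN, Matrix.mul_apply, Fintype.sum_sum_type,
        Finset.sum_eq_single i₀, Finset.sum_eq_single i]
      · simp [hypUnipotent, hSe, hN0, b, h0]
      · intro k _ hk
        simp [hypUnipotent, Matrix.one_apply_ne' hk]
      · simp
      · intro k _ hk
        rw [hN1 k hk, mul_zero]
      · simp
  · rw [Units.val_mul, mul_assoc, ← hN, hSN1, hNrow]

end Hyperbolic

end LocalHecke

end

noncomputable section

namespace LocalHecke

/-! ### Diagonalization of similitudes -/

section Diagonalization

variable {D : Type*} [DivisionRing D] {η : D}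

theorem consDiag_add {N : ℕ} (a b : D) (X Y : Matrix (Fin N) (Fin N) D) :
    consDiag a X + consDiag b Y = consDiag (a + b) (X + Y) := by
  ext i j
  cases i using Fin.cases <;> cases j using Fin.cases <;> simp

/-- The orthogonal sum of the matrix `(a, b; c, d)` on a hyperbolic plane and of `M`. -/
def hypCons {k : ℕ} (a b c d : D) (M : Matrix (Fin k ⊕ Fin k) (Fin k ⊕ Fin k) D) :
    Matrix (Fin (k + 1) ⊕ Fin (k + 1)) (Fin (k + 1) ⊕ Fin (k + 1)) D :=
  Matrix.fromBlocks (consDiag a M.toBlocks₁₁) (consDiag b M.toBlocks₁₂)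
    (consDiag c M.toBlocks₂₁) (consDiag d M.toBlocks₂₂)

variable {k : ℕ}

theorem hypCons_mul (a b c d a' b' c' d' : D) (M N : Matrix (Fin k ⊕ Fin k) (Fin k ⊕ Fin k) D) :
    hypCons a b c d M * hypCons a' b' c' d' N =
      hypCons (a * a' + b * c') (a * b' + b * d') (c * a' + d * c') (c * b' + d * d') (M * N) := by
  have h : M * N = Matrix.fromBlocks (M.toBlocks₁₁ * N.toBlocks₁₁ + M.toBlocks₁₂ * N.toBlocks₂₁)
      (M.toBlocks₁₁ * N.toBlocks₁₂ + M.toBlocks₁₂ * N.toBlocks₂₂)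
      (M.toBlocks₂₁ * N.toBlocks₁₁ + M.toBlocks₂₂ * N.toBlocks₂₁)
      (M.toBlocks₂₁ * N.toBlocks₁₂ + M.toBlocks₂₂ * N.toBlocks₂₂) := by
    rw [← Matrix.fromBlocks_multiply, Matrix.fromBlocks_toBlocks, Matrix.fromBlocks_toBlocks]
  rw [h]
  simp only [hypCons, Matrix.fromBlocks_multiply, consDiag_mul, consDiag_add,
    Matrix.toBlocks_fromBlocks₁₁, Matrix.toBlocks_fromBlocks₁₂, Matrix.toBlocks_fromBlocks₂₁,
    Matrix.toBlocks_fromBlocks₂₂]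

theorem hypCons_injective {a b c d a' b' c' d' : D}
    {M N : Matrix (Fin k ⊕ Fin k) (Fin k ⊕ Fin k) D}
    (h : hypCons a b c d M = hypCons a' b' c' d' N) : M = N := by
  obtain ⟨h1, h2, h3, h4⟩ := Matrix.fromBlocks_inj.1 h
  rw [← Matrix.fromBlocks_toBlocks M, ← Matrix.fromBlocks_toBlocks N, (consDiag_injective h1).2,
    (consDiag_injective h2).2, (consDiag_injective h3).2, (consDiag_injective h4).2]

theorem consDiag_zero_zero_eq : consDiag (0 : D) (0 : Matrix (Fin k) (Fin k) D) = 0 := by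
  ext i j
  cases i using Fin.cases <;> cases j using Fin.cases <;> simp

theorem smul_consDiag (c a : D) (X : Matrix (Fin k) (Fin k) D) :
    c • consDiag a X = consDiag (c * a) (c • X) := by
  ext i j
  cases i using Fin.cases <;> cases j using Fin.cases <;> simp

theorem hypCons_one : hypCons (1 : D) 0 0 1 (1 : Matrix (Fin k ⊕ Fin k) (Fin k ⊕ Fin k) D) = 1 := by
  have h : (1 : Matrix (Fin k ⊕ Fin k) (Fin k ⊕ Fin k) D) = Matrix.fromBlocks 1 0 0 1 :=
    Matrix.fromBlocks_one.symm
  rw [h, hypCons, ← Matrix.fromBlocks_one]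
  simp only [Matrix.toBlocks_fromBlocks₁₁, Matrix.toBlocks_fromBlocks₁₂,
    Matrix.toBlocks_fromBlocks₂₁, Matrix.toBlocks_fromBlocks₂₂, consDiag_one_one,
    consDiag_zero_zero_eq]

theorem hypCons_hypForm : hypCons 0 1 η 0 (hypForm η (Fin k)) = hypForm η (Fin (k + 1)) := by
  have h : consDiag η (η • (1 : Matrix (Fin k) (Fin k) D)) = η • 1 := by
    rw [← consDiag_one_one, smul_consDiag, mul_one]
  rw [hypCons, hypForm, hypForm]
  simp [consDiag_one_one, consDiag_zero_zero_eq, h]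

theorem smul_hypCons (x a b c d : D) (M : Matrix (Fin k ⊕ Fin k) (Fin k ⊕ Fin k) D) :
    x • hypCons a b c d M = hypCons (x * a) (x * b) (x * c) (x * d) (x • M) := by
  simp only [hypCons, Matrix.fromBlocks_smul, smul_consDiag]
  rfl

theorem valuation_hypCons_le {v : Valuation D ℤᵐ⁰} {M : Matrix (Fin k ⊕ Fin k) (Fin k ⊕ Fin k) D}
    (hM : ∀ i j, v (M i j) ≤ 1) (i j : Fin (k + 1) ⊕ Fin (k + 1)) :
    v (hypCons 1 0 0 1 M i j) ≤ 1 := by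
  rcases i with i | i <;> rcases j with j | j <;>
    cases i using Fin.cases <;> cases j using Fin.cases <;>
    simp [hypCons, hM, Matrix.toBlocks₁₁, Matrix.toBlocks₁₂, Matrix.toBlocks₂₁, Matrix.toBlocks₂₂]

/-- Orthogonal sum with the identity of a hyperbolic plane. -/
def hypConsUnit : (Matrix (Fin k ⊕ Fin k) (Fin k ⊕ Fin k) D)ˣ →*
    (Matrix (Fin (k + 1) ⊕ Fin (k + 1)) (Fin (k + 1) ⊕ Fin (k + 1)) D)ˣ :=
  Units.map
    { toFun := hypCons 1 0 0 1
      map_one' := hypCons_one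
      map_mul' := fun X Y => by rw [hypCons_mul]; simp }

theorem hypConsUnit_val (U : (Matrix (Fin k ⊕ Fin k) (Fin k ⊕ Fin k) D)ˣ) :
    (hypConsUnit U).1 = hypCons 1 0 0 1 U.1 := rfl

theorem isUnit_of_isUnit_hypCons {a d : D} {M : Matrix (Fin k ⊕ Fin k) (Fin k ⊕ Fin k) D}
    (h : IsUnit (hypCons a 0 0 d M)) : IsUnit M := by
  obtain ⟨u, hu⟩ := h
  have h1 : hypCons a 0 0 d M * (u⁻¹).1 = 1 := by rw [← hu, u.mul_inv]
  have h2 : (u⁻¹).1 * hypCons a 0 0 d M = 1 := by rw [← hu, u.inv_mul]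
  let f : Fin k ⊕ Fin k → Fin (k + 1) ⊕ Fin (k + 1) := Sum.map Fin.succ Fin.succ
  have hf : Function.Injective f :=
    Sum.map_injective.2 ⟨Fin.succ_injective _, Fin.succ_injective _⟩
  have hone : ∀ i j, (1 : Matrix (Fin k ⊕ Fin k) (Fin k ⊕ Fin k) D) i j =
      (1 : Matrix (Fin (k + 1) ⊕ Fin (k + 1)) (Fin (k + 1) ⊕ Fin (k + 1)) D) (f i) (f j) :=
    fun i j => by simp [Matrix.one_apply, hf.eq_iff]
  refine ⟨⟨M, (u⁻¹).1.submatrix f f, ?_, ?_⟩, rfl⟩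
  · ext i j
    rw [hone, ← h1, Matrix.mul_apply, Matrix.mul_apply, Fintype.sum_sum_type, Fintype.sum_sum_type,
      Fin.sum_univ_succ, Fin.sum_univ_succ]
    rcases i with i | i <;> simp [f, hypCons, Matrix.toBlocks₁₁, Matrix.toBlocks₁₂,
      Matrix.toBlocks₂₁, Matrix.toBlocks₂₂]
  · ext i j
    rw [hone, ← h2, Matrix.mul_apply, Matrix.mul_apply, Fintype.sum_sum_type, Fintype.sum_sum_type,
      Fin.sum_univ_succ, Fin.sum_univ_succ]
    rcases j with j | j <;> simp [f, hypCons, Matrix.toBlocks₁₁, Matrix.toBlocks₁₂,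
      Matrix.toBlocks₂₁, Matrix.toBlocks₂₂]

variable [StarRing D]

theorem conjTranspose_consDiag (a : D) (X : Matrix (Fin k) (Fin k) D) :
    (consDiag a X)ᴴ = consDiag (star a) Xᴴ := by
  ext i j
  cases i using Fin.cases <;> cases j using Fin.cases <;> simp

theorem conjTranspose_hypCons (a b c d : D) (M : Matrix (Fin k ⊕ Fin k) (Fin k ⊕ Fin k) D) :
    (hypCons a b c d M)ᴴ = hypCons (star a) (star c) (star b) (star d) Mᴴ := by
  rw [hypCons, Matrix.fromBlocks_conjTranspose]
  simp only [conjTranspose_consDiag]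
  rfl

theorem isHypSimilitude_of_hypCons {a d m : D} {M : Matrix (Fin k ⊕ Fin k) (Fin k ⊕ Fin k) D}
    (h : IsHypSimilitude η (hypCons a 0 0 d M) m) : IsHypSimilitude η M m := by
  unfold IsHypSimilitude at *
  rw [← hypCons_hypForm, conjTranspose_hypCons, hypCons_mul, hypCons_mul, smul_hypCons] at h
  exact hypCons_injective h

variable {v : Valuation D ℤᵐ⁰}

theorem hypConsUnit_mem {U : (Matrix (Fin k ⊕ Fin k) (Fin k ⊕ Fin k) D)ˣ}
    (hU : U ∈ hypUnitary η (Fin k) v) : hypConsUnit U ∈ hypUnitary η (Fin (k + 1)) v := by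
  refine ⟨?_, ?_⟩
  · obtain ⟨h1, h2⟩ := mem_GLOrder_iff.1 hU.1
    refine mem_GLOrder_iff.2 ⟨valuation_hypCons_le h1, ?_⟩
    rw [← map_inv]
    exact valuation_hypCons_le h2
  · have h := hU.2
    unfold IsHypSimilitude at *
    rw [hypConsUnit_val, ← hypCons_hypForm, conjTranspose_hypCons, hypCons_mul, hypCons_mul, h]
    simp

/-- The diagonal similitude `diag(a, (a*)⁻¹ m)` with multiplier `m`. -/
def hypDiagonal {ι : Type*} [DecidableEq ι] (a : ι → D) (m : D) : Matrix (ι ⊕ ι) (ι ⊕ ι) D :=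
  Matrix.fromBlocks (Matrix.diagonal a) 0 0 (Matrix.diagonal fun i => (star (a i))⁻¹ * m)

theorem hypDiagonal_eq_diagonal {ι : Type*} [DecidableEq ι] (a : ι → D) (m : D) :
    hypDiagonal a m = Matrix.diagonal (Sum.elim a fun i => (star (a i))⁻¹ * m) := by
  rw [hypDiagonal, Matrix.fromBlocks_diagonal]

theorem hypCons_hypDiagonal (a : D) (b : Fin k → D) (m : D) :
    hypCons a 0 0 ((star a)⁻¹ * m) (hypDiagonal b m) =
      hypDiagonal (Fin.cons a b : Fin (k + 1) → D) m := by
  rw [hypCons, hypDiagonal, hypDiagonal]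
  simp only [Matrix.toBlocks_fromBlocks₁₁, Matrix.toBlocks_fromBlocks₁₂,
    Matrix.toBlocks_fromBlocks₂₁, Matrix.toBlocks_fromBlocks₂₂, consDiag_diagonal,
    consDiag_zero_zero_eq]
  congr 2
  funext i
  cases i using Fin.cases <;> simp

/-- A similitude whose first row and column are cleared splits off a hyperbolic plane. -/
theorem IsHypSimilitude.eq_hypCons (hη : η = 1 ∨ η = -1) {m : D} (hm : m ∈ Subring.center D)
    {M : Matrix (Fin (k + 1) ⊕ Fin (k + 1)) (Fin (k + 1) ⊕ Fin (k + 1)) D} (hu : IsUnit M)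
    (hM : IsHypSimilitude η M m) (h0 : M (Sum.inl 0) (Sum.inl 0) ≠ 0)
    (hr : ∀ j, j ≠ Sum.inl 0 → M (Sum.inl 0) j = 0)
    (hc : ∀ i, i ≠ Sum.inl 0 → M i (Sum.inl 0) = 0) :
    ∃ M', M = hypCons (M (Sum.inl 0) (Sum.inl 0)) 0 0
      ((star (M (Sum.inl 0) (Sum.inl 0)))⁻¹ * m) M' := by
  have key : ∀ {N : Matrix (Fin (k + 1) ⊕ Fin (k + 1)) (Fin (k + 1) ⊕ Fin (k + 1)) D},
      IsHypSimilitude η N m → N (Sum.inl 0) (Sum.inl 0) ≠ 0 →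
      (∀ i, i ≠ Sum.inl 0 → N i (Sum.inl 0) = 0) → ∀ j, N (Sum.inr 0) j =
        if j = Sum.inr 0 then (star (N (Sum.inl 0) (Sum.inl 0)))⁻¹ * m else 0 := by
    intro N hN h0 hc j
    have h := congr_fun₂ hN (Sum.inl 0) j
    rw [conjTranspose_mul_hypForm_mul_apply, Finset.sum_eq_single 0, Finset.sum_eq_zero,
      add_zero] at h
    · rw [← inv_mul_cancel_left₀ (show star (N (Sum.inl 0) (Sum.inl 0)) ≠ 0 by simpa using h0)
        (N (Sum.inr 0) j), h]
      rcases j with j | j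
      · simp [hypForm]
      · by_cases hj : j = 0
        · simp [hypForm, hj]
        · simp [hypForm, hj, Matrix.one_apply_ne' hj]
    · intro i _
      rw [hc _ (by simp)]; simp
    · intro i _ hi
      rw [hc _ (by simpa using hi)]; simp
    · simp
  have hrow := key hM h0 hc
  have hcol := key (hM.conjTranspose hη hu hm) (by simpa using h0) (fun i hi => by simp [hr i hi])
  have hcol' : ∀ i, i ≠ Sum.inr 0 → M i (Sum.inr 0) = 0 := fun i hi => by
    have := hcol i
    rw [if_neg hi, Matrix.conjTranspose_apply, star_eq_zero] at this
    exact this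
  refine ⟨M.submatrix (Sum.map Fin.succ Fin.succ) (Sum.map Fin.succ Fin.succ), ?_⟩
  ext i j
  rcases i with i | i <;> rcases j with j | j <;>
    cases i using Fin.cases <;> cases j using Fin.cases <;>
    simp [hypCons, Matrix.toBlocks₁₁, Matrix.toBlocks₁₂, Matrix.toBlocks₂₁, Matrix.toBlocks₂₂,
      hr, hc, hrow, hcol', Fin.succ_ne_zero]

/-- The elementary divisor theorem for similitudes: `a` collects the smaller half of the elementary
divisors. An entry of maximal valuation is moved to the top left, its row and its column are cleared
by isometries, and a hyperbolic plane splits off. -/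
theorem exists_hypUnitary_mul_mul_eq_hypDiagonal (hη : η = 1 ∨ η = -1)
    (hstar : ∀ x : D, v (star x) = v x) {m : D} (hm : m ∈ Subring.center D)
    {l : ℤ} (hl : v m = WithZero.exp (-l)) (M : Matrix (Fin k ⊕ Fin k) (Fin k ⊕ Fin k) D)
    (hu : IsUnit M) (hM : IsHypSimilitude η M m) :
    ∃ U ∈ hypUnitary η (Fin k) v, ∃ V ∈ hypUnitary η (Fin k) v, ∃ (a : Fin k → D) (c : Fin k → ℤ),
      U.1 * M * V.1 = hypDiagonal a m ∧ Monotone c ∧ (∀ i, 2 * c i ≤ l) ∧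
      ∀ i, v (a i) = WithZero.exp (-c i) := by
  induction k with
  | zero =>
    exact ⟨1, one_mem _, 1, one_mem _, Fin.elim0, Fin.elim0, by ext (i | i) <;> exact i.elim0,
      fun i => i.elim0, fun i => i.elim0, fun i => i.elim0⟩
  | succ k ih =>
    obtain ⟨p, hp⟩ := Finite.exists_max (fun p : (Fin (k + 1) ⊕ Fin (k + 1)) ×
      (Fin (k + 1) ⊕ Fin (k + 1)) => v (M p.1 p.2))
    have hp0 : M p.1 p.2 ≠ 0 := by
      intro h0
      have : M = 0 := by
        ext i j
        have := hp (i, j)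
        rw [h0, map_zero, le_zero_iff, map_eq_zero] at this
        exact this
      exact hu.ne_zero this
    obtain ⟨P, hP, hPM⟩ := exists_hypUnitary_move_row (v := v) hη hstar (0 : Fin (k + 1)) p.1
    obtain ⟨Q, hQ, hQM⟩ := exists_hypUnitary_move_row (v := v) hη hstar (0 : Fin (k + 1)) p.2
    have hQM' : ∀ (N : Matrix (Fin (k + 1) ⊕ Fin (k + 1)) (Fin (k + 1) ⊕ Fin (k + 1)) D) (i),
        (N * (star Q).1) i (Sum.inl 0) = N i p.2 := by
      intro N i
      have := hQM Nᴴ i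
      rw [← star_inj, ← Matrix.conjTranspose_apply, Matrix.conjTranspose_mul] at this
      simp only [Matrix.conjTranspose_conjTranspose, Matrix.conjTranspose_apply, star_star] at this
      exact this
    -- the pivot in the top left corner
    set M₁ := P.1 * M * (star Q).1 with hM₁
    have hM₁m : IsHypSimilitude η M₁ m :=
      IsHypSimilitude.mul_of_one (by simpa using hP.2.mul (one_mem _) hM)
        (star_mem_hypUnitary hη hstar hQ).2 hm
    have hM₁p : M₁ (Sum.inl 0) (Sum.inl 0) = M p.1 p.2 := by
      rw [hM₁, hQM', hPM]
    have hM₁v : ∀ i j, v (M₁ i j) ≤ v (M p.1 p.2) :=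
      valuation_mul_GLOrder_le (star_mem_hypUnitary hη hstar hQ).1
        (valuation_GLOrder_mul_le hP.1 fun i j => hp (i, j))
    obtain ⟨R, hR, hR1, hR2⟩ := exists_hypUnitary_clear_column hη hstar hM₁m 0
      (by rwa [hM₁p]) (by rwa [hM₁p])
    -- the column is cleared
    set M₂ := R.1 * M₁ with hM₂
    have hM₂m : IsHypSimilitude η M₂ m := by simpa using hR.2.mul (one_mem _) hM₁m
    have hM₂u : IsUnit M₂ := R.isUnit.mul ((P.isUnit.mul hu).mul (star Q).isUnit)
    have hM₂p : M₂ (Sum.inl 0) (Sum.inl 0) = M p.1 p.2 := by rw [hR2, hM₁p]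
    have hM₂v : ∀ i j, v (M₂ i j) ≤ v (M p.1 p.2) := valuation_GLOrder_mul_le hR.1 hM₁v
    obtain ⟨S, hS, hS1, hS2⟩ := exists_hypUnitary_clear_column (v := v) hη hstar
      (hM₂m.conjTranspose hη hM₂u hm) 0 (by simpa [hM₂p] using hp0)
      (fun i j => by
        rw [Matrix.conjTranspose_apply, Matrix.conjTranspose_apply, hstar, hstar, hM₂p]
        exact hM₂v j i)
    -- the row is cleared as well
    have hS' := star_mem_hypUnitary hη hstar hS
    set M₃ := M₂ * (star S).1 with hM₃
    have hM₃t : ∀ i j, M₃ i j = star ((S.1 * M₂ᴴ) j i) := by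
      intro i j
      rw [← Matrix.conjTranspose_apply, Matrix.conjTranspose_mul,
        Matrix.conjTranspose_conjTranspose]
      rfl
    have hM₃m : IsHypSimilitude η M₃ m := hM₂m.mul_of_one hS'.2 hm
    have hM₃u : IsUnit M₃ := hM₂u.mul (star S).isUnit
    have hM₃c : ∀ i, M₃ i (Sum.inl 0) = M₂ i (Sum.inl 0) := fun i => by
      rw [hM₃t, hS2, Matrix.conjTranspose_apply, star_star]
    have hM₃v : ∀ i j, v (M₃ i j) ≤ v (M p.1 p.2) := valuation_mul_GLOrder_le hS'.1 hM₂v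
    set a := M p.1 p.2 with ha
    have hM₃p : M₃ (Sum.inl 0) (Sum.inl 0) = a := by rw [hM₃c, hM₂p]
    obtain ⟨M', hM'⟩ := hM₃m.eq_hypCons hη hm hM₃u (by rwa [hM₃p])
      (fun j hj => by rw [hM₃t, hS1 j hj, star_zero]) (fun i hi => by rw [hM₃c, hR1 i hi])
    rw [hM₃p] at hM'
    rw [hM'] at hM₃m hM₃u
    obtain ⟨U, hU, V, hV, b, c, hUV, hc, hcl, hb⟩ :=
      ih M' (isUnit_of_isUnit_hypCons hM₃u) (isHypSimilitude_of_hypCons hM₃m)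
    obtain ⟨c₀, hc₀⟩ : ∃ c : ℤ, v a = WithZero.exp (-c) :=
      ⟨-WithZero.log (v a), by rw [neg_neg, WithZero.exp_log (by simpa using hp0)]⟩
    set W := hypConsUnit U * R * P with hW
    set T := star Q * star S * hypConsUnit V with hT
    have htot : W.1 * M * T.1 = hypDiagonal (Fin.cons a b : Fin (k + 1) → D) m := by
      calc W.1 * M * T.1 = (hypConsUnit U).1 * M₃ * (hypConsUnit V).1 := by
            simp only [hW, hT, hM₃, hM₂, hM₁, Units.val_mul, mul_assoc]
        _ = _ := by
            rw [hM', hypConsUnit_val, hypConsUnit_val, hypCons_mul, hypCons_mul, hUV,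
              ← hypCons_hypDiagonal]
            simp
    have hWm : W ∈ hypUnitary η (Fin (k + 1)) v := mul_mem (mul_mem (hypConsUnit_mem hU) hR) hP
    have hTm : T ∈ hypUnitary η (Fin (k + 1)) v :=
      mul_mem (mul_mem (star_mem_hypUnitary hη hstar hQ) hS') (hypConsUnit_mem hV)
    have hbound : ∀ i j, v (hypDiagonal (Fin.cons a b : Fin (k + 1) → D) m i j) ≤
        WithZero.exp (-c₀) := by
      rw [← htot, ← hc₀]
      exact valuation_mul_GLOrder_le hTm.1 (valuation_GLOrder_mul_le hWm.1 fun i j => hp (i, j))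
    have hcle : ∀ i, c₀ ≤ c i := fun i => by
      have := hbound (Sum.inl i.succ) (Sum.inl i.succ)
      rw [hypDiagonal_eq_diagonal, Matrix.diagonal_apply_eq, Sum.elim_inl, Fin.cons_succ, hb,
        WithZero.exp_le_exp] at this
      linarith
    have hc₀l : 2 * c₀ ≤ l := by
      have := hbound (Sum.inr 0) (Sum.inr 0)
      rw [hypDiagonal_eq_diagonal, Matrix.diagonal_apply_eq, Sum.elim_inr, Fin.cons_zero, map_mul,
        map_inv₀, hstar, hl, hc₀, ← WithZero.exp_neg, ← WithZero.exp_add,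
        WithZero.exp_le_exp] at this
      linarith
    refine ⟨W, hWm, T, hTm, Fin.cons a b, Fin.cons c₀ c, htot, ?_, ?_, ?_⟩
    · intro i j hij
      cases i using Fin.cases with
      | zero => cases j using Fin.cases <;> simp [hcle]
      | succ i =>
        cases j using Fin.cases with
        | zero => exact absurd hij (by simp)
        | succ j => simpa using hc (Fin.succ_le_succ_iff.1 hij)
    · intro i
      cases i using Fin.cases <;> simp [hc₀l, hcl]
    · intro i
      cases i using Fin.cases <;> simp [hc₀, hb]

end Diagonalization

end LocalHecke

end

noncomputable section

namespace LocalHecke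

/-! ### Elementary divisors of similitudes -/

section SimilitudeDivisors

variable {D : Type*} [DivisionRing D] {η : D} {k N : ℕ}

/-- The order of the diagonal entries of `diag(a, (a*)⁻¹ m)` in which their valuations increase,
if the valuations of the entries of `a` increase and are at most half of that of `m`. -/
def hypOrder (hN : k + k = N) : Fin k ⊕ Fin k ≃ Fin N :=
  ((Equiv.refl _).sumCongr Fin.revPerm).trans (finSumFinEquiv.trans (finCongr hN))

theorem monotone_hypOrder (hN : k + k = N) {c : Fin k → ℤ} {l : ℤ} (hc : Monotone c)
    (hl : ∀ i, 2 * c i ≤ l) :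
    Monotone fun i => Sum.elim c (fun i => l - c i) ((hypOrder hN).symm i) := by
  subst hN
  have h1 : ∀ i, (hypOrder rfl).symm (Fin.castAdd k i) = Sum.inl i := fun i => by
    rw [Equiv.symm_apply_eq]; rfl
  have h2 : ∀ i, (hypOrder rfl).symm (Fin.natAdd k i) = Sum.inr (Fin.rev i) := fun i => by
    rw [Equiv.symm_apply_eq]
    simp [hypOrder]
  intro i j hij
  induction i using Fin.addCases with
  | left i =>
    induction j using Fin.addCases with
    | left j =>
      simp only [h1, Sum.elim_inl]
      exact hc hij
    | right j =>
      simp only [h1, h2, Sum.elim_inl, Sum.elim_inr]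
      have := hl i
      have := hl (Fin.rev j)
      linarith
  | right i =>
    induction j using Fin.addCases with
    | left j =>
      rw [Fin.le_def, Fin.val_natAdd, Fin.val_castAdd] at hij
      omega
    | right j =>
      simp only [h2, Sum.elim_inr]
      have : c (Fin.rev j) ≤ c (Fin.rev i) :=
        by
        refine hc (Fin.rev_le_rev.2 ?_)
        rw [Fin.le_def, Fin.val_natAdd, Fin.val_natAdd] at hij
        rw [Fin.le_def]
        omega
      linarith

variable {v : Valuation D ℤᵐ⁰}

theorem ne_zero_of_valuation_eq_exp {x : D} {i : ℤ} (h : v x = WithZero.exp i) : x ≠ 0 := by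
  rintro rfl
  rw [map_zero] at h
  exact WithZero.coe_ne_zero h.symm

variable [StarRing D]

theorem hypDiagonal_mul {ι : Type*} [Fintype ι] [DecidableEq ι] (b a : ι → D) {u m : D}
    (hu : u ∈ Subring.center D) :
    hypDiagonal b u * hypDiagonal a m = hypDiagonal (b * a) (u * m) := by
  rw [hypDiagonal_eq_diagonal, hypDiagonal_eq_diagonal, hypDiagonal_eq_diagonal,
    Matrix.diagonal_mul_diagonal]
  congr 1
  funext i
  rcases i with i | i
  · simp
  · simp only [Sum.elim_inr, Pi.mul_apply, star_mul, mul_inv_rev]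
    rw [mul_assoc, ← mul_assoc u, ← Subring.mem_center_iff.1 hu, mul_assoc, mul_assoc]

theorem isHypSimilitude_hypDiagonal {ι : Type*} [Fintype ι] [DecidableEq ι] {a : ι → D}
    (ha : ∀ i, a i ≠ 0) {m : D} (hms : star m = m)
    (hη : η = 1 ∨ η = -1) : IsHypSimilitude η (hypDiagonal a m) m := by
  have h1 : (fun i => star (a i) * ((star (a i))⁻¹ * m)) = fun _ => m := by
    funext i
    rw [mul_inv_cancel_left₀ (by simpa using ha i)]
  have h2 : (fun i => star ((star (a i))⁻¹ * m) * a i) = fun _ => m := by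
    funext i
    rw [star_mul, hms, star_inv₀, star_star, mul_assoc, inv_mul_cancel₀ (ha i), mul_one]
  unfold IsHypSimilitude
  rw [hypDiagonal, hypForm, Matrix.fromBlocks_conjTranspose, Matrix.fromBlocks_multiply,
    Matrix.fromBlocks_multiply, Matrix.diagonal_conjTranspose, Matrix.diagonal_conjTranspose,
    Matrix.fromBlocks_smul]
  rcases hη with rfl | rfl
  · simp only [Matrix.mul_zero, Matrix.zero_mul, add_zero, zero_add, mul_one, one_smul,
      Matrix.conjTranspose_zero, Matrix.diagonal_mul_diagonal, Pi.star_apply, h1, h2, smul_zero,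
      Matrix.smul_one_eq_diagonal]
  · simp only [Matrix.mul_zero, Matrix.zero_mul, add_zero, zero_add, mul_one, one_smul, neg_smul,
      Matrix.conjTranspose_zero, Matrix.diagonal_mul_diagonal, Pi.star_apply, h1, h2, smul_zero,
      Matrix.smul_one_eq_diagonal, Matrix.mul_neg, Matrix.neg_mul, smul_neg, neg_zero]

/-- The diagonal form of a similitude shows its elementary divisors. -/
theorem exists_hypDiagonal_of_hasElementaryDivisors (hN : k + k = N) (hη : η = 1 ∨ η = -1)
    (hstar : ∀ x : D, v (star x) = v x) {m : D} (hm : m ∈ Subring.center D) {l : ℤ}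
    (hl : v m = WithZero.exp (-l)) (M : (Matrix (Fin k ⊕ Fin k) (Fin k ⊕ Fin k) D)ˣ)
    (hM : IsHypSimilitude η M.1 m) {e : Fin N → ℕ} (he : HasElementaryDivisors v M.1 e) :
    ∃ U ∈ hypUnitary η (Fin k) v, ∃ V ∈ hypUnitary η (Fin k) v, ∃ a : Fin k → D,
      U.1 * M.1 * V.1 = hypDiagonal a m ∧
      ∀ p, v (Sum.elim a (fun i => (star (a i))⁻¹ * m) p) =
        WithZero.exp (-(e (hypOrder hN p) : ℤ)) := by
  obtain ⟨U, hU, V, hV, a, c, h, hc, hcl, ha⟩ :=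
    exists_hypUnitary_mul_mul_eq_hypDiagonal hη hstar hm hl M.1 M.isUnit hM
  refine ⟨U, hU, V, hV, a, h, ?_⟩
  have hval : ∀ p, v (Sum.elim a (fun i => (star (a i))⁻¹ * m) p) =
      WithZero.exp (-Sum.elim c (fun i => l - c i) p) := by
    rintro (i | i)
    · simp [ha]
    · rw [Sum.elim_inr, Sum.elim_inr, map_mul, map_inv₀, hstar, ha, hl, ← WithZero.exp_neg,
        ← WithZero.exp_add]
      congr 1
      ring
  have h1 := (hasElementaryDivisors_iff (hypOrder hN)).1 (he.mul_mul hU.1 hV.1)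
  have h2 : HasIntElementaryDivisors v (Matrix.reindex (hypOrder hN) (hypOrder hN)
      (U.1 * M.1 * V.1)) fun i => Sum.elim c (fun i => l - c i) ((hypOrder hN).symm i) := by
    refine ⟨monotone_hypOrder hN hc hcl, 1, one_mem _, 1, one_mem _, _,
      fun i => hval ((hypOrder hN).symm i), ?_⟩
    rw [h, hypDiagonal_eq_diagonal, reindex_diagonal, Units.val_one, one_mul, mul_one]
    rfl
  have h3 := h1.unique h2
  intro p
  have h4 := congr_fun h3 (hypOrder hN p)
  simp only [Equiv.symm_apply_apply] at h4
  rw [hval, h4]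

/-- Similitudes with the same elementary divisors and with multipliers of the same valuation
differ by integral similitudes with unit multipliers. -/
theorem exists_eq_mul_mul_hypUnitary (hN : k + k = N) (hη : η = 1 ∨ η = -1)
    (hstar : ∀ x : D, v (star x) = v x) {m m' : D} (hm : m ∈ Subring.center D)
    (hm' : m' ∈ Subring.center D) (hms : star m = m) (hms' : star m' = m') {l : ℤ}
    (hl : v m = WithZero.exp (-l)) (hl' : v m' = WithZero.exp (-l))
    (M M' : (Matrix (Fin k ⊕ Fin k) (Fin k ⊕ Fin k) D)ˣ) (hM : IsHypSimilitude η M.1 m)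
    (hM' : IsHypSimilitude η M'.1 m') {e : Fin N → ℕ} (he : HasElementaryDivisors v M.1 e)
    (he' : HasElementaryDivisors v M'.1 e) :
    ∃ U ∈ GLOrder (Fin k ⊕ Fin k) v.integer, ∃ V ∈ hypUnitary η (Fin k) v,
      IsHypSimilitude η U.1 (m' * m⁻¹) ∧ M' = U * M * V := by
  obtain ⟨U₁, hU₁, V₁, hV₁, a, h, ha⟩ :=
    exists_hypDiagonal_of_hasElementaryDivisors hN hη hstar hm hl M hM he
  obtain ⟨U₂, hU₂, V₂, hV₂, a', h', ha'⟩ :=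
    exists_hypDiagonal_of_hasElementaryDivisors hN hη hstar hm' hl' M' hM' he'
  have hm0 := ne_zero_of_valuation_eq_exp hl
  have hm0' := ne_zero_of_valuation_eq_exp hl'
  have hmi : m⁻¹ ∈ Subring.center D := Set.inv_mem_center hm
  have hu : m' * m⁻¹ ∈ Subring.center D := mul_mem hm' hmi
  have ha0 : ∀ i, a i ≠ 0 := fun i => ne_zero_of_valuation_eq_exp (ha (Sum.inl i))
  have ha0' : ∀ i, a' i ≠ 0 := fun i => ne_zero_of_valuation_eq_exp (ha' (Sum.inl i))
  have hb0 : ∀ i, (a' * a⁻¹) i ≠ 0 := fun i => mul_ne_zero (ha0' i) (inv_ne_zero (ha0 i))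
  have hvb : ∀ i, v ((a' * a⁻¹) i) = 1 := fun i => by
    have h1 := ha (Sum.inl i)
    have h2 := ha' (Sum.inl i)
    rw [Sum.elim_inl] at h1 h2
    rw [Pi.mul_apply, Pi.inv_apply, map_mul, map_inv₀, h1, h2, mul_inv_cancel₀ (by simp)]
  set d : Fin k ⊕ Fin k → D :=
    Sum.elim (a' * a⁻¹) fun i => (star ((a' * a⁻¹) i))⁻¹ * (m' * m⁻¹) with hd
  have hd0 : ∀ p, d p ≠ 0 := by
    rintro (i | i)
    · exact hb0 i
    · exact mul_ne_zero (inv_ne_zero (star_ne_zero.2 (hb0 i))) (mul_ne_zero hm0' (inv_ne_zero hm0))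
  have hvd : ∀ p, v (d p) = 1 := by
    rintro (i | i)
    · exact hvb i
    · rw [hd, Sum.elim_inr, map_mul, map_inv₀, hstar, hvb, map_mul, map_inv₀, hl, hl',
        mul_inv_cancel₀ (by simp), inv_one, one_mul]
  have hT : (diagonalUnit d hd0).1 = hypDiagonal (a' * a⁻¹) (m' * m⁻¹) :=
    (hypDiagonal_eq_diagonal _ _).symm
  have hprod : diagonalUnit d hd0 * (U₁ * M * V₁) = U₂ * M' * V₂ := by
    refine Units.ext ?_
    rw [Units.val_mul, hT, Units.val_mul, Units.val_mul, h, Units.val_mul, Units.val_mul, h',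
      hypDiagonal_mul _ _ hu]
    congr 1
    · funext i
      simp [ha0 i]
    · rw [mul_assoc, inv_mul_cancel₀ hm0, mul_one]
  have hTs : IsHypSimilitude η (diagonalUnit d hd0).1 (m' * m⁻¹) := by
    rw [hT]
    refine isHypSimilitude_hypDiagonal hb0 ?_ hη
    rw [star_mul, star_inv₀, hms, hms']
    exact (Subring.mem_center_iff.1 hmi m').symm
  refine ⟨U₂⁻¹ * diagonalUnit d hd0 * U₁,
    mul_mem (mul_mem (inv_mem hU₂.1) (diagonalUnit_mem hd0 hvd)) hU₁.1, V₁ * V₂⁻¹,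
    mul_mem hV₁ (inv_mem hV₂), ?_, ?_⟩
  · have := IsHypSimilitude.mul (one_mem _) (inv_mem hU₂).2 (hTs.mul_of_one hU₁.2 hu)
    rw [one_mul, ← mul_assoc] at this
    exact this
  · calc M' = U₂⁻¹ * (U₂ * M' * V₂) * V₂⁻¹ := by group
      _ = U₂⁻¹ * diagonalUnit d hd0 * U₁ * M * (V₁ * V₂⁻¹) := by rw [← hprod]; group

/-- The sum of the elementary divisors of two similitudes is attained by some product. -/
theorem exists_hypUnitary_mul_mul_add (hN : k + k = N) (hη : η = 1 ∨ η = -1)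
    (hstar : ∀ x : D, v (star x) = v x) {m m' : D} (hm : m ∈ Subring.center D)
    (hm' : m' ∈ Subring.center D) {l l' : ℤ}
    (hl : v m = WithZero.exp (-l)) (hl' : v m' = WithZero.exp (-l'))
    (M M' : (Matrix (Fin k ⊕ Fin k) (Fin k ⊕ Fin k) D)ˣ) (hM : IsHypSimilitude η M.1 m)
    (hM' : IsHypSimilitude η M'.1 m') {e e' : Fin N → ℕ} (he : HasElementaryDivisors v M.1 e)
    (he' : HasElementaryDivisors v M'.1 e') :
    ∃ W ∈ hypUnitary η (Fin k) v, HasElementaryDivisors v (M.1 * W.1 * M'.1) (e + e') := by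
  obtain ⟨U₁, hU₁, V₁, hV₁, a, h, ha⟩ :=
    exists_hypDiagonal_of_hasElementaryDivisors hN hη hstar hm hl M hM he
  obtain ⟨U₂, hU₂, V₂, hV₂, a', h', ha'⟩ :=
    exists_hypDiagonal_of_hasElementaryDivisors hN hη hstar hm' hl' M' hM' he'
  refine ⟨V₁ * U₂, mul_mem hV₁ hU₂, he.1.add he'.1, U₁⁻¹, inv_mem hU₁.1, V₂⁻¹, inv_mem hV₂.1,
    hypOrder hN, fun i => Sum.elim a (fun i => (star (a i))⁻¹ * m) ((hypOrder hN).symm i) *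
      Sum.elim a' (fun i => (star (a' i))⁻¹ * m') ((hypOrder hN).symm i), fun i => ?_, ?_⟩
  · rw [map_mul, ha, ha', Equiv.apply_symm_apply, ← WithZero.exp_add]
    congr 1
    simp only [Pi.add_apply, Nat.cast_add]
    ring
  · simp only [Equiv.symm_apply_apply]
    rw [← Matrix.diagonal_mul_diagonal, ← hypDiagonal_eq_diagonal, ← hypDiagonal_eq_diagonal, ← h,
      ← h']
    simp only [← Units.val_mul]
    congr 1
    group

end SimilitudeDivisors

end LocalHecke

end

noncomputable section

namespace LocalHecke

/-! ### The leading term law for groups of similitudes -/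

section Similitudes

variable {F : Type*} [Field F] {D : Type*} [DivisionRing D] [Algebra F D] {v : Valuation D ℤᵐ⁰}
  {vF : Valuation F ℤᵐ⁰}

theorem valuation_algebraMap_eq_one_iff (hv : ∀ x : F, v (algebraMap F D x) ≤ 1 ↔ vF x ≤ 1)
    (x : F) : v (algebraMap F D x) = 1 ↔ vF x = 1 := by
  by_cases hx : x = 0
  · simp [hx]
  have h1 := hv x⁻¹
  rw [map_inv₀, map_inv₀, map_inv₀,
    inv_le_one₀ (zero_lt_iff.2 (by simpa using hx)),
    inv_le_one₀ (zero_lt_iff.2 (by simpa using hx))] at h1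
  rw [le_antisymm_iff, le_antisymm_iff, hv, h1]

theorem algebraMap_mem_center (x : F) : algebraMap F D x ∈ Subring.center D :=
  Subring.mem_center_iff.2 fun y => (Algebra.commutes x y).symm

theorem IsHypSimilitude.multiplier_unique [StarRing D] {η : D} {k : ℕ} (hk : 0 < k)
    {M : Matrix (Fin k ⊕ Fin k) (Fin k ⊕ Fin k) D} {m m' : D} (hm : IsHypSimilitude η M m)
    (hm' : IsHypSimilitude η M m') : m = m' := by
  have h := congr_fun₂ (hm.symm.trans hm') (Sum.inl ⟨0, hk⟩) (Sum.inr ⟨0, hk⟩)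
  simpa [hypForm] using h

/-- The leading term law holds for the similitudes over an order if these can be identified with
the integral similitudes of a hyperbolic form over a division algebra, in such a way that
multipliers and elementary divisors correspond. -/
theorem leadingTermLaw_modular_of_hyperbolic [StarRing D] {A : Type*} [Ring A] [Algebra F A]
    [StarRing A] {r n k : ℕ} {φ : A ≃ₐ[F] Matrix (Fin r) (Fin r) D}
    (hfin : ∀ k : ℤ, ∃ S : Set D, S.Finite ∧ ∀ x, v x ≤ 1 → ∃ s ∈ S, v (x - s) ≤ WithZero.exp (-k))
    (hv : ∀ x : F, v (algebraMap F D x) ≤ 1 ↔ vF x ≤ 1) (hstar : ∀ x : D, v (star x) = v x)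
    (hstarF : ∀ x : F, star (algebraMap F D x) = algebraMap F D x) {η : D} (hη : η = 1 ∨ η = -1)
    (hk : 0 < k) (hN : k + k = 2 * n * r)
    (ρ : (Matrix (Fin n ⊕ Fin n) (Fin n ⊕ Fin n) A)ˣ ≃*
      (Matrix (Fin k ⊕ Fin k) (Fin k ⊕ Fin k) D)ˣ)
    (hsim : ∀ M (m : F), HasSimilitude M.1 m ↔ IsHypSimilitude η (ρ M).1 (algebraMap F D m))
    (hint : ∀ M, M.1 ∈ (order v φ).matrix (n := Fin n ⊕ Fin n) ↔ ∀ i j, v ((ρ M).1 i j) ≤ 1)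
    (hdiv : ∀ M (e : Fin (2 * n * r) → ℕ), HasElementaryDivisors v (flatten φ M.1) e ↔
      HasElementaryDivisors v (ρ M).1 e) :
    LeadingTermLaw (DeltaOrder n vF (order v φ)) (SpOrder n vF (order v φ)) simDivLT
      (ModularInv v φ) := by
  have hGL : ∀ M, M ∈ GLOrder (Fin n ⊕ Fin n) (order v φ) ↔
      ρ M ∈ GLOrder (Fin k ⊕ Fin k) v.integer := fun M => by
    rw [mem_GLOrder_iff, ← map_inv, ← hint, ← hint]
    exact Submonoid.mem_units_iff _ _
  have hSp : ∀ M, M ∈ SpOrder n vF (order v φ) ↔ ρ M ∈ GLOrder (Fin k ⊕ Fin k) v.integer ∧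
      ∃ m : F, v (algebraMap F D m) = 1 ∧ HasSimilitude M.1 m := fun M => by
    simp only [valuation_algebraMap_eq_one_iff hv, ← hGL]
    rfl
  have hlift : ∀ U ∈ GLOrder (Fin k ⊕ Fin k) v.integer, ∀ u : F, v (algebraMap F D u) = 1 →
      IsHypSimilitude η U.1 (algebraMap F D u) → ρ.symm U ∈ SpOrder n vF (order v φ) :=
    fun U hU u hu hUu => (hSp _).2 ⟨by rwa [MulEquiv.apply_symm_apply], u, hu,
      (hsim _ _).2 (by rwa [MulEquiv.apply_symm_apply])⟩
  have hlift' : ∀ U ∈ hypUnitary η (Fin k) v, ρ.symm U ∈ SpOrder n vF (order v φ) :=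
    fun U hU => hlift U hU.1 1 (by simp) (by simpa using hU.2)
  have huniq : ∀ (M : (Matrix (Fin n ⊕ Fin n) (Fin n ⊕ Fin n) A)ˣ) (m m' : F),
      HasSimilitude M.1 m → HasSimilitude M.1 m' → m = m' := fun M m m' h h' =>
    (algebraMap F D).injective
      (((hsim _ _).1 h).multiplier_unique hk ((hsim _ _).1 h'))
  have hne : ∀ {m : F} {i : ℤ}, v (algebraMap F D m) = WithZero.exp i → m ≠ 0 := by
    rintro m i h rfl
    rw [map_zero] at h
    exact ne_zero_of_valuation_eq_exp h rfl
  refine leadingTermLaw_of ?_ ?_ ?_ ?_ ?_ ?_ ?_ ?_ ?_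
  · rintro M ⟨hM, m, hm, hMm⟩
    refine ⟨((Submonoid.mem_units_iff _ _).1 hM).1, m, ?_, hm.le, hMm⟩
    rintro rfl
    simp at hm
  · rintro g ⟨-, μ, hμ, -, hg⟩
    refine mem_commensurator_of_map_GLOrder hfin ρ.toMonoidHom _ _
      (fun h hh => ((hSp _).1 hh).1) fun x hx h hh hm => (hSp _).2 ⟨hm, ?_⟩
    obtain ⟨-, u, hu, hhu⟩ := (hSp _).1 hh
    obtain ⟨ν, hν, hxν⟩ : ∃ ν : F, ν ≠ 0 ∧ HasSimilitude x.1 ν := by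
      rcases hx with rfl | rfl
      · exact ⟨μ, hμ, hg⟩
      · exact ⟨μ⁻¹, inv_ne_zero hμ, hg.inv hμ⟩
    refine ⟨u, hu, ?_⟩
    have := (hxν.mul hhu).mul (hxν.inv hν)
    rwa [mul_comm ν u, mul_inv_cancel_right₀ hν] at this
  · rintro M ⟨hM, m, hm0, hm, hMm⟩
    obtain ⟨e, he⟩ := exists_hasElementaryDivisors (finSumFinEquiv.trans (finCongr hN))
      (ρ M).isUnit ((hint M).1 hM)
    have h0 : v (algebraMap F D m) ≠ 0 := by simpa using hm0
    have hlog : WithZero.log (v (algebraMap F D m)) ≤ 0 := by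
      rw [← WithZero.exp_le_exp, WithZero.exp_log h0, WithZero.exp_zero, hv]
      exact hm
    refine ⟨(e, (-WithZero.log (v (algebraMap F D m))).toNat), (hdiv _ _).2 he, m, hMm, ?_⟩
    rw [Int.toNat_of_nonneg (by simpa using hlog), neg_neg, WithZero.exp_log h0]
  · rintro M ⟨e, l⟩ ⟨f, l'⟩ ⟨h1, m, hm, hl⟩ ⟨h1', m', hm', hl'⟩
    obtain rfl := huniq _ _ _ hm hm'
    have := WithZero.exp_injective (hl.symm.trans hl')
    exact Prod.ext (h1.unique h1') (by simpa using this)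
  · rintro M h hh h' hh' x ⟨h1, m, hm, hl⟩
    obtain ⟨hU, u, hu, hhu⟩ := (hSp _).1 hh
    obtain ⟨hU', u', hu', hhu'⟩ := (hSp _).1 hh'
    refine ⟨?_, u * m * u', (hhu.mul hm).mul hhu', ?_⟩
    · rw [hdiv] at h1 ⊢
      rw [map_mul, map_mul]
      exact h1.mul_mul hU hU'
    · rw [map_mul, map_mul, map_mul, map_mul, hu, hu', one_mul, mul_one, hl]
  · rintro M - M' - x ⟨h1, m, hm, hl⟩ ⟨h1', m', hm', hl'⟩
    obtain ⟨U, hU, V, hV, hUm, hUV⟩ := exists_eq_mul_mul_hypUnitary hN hη hstar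
      (algebraMap_mem_center m) (algebraMap_mem_center m') (hstarF m) (hstarF m') hl hl' (ρ M)
      (ρ M') ((hsim _ _).1 hm) ((hsim _ _).1 hm') ((hdiv _ _).1 h1) ((hdiv _ _).1 h1')
    rw [← map_inv₀, ← map_mul] at hUm
    refine ⟨_, hlift U hU _ ?_ hUm, _, hlift' V hV, ρ.injective ?_⟩
    · rw [map_mul, map_inv₀, map_mul, map_inv₀, hl, hl', mul_inv_cancel₀ WithZero.coe_ne_zero]
    · rw [map_mul, map_mul, MulEquiv.apply_symm_apply, MulEquiv.apply_symm_apply, hUV]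
  · rintro M - M' - x y z ⟨h1, m, hm, hl⟩ ⟨h1', m', hm', hl'⟩ ⟨h1'', m'', hm'', hl''⟩
    obtain rfl := huniq _ _ _ hm'' (hm.mul hm')
    have h2 : z.2 = x.2 + y.2 := by
      rw [map_mul, map_mul, hl, hl', ← WithZero.exp_add] at hl''
      have := WithZero.exp_injective hl''
      omega
    rw [hdiv] at h1 h1' h1''
    rw [map_mul] at h1''
    rcases h1.eq_add_or_divLT h1' h1'' with h | h
    · exact Or.inl (Prod.ext h h2)
    · exact Or.inr (Or.inr ⟨h2, h⟩)
  · rintro M - M' - x y ⟨h1, m, hm, hl⟩ ⟨h1', m', hm', hl'⟩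
    obtain ⟨W, hW, h⟩ := exists_hypUnitary_mul_mul_add hN hη hstar (algebraMap_mem_center m)
      (algebraMap_mem_center m') hl hl' (ρ M) (ρ M') ((hsim _ _).1 hm) ((hsim _ _).1 hm')
      ((hdiv _ _).1 h1) ((hdiv _ _).1 h1')
    obtain ⟨-, u, hu, hWu⟩ := (hSp _).1 (hlift' W hW)
    refine ⟨_, hlift' W hW, ?_, m * u * m', (hm.mul hWu).mul hm', ?_⟩
    · rw [hdiv, map_mul, map_mul, MulEquiv.apply_symm_apply]
      exact h
    · rw [map_mul, map_mul, map_mul, map_mul, hu, hl, hl', mul_one, ← WithZero.exp_add,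
        Prod.snd_add]
      congr 1
      push_cast
      ring
  · rintro M - M' - M₁ - M₁' - x y ⟨h1, -⟩ ⟨h1', m', hm', hl'⟩ ⟨h2, -⟩ ⟨h2', m₁', hm₁', hl₁'⟩
      ⟨h3, -⟩ heq
    rw [hdiv] at h1 h1' h2 h2' h3
    rw [map_mul] at h3
    obtain ⟨U, hU, h⟩ := h1.exists_eq_mul_right_factor h1' h2 h2' h3 (by
      have := congr_arg (fun M => (ρ M).1) heq
      simp only [map_mul] at this
      exact this)
    have h4 : ρ M₁' = U * ρ M' := Units.ext h
    refine (hSp _).2 ⟨?_, m₁' * m'⁻¹, ?_, hm₁'.mul (hm'.inv (hne hl'))⟩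
    · rw [map_mul, map_inv, h4, mul_inv_cancel_right]
      exact hU
    · rw [map_mul, map_inv₀, map_mul, map_inv₀, hl', hl₁', mul_inv_cancel₀ WithZero.coe_ne_zero]

end Similitudes

end LocalHecke

end

noncomputable section

namespace LocalHecke

/-! ### Division algebras with involution -/

section DivisionCase

variable {D : Type*} [DivisionRing D] {v : Valuation D ℤᵐ⁰}

theorem hasElementaryDivisors_reindex_iff {ι κ : Type*} [Fintype ι] [DecidableEq ι] [Fintype κ]
    [DecidableEq κ] {N : ℕ} (s : ι ≃ κ) (s₀ : κ ≃ Fin N) {X : Matrix ι ι D} {e : Fin N → ℕ} :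
    HasElementaryDivisors v (Matrix.reindex s s X) e ↔ HasElementaryDivisors v X e := by
  rw [hasElementaryDivisors_iff s₀, hasElementaryDivisors_iff (s.trans s₀)]
  rfl

/-- An involution that preserves the valuation ring preserves the valuation, since the valuation is
discrete: it multiplies all valuations by some `b ≥ 0`, and `b² = 1`. -/
theorem valuation_star_eq [StarRing D] (hsurj : Function.Surjective v)
    (h : ∀ x, v x ≤ 1 → v (star x) ≤ 1) (x : D) : v (star x) = v x := by
  have hunit : ∀ u, v u = 1 → v (star u) = 1 := fun u hu => by
    refine le_antisymm (h u hu.le) ?_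
    have h1 := h u⁻¹ (by rw [map_inv₀, hu, inv_one])
    have hu0 : star u ≠ 0 := star_ne_zero.2 (by rintro rfl; simp at hu)
    rwa [star_inv₀, map_inv₀, inv_le_one₀ (zero_lt_iff.2 (by simpa using hu0))] at h1
  obtain ⟨π, hπ⟩ := hsurj (WithZero.exp (-1))
  have hπ0 : π ≠ 0 := ne_zero_of_valuation_eq_exp hπ
  have hpow : ∀ (x : D) (c : ℤ), v x = WithZero.exp (-c) → v (star x) = v (star π) ^ c := by
    intro x c hx
    have h1 : v (x * (π ^ c)⁻¹) = 1 := by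
      rw [map_mul, map_inv₀, map_zpow₀, hx, hπ, ← WithZero.exp_zsmul, smul_eq_mul, mul_neg_one,
        mul_inv_cancel₀ WithZero.coe_ne_zero]
    have h2 := hunit _ h1
    rw [star_mul, star_inv₀, star_zpow₀, map_mul, map_inv₀, map_zpow₀] at h2
    have h3 : v (star π) ^ c ≠ 0 := zpow_ne_zero _ (by simpa using hπ0)
    rwa [inv_mul_eq_one₀ h3, eq_comm] at h2
  have hπs : v (star π) ≠ 0 := by simpa using hπ0
  obtain ⟨b, hb⟩ : ∃ b : ℤ, v (star π) = WithZero.exp (-b) :=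
    ⟨-WithZero.log (v (star π)), by rw [neg_neg, WithZero.exp_log hπs]⟩
  have hb0 : 0 ≤ b := by
    have := h π (by rw [hπ, ← WithZero.exp_zero, WithZero.exp_le_exp]; norm_num)
    rw [hb, ← WithZero.exp_zero, WithZero.exp_le_exp] at this
    linarith
  have hbb : b * b = 1 := by
    have := hpow (star π) b hb
    rw [star_star, hπ, hb, ← WithZero.exp_zsmul] at this
    have := WithZero.exp_injective this
    rw [smul_eq_mul] at this
    linarith
  have hb1 : b = 1 := by nlinarith
  by_cases hx : x = 0
  · simp [hx]
  · have hvx : v x = WithZero.exp (- -WithZero.log (v x)) := by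
      rw [neg_neg, WithZero.exp_log (by simpa using hx)]
    rw [hpow x _ hvx, hb, hb1, ← hπ, hπ, ← WithZero.exp_zsmul]
    conv_rhs => rw [hvx]
    congr 1
    rw [smul_eq_mul]
    ring

/-- Transport of an involution along a ring isomorphism. -/
abbrev starRingOfRingEquiv {A : Type*} [Ring A] [StarRing A] (ψ : A ≃+* D) : StarRing D where
  star x := ψ (star (ψ.symm x))
  star_involutive x := by simp
  star_mul x y := by simp
  star_add x y := by simp

/-- The only entry of a matrix of size one. -/
def entryAlgEquiv (F D : Type*) [Field F] [DivisionRing D] [Algebra F D] :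
    Matrix (Fin 1) (Fin 1) D ≃ₐ[F] D where
  toFun X := X 0 0
  invFun x := Matrix.of fun _ _ => x
  left_inv X := by
    ext i j
    rw [Subsingleton.elim i 0, Subsingleton.elim j 0]
    rfl
  right_inv _ := rfl
  map_mul' X Y := by simp [Matrix.mul_apply]
  map_add' _ _ := rfl
  commutes' x := by simp [Matrix.algebraMap_matrix_apply]

/-- The leading term law for similitudes if `A` is a division algebra. -/
theorem leadingTermLaw_modular_of_division {F : Type*} [Field F] [Algebra F D]
    {vF : Valuation F ℤᵐ⁰} {A : Type*} [Ring A] [Algebra F A] [StarRing A] {n : ℕ}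
    {φ : A ≃ₐ[F] Matrix (Fin 1) (Fin 1) D}
    (hfin : ∀ k : ℤ, ∃ S : Set D, S.Finite ∧ ∀ x, v x ≤ 1 → ∃ s ∈ S, v (x - s) ≤ WithZero.exp (-k))
    (hsurj : Function.Surjective v) (hv : ∀ x : F, v (algebraMap F D x) ≤ 1 ↔ vF x ≤ 1)
    (hn : 1 ≤ n) (hF : ∀ x : F, star (algebraMap F A x) = algebraMap F A x)
    (horder : ∀ a ∈ order v φ, star a ∈ order v φ) :
    LeadingTermLaw (DeltaOrder n vF (order v φ)) (SpOrder n vF (order v φ)) simDivLT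
      (ModularInv v φ) := by
  let ψ : A ≃ₐ[F] D := φ.trans (entryAlgEquiv F D)
  have hψ : ∀ a, ψ a = φ a 0 0 := fun a => rfl
  have hmem : ∀ a, a ∈ order v φ ↔ v (ψ a) ≤ 1 := by
    intro a
    rw [hψ]
    constructor
    · exact fun h => h 0 0
    · intro h i j
      rw [Subsingleton.elim i 0, Subsingleton.elim j 0]
      exact h
  let : StarRing D := starRingOfRingEquiv ψ.toRingEquiv
  have hstarD : ∀ a : A, star (ψ a) = ψ (star a) := fun a =>
    congr_arg (fun x => ψ (star x)) (ψ.symm_apply_apply a)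
  have hstar : ∀ x : D, v (star x) = v x := by
    refine valuation_star_eq hsurj fun x hx => ?_
    obtain ⟨a, rfl⟩ := ψ.surjective x
    rw [hstarD]
    exact (hmem _).1 (horder a ((hmem a).2 hx))
  have hN : n + n = 2 * n * 1 := by ring
  have hJ : (J A n).map ψ = hypForm (-1 : D) (Fin n) := by
    have h1 : (-1 : Matrix (Fin n) (Fin n) A).map ψ = -1 := by
      ext i j
      by_cases h : i = j <;> simp [h]
    rw [J, hypForm, Matrix.fromBlocks_map, neg_smul, one_smul, h1]
    simp
  have hflat : ∀ M : Matrix (Fin n ⊕ Fin n) (Fin n ⊕ Fin n) A, M.map ψ =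
      Matrix.reindex (Equiv.prodUnique _ _) (Equiv.prodUnique _ _) (flatten φ M) := fun M => rfl
  let ρ : (Matrix (Fin n ⊕ Fin n) (Fin n ⊕ Fin n) A)ˣ ≃*
    (Matrix (Fin n ⊕ Fin n) (Fin n ⊕ Fin n) D)ˣ := Units.mapEquiv ψ.toRingEquiv.mapMatrix.toMulEquiv
  have hρ : ∀ M, (ρ M).1 = M.1.map ψ := fun M => rfl
  refine leadingTermLaw_modular_of_hyperbolic hfin hv hstar (fun x => ?_) (Or.inr rfl) hn hN ρ
    (fun M m => ?_) (fun M => ?_) fun M e => ?_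
  · rw [← ψ.commutes, hstarD, hF]
  · have hinj : Function.Injective
        (fun X : Matrix (Fin n ⊕ Fin n) (Fin n ⊕ Fin n) A => X.map ψ) :=
      Matrix.map_injective ψ.injective
    unfold HasSimilitude IsHypSimilitude
    rw [← hinj.eq_iff, hρ, ← hJ]
    have h1 : (M.1ᴴ).map ψ = (M.1.map ψ)ᴴ := by
      ext i j
      exact (hstarD _).symm
    have h2 : (m • J A n).map ψ = algebraMap F D m • (J A n).map ψ := by
      ext i j
      change ψ (m • J A n i j) = algebraMap F D m * ψ (J A n i j)
      rw [map_smul, Algebra.smul_def]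
    simp only [h2, ← h1]
    rw [Matrix.map_mul, Matrix.map_mul]
  · exact forall_congr' fun i => forall_congr' fun j => hmem _
  · rw [hρ, hflat, hasElementaryDivisors_reindex_iff _ (finSumFinEquiv.trans (finCongr hN))]

end DivisionCase

end LocalHecke

end

noncomputable section

namespace LocalHecke

/-! ### The split quaternion algebra -/

section SplitQuaternion

/-- The matrix `(0, 1; -1, 0)`, which conjugates the transpose of a matrix of size two to its
adjugate. -/
def symplecticTwo (D : Type*) [Ring D] : Matrix (Fin 2) (Fin 2) D := !![0, 1; -1, 0]

/-- If `Y` behaves like the conjugate of `X`, then it is the adjugate of `X`: for nonscalar `X` the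
quadratic equation of `X` is its characteristic equation. -/
theorem eq_adjugate_of_trace_norm {D : Type*} [Field D] {X Y : Matrix (Fin 2) (Fin 2) D} {t s : D}
    (ht : Y + X = t • 1) (hs : Y * X = s • 1) (hscalar : ∀ x : D, X = x • 1 → Y = X) :
    Y = X.adjugate := by
  have hY : Y = t • 1 - X := by rw [← ht, add_sub_cancel_right]
  have hXX : X * X = t • X - s • 1 := by
    rw [← hs, hY, sub_mul, Matrix.smul_mul, one_mul, sub_sub_cancel]
  have h00 := congr_fun₂ hXX 0 0
  have h01 := congr_fun₂ hXX 0 1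
  have h10 := congr_fun₂ hXX 1 0
  have h11 := congr_fun₂ hXX 1 1
  simp [Matrix.mul_apply, Fin.sum_univ_two] at h00 h01 h10 h11
  have htr : t = X 0 0 + X 1 1 → Y = X.adjugate := by
    intro htr
    rw [hY, Matrix.adjugate_fin_two, htr]
    ext i j
    fin_cases i <;> fin_cases j <;> simp
  by_cases h1 : X 0 1 = 0
  · by_cases h2 : X 1 0 = 0
    · by_cases h3 : X 0 0 = X 1 1
      · have hX : X = X 0 0 • 1 := by
          ext i j
          fin_cases i <;> fin_cases j <;> simp [h1, h2, h3]
        rw [hscalar _ hX, Matrix.adjugate_fin_two]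
        ext i j
        fin_cases i <;> fin_cases j <;> simp [h1, h2, h3]
      · refine htr (mul_right_cancel₀ (sub_ne_zero.2 h3) ?_)
        linear_combination h11 - h00
    · refine htr (mul_right_cancel₀ h2 ?_)
      linear_combination -h10
  · refine htr (mul_right_cancel₀ h1 ?_)
    linear_combination -h01

theorem adjugate_eq_symplecticTwo {D : Type*} [Field D] (X : Matrix (Fin 2) (Fin 2) D) :
    X.adjugate = symplecticTwo D * Xᵀ * -symplecticTwo D := by
  rw [Matrix.adjugate_fin_two, symplecticTwo]
  ext i j
  rw [Matrix.mul_apply, Fin.sum_univ_two, Matrix.mul_apply, Matrix.mul_apply, Fin.sum_univ_two,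
    Fin.sum_univ_two]
  fin_cases i <;> fin_cases j <;> simp

/-- The canonical involution of a split quaternion algebra is the adjugate. -/
theorem map_star_eq_adjugate {F D A : Type*} [Field F] [Field D] [Algebra F D] [Ring A]
    [Algebra F A] [StarRing A] (φ : A ≃ₐ[F] Matrix (Fin 2) (Fin 2) D)
    (hD : Function.Surjective (algebraMap F D))
    (hF : ∀ x : F, star (algebraMap F A x) = algebraMap F A x) {a b : F}
    (f : A ≃⋆ₐ[F] ℍ[F,a,b]) (x : A) : φ (star x) = (φ x).adjugate := by
  have hmap : ∀ t : F, φ (algebraMap F A t) = algebraMap F D t • 1 := fun t => by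
    rw [φ.commutes, Algebra.algebraMap_eq_smul_one, algebraMap_smul]
  have hf : ∀ t : F, f (algebraMap F A t) = (t : ℍ[F,a,b]) := fun t => by
    rw [Algebra.algebraMap_eq_smul_one, map_smul, map_one]
    ext <;> simp
  refine eq_adjugate_of_trace_norm (t := algebraMap F D (2 * (f x).re))
    (s := algebraMap F D (star (f x) * f x).re) ?_ ?_ ?_
  · rw [← map_add, ← hmap]
    refine congr_arg φ (EquivLike.injective f ?_)
    rw [map_add, map_star, hf, QuaternionAlgebra.star_add_self']
    simp
  · rw [← map_mul, ← hmap]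
    refine congr_arg φ (EquivLike.injective f ?_)
    rw [map_mul, map_star, hf, ← QuaternionAlgebra.star_mul_eq_coe]
  · intro y hy
    obtain ⟨y, rfl⟩ := hD y
    rw [← hmap] at hy
    rw [φ.injective hy, hF]

theorem isHypSimilitude_reindex_iff {D : Type*} [Field D] [StarRing D] {η m : D}
    {ι κ : Type*} [Fintype ι] [DecidableEq ι] [Fintype κ] [DecidableEq κ]
    (s : κ ≃ ι ⊕ ι) {H M : Matrix κ κ D}
    (hH : Matrix.reindex s s H = hypForm η ι) :
    IsHypSimilitude η (Matrix.reindex s s M) m ↔ Mᴴ * H * M = m • H := by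
  rw [IsHypSimilitude, ← hH, Matrix.conjTranspose_reindex, ← reindex_mul_mul,
    ← (Matrix.reindex s s).injective.eq_iff]
  rfl

/-- The leading term law for similitudes if `A` is the algebra of matrices of size two over `D = F`
with the adjugate as its involution. Such a similitude, as a matrix over `D`, is a similitude of
a split symmetric form. -/
theorem leadingTermLaw_modular_of_adjugate {F D A : Type*} [Field F] [Field D] [Algebra F D]
    [Ring A] [Algebra F A] [StarRing A] {v : Valuation D ℤᵐ⁰} {vF : Valuation F ℤᵐ⁰} {n : ℕ}
    {φ : A ≃ₐ[F] Matrix (Fin 2) (Fin 2) D}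
    (hfin : ∀ k : ℤ, ∃ S : Set D, S.Finite ∧ ∀ x, v x ≤ 1 → ∃ s ∈ S, v (x - s) ≤ WithZero.exp (-k))
    (hv : ∀ x : F, v (algebraMap F D x) ≤ 1 ↔ vF x ≤ 1) (hn : 1 ≤ n)
    (hadj : ∀ x, φ (star x) = (φ x).adjugate) :
    LeadingTermLaw (DeltaOrder n vF (order v φ)) (SpOrder n vF (order v φ)) simDivLT
      (ModularInv v φ) := by
  let : StarRing D := starRingOfComm
  let Φ := flattenRingEquiv φ (Fin n ⊕ Fin n)
  let s : (Fin n ⊕ Fin n) × Fin 2 ≃ Fin (n * 2) ⊕ Fin (n * 2) :=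
    (Equiv.sumProdDistrib _ _ _).trans (finProdFinEquiv.sumCongr finProdFinEquiv)
  obtain ⟨w, hw⟩ := φ.surjective (symplecticTwo D)
  have hww : w * w = -1 := by
    refine φ.injective ?_
    rw [map_mul, hw, map_neg, map_one, symplecticTwo]
    ext i j
    fin_cases i <;> fin_cases j <;> simp
  -- the form `diag(w) J` over `A` becomes symmetric over `D`
  let P : (Matrix (Fin n ⊕ Fin n) (Fin n ⊕ Fin n) A)ˣ :=
    { val := Matrix.fromBlocks 1 0 0 (Matrix.diagonal fun _ => -w)
      inv := Matrix.fromBlocks 1 0 0 (Matrix.diagonal fun _ => w)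
      val_inv := by simp [Matrix.fromBlocks_multiply, hww]
      inv_val := by simp [Matrix.fromBlocks_multiply, hww] }
  let H₀ : Matrix (Fin n ⊕ Fin n) (Fin n ⊕ Fin n) A := Matrix.fromBlocks 0 1 1 0
  let W : Matrix (Fin n ⊕ Fin n) (Fin n ⊕ Fin n) A := Matrix.diagonal fun _ => w
  have hWW : W * W = -1 := by
    simp only [W, Matrix.diagonal_mul_diagonal, hww]
    rw [← Matrix.diagonal_one, Matrix.diagonal_neg]
  have hPJ : (P⁻¹).1 * H₀ * P.1 = -W * J A n := by
    have h1 : W =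
        Matrix.fromBlocks (Matrix.diagonal fun _ => w) 0 0 (Matrix.diagonal fun _ => w) := by
      rw [Matrix.fromBlocks_diagonal, Sum.elim_lam_const_lam_const]
    change Matrix.fromBlocks 1 0 0 (Matrix.diagonal fun _ => w) * Matrix.fromBlocks 0 1 1 0 *
      Matrix.fromBlocks 1 0 0 (Matrix.diagonal fun _ => -w) = _
    rw [h1, J, Matrix.fromBlocks_neg, Matrix.fromBlocks_multiply, Matrix.fromBlocks_multiply,
      Matrix.fromBlocks_multiply]
    simp
  have hPt : (Φ P.1)ᵀ = Φ (P⁻¹).1 := by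
    have hwt : -(φ w)ᵀ = φ w := by
      rw [hw, symplecticTwo]
      ext i j
      fin_cases i <;> fin_cases j <;> simp
    have h1 : ∀ i j, (φ (P.1 j i))ᵀ = φ ((P⁻¹).1 i j) := by
      change ∀ i j, (φ (Matrix.fromBlocks 1 0 0 (Matrix.diagonal fun _ => -w) j i))ᵀ =
        φ (Matrix.fromBlocks 1 0 0 (Matrix.diagonal fun _ => w) i j)
      rintro (i | i) (j | j)
      · by_cases h : i = j
        · simp [h]
        · simp [h, Ne.symm h]
      · simp
      · simp
      · by_cases h : i = j
        · simp [h, hwt]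
        · simp [h, Ne.symm h]
    ext ⟨i, a⟩ ⟨j, b⟩
    exact congr_fun₂ (h1 i j) a b
  have hH : Matrix.reindex s s (Φ H₀) = hypForm (1 : D) (Fin (n * 2)) := by
    have h1 : ∀ x y : Fin n × Fin 2, φ ((1 : Matrix (Fin n) (Fin n) A) x.1 y.1) x.2 y.2 =
        (1 : Matrix (Fin (n * 2)) (Fin (n * 2)) D) (finProdFinEquiv x) (finProdFinEquiv y) := by
      rintro ⟨i, a⟩ ⟨j, b⟩
      by_cases h : i = j
      · by_cases h' : a = b <;> simp [h, h', Matrix.one_apply]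
      · simp [h]
    rw [← Equiv.eq_symm_apply]
    ext ⟨i | i, a⟩ ⟨j | j, b⟩
    · exact congr_fun₂ (map_zero φ) a b
    · exact h1 (i, a) (j, b)
    · rw [hypForm, one_smul]
      exact h1 (i, a) (j, b)
    · exact congr_fun₂ (map_zero φ) a b
  -- the conjugate transpose over `A` in terms of the transpose over `D`
  have hΦ : ∀ M, Φ Mᴴ = Φ W * (Φ M)ᵀ * -Φ W := by
    intro M
    let T : Matrix (Fin n ⊕ Fin n) (Fin n ⊕ Fin n) A := Matrix.of fun i j => φ.symm (φ (M j i))ᵀ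
    have h1 : Φ T = (Φ M)ᵀ := by
      ext ⟨i, a⟩ ⟨j, b⟩
      exact congr_fun₂ (φ.apply_symm_apply ((φ (M j i))ᵀ)) a b
    have h2 : Mᴴ = W * T * -W := by
      ext i j
      rw [mul_neg, Matrix.neg_apply, Matrix.mul_diagonal, Matrix.diagonal_mul]
      refine φ.injective ?_
      have h3 : φ (T i j) = (φ (M j i))ᵀ := φ.apply_symm_apply _
      rw [map_neg, map_mul, map_mul, hw, Matrix.conjTranspose_apply, hadj,
        adjugate_eq_symplecticTwo, h3, mul_neg]
    rw [← h1, h2, map_mul, map_mul, map_neg]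
  let ρ : (Matrix (Fin n ⊕ Fin n) (Fin n ⊕ Fin n) A)ˣ ≃*
      (Matrix (Fin (n * 2) ⊕ Fin (n * 2)) (Fin (n * 2) ⊕ Fin (n * 2)) D)ˣ :=
    (MulAut.conj P).trans ((flattenUnits φ _).trans (reindexUnits s))
  have hρ : ∀ M, (ρ M).1 = Matrix.reindex s s (Φ P.1 * Φ M.1 * Φ (P⁻¹).1) := fun M => by
    rw [← map_mul, ← map_mul]
    rfl
  have hPGL : flattenUnits φ _ P ∈ GLOrder _ v.integer := by
    have hwo : w ∈ order v φ := by
      change ∀ i j, v (φ w i j) ≤ 1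
      rw [hw, symplecticTwo]
      intro i j
      fin_cases i <;> fin_cases j <;> simp
    have h1 : ∀ y ∈ order v φ, ∀ i j,
        (Matrix.fromBlocks 1 0 0 (Matrix.diagonal fun _ => y) :
          Matrix (Fin n ⊕ Fin n) (Fin n ⊕ Fin n) A) i j ∈ order v φ := by
      rintro y hy (i | i) (j | j)
      · by_cases h : i = j
        · simp [h, one_mem]
        · simp [h, zero_mem]
      · exact zero_mem _
      · exact zero_mem _
      · by_cases h : i = j
        · simp [h, hy]
        · simp [h, zero_mem]
    exact mem_GLOrder_order_iff.1
      ((Submonoid.mem_units_iff _ _).2 ⟨h1 _ (neg_mem hwo), h1 _ hwo⟩)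
  have hN : n * 2 + n * 2 = 2 * n * 2 := by ring
  have hback : ∀ M : (Matrix (Fin n ⊕ Fin n) (Fin n ⊕ Fin n) A)ˣ,
      ((flattenUnits φ _ P)⁻¹).1 * (Φ P.1 * Φ M.1 * Φ (P⁻¹).1) * (flattenUnits φ _ P).1 =
        flatten φ M.1 := fun M => by
    change Φ (P⁻¹).1 * (Φ P.1 * Φ M.1 * Φ (P⁻¹).1) * Φ P.1 = Φ M.1
    rw [← map_mul, ← map_mul, ← map_mul, ← map_mul, mul_assoc P.1, P.inv_mul_cancel_left,
      P.inv_mul_cancel_right]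
  refine leadingTermLaw_modular_of_hyperbolic hfin hv (fun x => rfl) (fun x => rfl) (Or.inl rfl)
    (k := n * 2) (by omega) hN ρ (fun M m => ?_) (fun M => ?_) fun M e => ?_
  · rw [hρ, isHypSimilitude_reindex_iff s hH]
    have hpq : Φ P.1 * Φ (P⁻¹).1 = 1 := by rw [← map_mul, P.mul_inv, map_one]
    have hqp : Φ (P⁻¹).1 * Φ P.1 = 1 := by rw [← map_mul, P.inv_mul, map_one]
    have hqt : (Φ (P⁻¹).1)ᵀ = Φ P.1 := by rw [← hPt, Matrix.transpose_transpose]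
    have hSJ : Φ (P⁻¹).1 * Φ H₀ * Φ P.1 = -Φ W * Φ (J A n) := by
      rw [← map_mul, ← map_mul, hPJ, map_mul, map_neg]
    have hWΦ : Φ W * -Φ W = 1 := by rw [mul_neg, ← map_mul, hWW, map_neg, map_one, neg_neg]
    have hWΦ' : -Φ W * Φ W = 1 := by rw [neg_mul, ← map_mul, hWW, map_neg, map_one, neg_neg]
    have hsmul : Φ (m • J A n) = algebraMap F D m • Φ (J A n) := by
      ext ⟨i, a⟩ ⟨j, b⟩
      change φ (m • J A n i j) a b = algebraMap F D m * φ (J A n i j) a b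
      rw [map_smul, Matrix.smul_apply, Algebra.smul_def]
    generalize hS : Φ (P⁻¹).1 * Φ H₀ * Φ P.1 = S at hSJ
    have h1 : HasSimilitude M.1 m ↔ (Φ M.1)ᵀ * S * Φ M.1 = algebraMap F D m • S := by
      unfold HasSimilitude
      rw [← Φ.injective.eq_iff, map_mul, map_mul, hΦ, hsmul, hSJ]
      constructor
      · intro h
        rw [← Matrix.mul_smul, ← h]
        simp only [← mul_assoc, hWΦ', one_mul]
      · intro h
        have h2 := congr_arg (fun X => Φ W * X) h
        simp only [← mul_assoc, Matrix.mul_smul, hWΦ, one_mul] at h2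
        simpa only [← mul_assoc] using h2
    have h2 : (Φ P.1 * Φ M.1 * Φ (P⁻¹).1)ᴴ * Φ H₀ * (Φ P.1 * Φ M.1 * Φ (P⁻¹).1) =
        Φ P.1 * ((Φ M.1)ᵀ * S * Φ M.1) * Φ (P⁻¹).1 := by
      change (Φ P.1 * Φ M.1 * Φ (P⁻¹).1)ᵀ * _ * _ = _
      rw [Matrix.transpose_mul, Matrix.transpose_mul, hPt, hqt, ← hS]
      simp only [mul_assoc]
    have h3 : Φ H₀ = Φ P.1 * S * Φ (P⁻¹).1 := by
      rw [← hS]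
      simp only [← mul_assoc, hpq, one_mul]
      rw [mul_assoc, hpq, mul_one]
    rw [h1, h2, h3, ← Matrix.smul_mul, ← Matrix.mul_smul]
    refine ⟨fun h => by rw [h], fun h => ?_⟩
    have h4 := congr_arg (fun X => Φ (P⁻¹).1 * X * Φ P.1) h
    simpa only [mul_assoc, hqp, mul_one, ← mul_assoc (Φ (P⁻¹).1) (Φ P.1), one_mul] using h4
  · rw [mem_order_matrix_iff, hρ]
    have h1 : (∀ i j, v (flatten φ M.1 i j) ≤ 1) ↔
        ∀ i j, v ((Φ P.1 * Φ M.1 * Φ (P⁻¹).1) i j) ≤ 1 := by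
      constructor
      · exact fun h => valuation_mul_GLOrder_le (inv_mem hPGL) (valuation_GLOrder_mul_le hPGL h)
      · intro h
        have := valuation_mul_GLOrder_le hPGL (valuation_GLOrder_mul_le (inv_mem hPGL) h)
        rwa [hback] at this
    rw [h1]
    exact ⟨fun h i j => h _ _, fun h i j => by simpa using h (s i) (s j)⟩
  · rw [hρ, hasElementaryDivisors_reindex_iff _ (finSumFinEquiv.trans (finCongr hN))]
    constructor
    · intro h
      have := h.mul_mul hPGL (inv_mem hPGL)
      exact this
    · intro h
      have := h.mul_mul (inv_mem hPGL) hPGL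
      rwa [hback] at this

end SplitQuaternion

end LocalHecke

end

noncomputable section

namespace LocalHecke

/-! ### The modular case -/

section Modular

/-- The leading term law for similitudes over an algebra with involution. Comparing dimensions,
either `A` is a division algebra, or `A` is a quaternion algebra that is split by `φ`. -/
theorem leadingTermLaw_modular {F D A : Type*} [Field F] [DivisionRing D] [Algebra F D]
    [FiniteDimensional F D] [Ring A] [Algebra F A] [StarRing A] {v : Valuation D ℤᵐ⁰}
    {vF : Valuation F ℤᵐ⁰} {r n : ℕ} {φ : A ≃ₐ[F] Matrix (Fin r) (Fin r) D}
    (hfin : ∀ k : ℤ, ∃ S : Set D, S.Finite ∧ ∀ x, v x ≤ 1 → ∃ s ∈ S, v (x - s) ≤ WithZero.exp (-k))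
    (hsurj : Function.Surjective v) (hv : ∀ x : F, v (algebraMap F D x) ≤ 1 ↔ vF x ≤ 1)
    (hn : 1 ≤ n) (hr : 1 ≤ r) (hA : IsModularAlgebra F A)
    (horder : ∀ a ∈ order v φ, star a ∈ order v φ) :
    LeadingTermLaw (DeltaOrder n vF (order v φ)) (SpOrder n vF (order v φ)) simDivLT
      (ModularInv v φ) := by
  obtain ⟨hF, hA⟩ := hA
  have hdim : Module.finrank F A = r * r * Module.finrank F D := by
    rw [φ.toLinearEquiv.finrank_eq, Module.finrank_matrix, Fintype.card_fin]
  have hD : 0 < Module.finrank F D := Module.finrank_pos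
  have hdim4 : Module.finrank F A < 4 ∨ Module.finrank F A = 4 ∧
      ∃ a b : F, Nonempty (A ≃⋆ₐ[F] ℍ[F,a,b]) := by
    rcases hA with h | ⟨-, h, -⟩ | ⟨a, b, -, -, ⟨f⟩⟩
    · omega
    · omega
    · refine Or.inr ⟨?_, a, b, ⟨f⟩⟩
      rw [(f.toAlgEquiv).toLinearEquiv.finrank_eq, QuaternionAlgebra.finrank_eq_four]
  have hcases : r = 1 ∨ r = 2 ∧ Module.finrank F D = 1 ∧ Module.finrank F A = 4 := by
    have h4 : r * r * Module.finrank F D ≤ 4 := by omega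
    have h2 : r ≤ 2 := by
      by_contra! h
      nlinarith
    interval_cases r
    · exact Or.inl rfl
    · right
      omega
  rcases hcases with rfl | ⟨rfl, hD1, hA4⟩
  · exact leadingTermLaw_modular_of_division hfin hsurj hv hn hF horder
  · obtain ⟨-, a, b, ⟨f⟩⟩ := hdim4.resolve_left (by omega)
    have hbij := Algebra.finrank_eq_one_iff_bijective_algebraMap.1 hD1
    have hcomm : ∀ x y : D, x * y = y * x := fun x y => by
      obtain ⟨x, rfl⟩ := hbij.2 x
      exact Algebra.commutes x y
    let hfield : Field D := { (inferInstance : DivisionRing D) with mul_comm := hcomm }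
    exact @leadingTermLaw_modular_of_adjugate F D A _ hfield _ _ _ _ v vF n φ hfin hv hn
      (@map_star_eq_adjugate F D A _ hfield _ _ _ _ φ hbij.2 hF a b f)

end Modular

end LocalHecke

end

theorem mainTheorem4
    {K : Type*} [Field K] [NumberField K]
    (𝔭 : IsDedekindDomain.HeightOneSpectrum (NumberField.RingOfIntegers K))
    (n : ℕ) (hn : 1 ≤ n) :
    -- the unimodular and the modular cases
    (∀ {D : Type*} [DivisionRing D] [Algebra (𝔭.adicCompletion K) D]
      [FiniteDimensional (𝔭.adicCompletion K) D]
      (v : Valuation D (WithZero (Multiplicative ℤ))) (_ : Function.Surjective v)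
      (_ : ∀ x : 𝔭.adicCompletion K,
        v (algebraMap (𝔭.adicCompletion K) D x) ≤ 1 ↔ x ∈ 𝔭.adicCompletionIntegers K)
      (r : ℕ) (_ : 1 ≤ r)
      {A : Type*} [Ring A] [Algebra (𝔭.adicCompletion K) A]
      (φ : A ≃ₐ[𝔭.adicCompletion K] Matrix (Fin r) (Fin r) D),
      LocalHecke.LeadingTermLaw
        (LocalHecke.InvOrder (Fin n) (LocalHecke.order v φ))
        (LocalHecke.GLOrder (Fin n) (LocalHecke.order v φ))
        LocalHecke.divLT (LocalHecke.UnimodularInv v φ) ∧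
      ∀ [StarRing A], LocalHecke.IsModularAlgebra (𝔭.adicCompletion K) A →
        (∀ a ∈ LocalHecke.order v φ, star a ∈ LocalHecke.order v φ) →
        LocalHecke.LeadingTermLaw
          (LocalHecke.DeltaOrder n
            (Valued.v : Valuation (𝔭.adicCompletion K) (WithZero (Multiplicative ℤ)))
            (LocalHecke.order v φ))
          (LocalHecke.SpOrder n
            (Valued.v : Valuation (𝔭.adicCompletion K) (WithZero (Multiplicative ℤ)))
            (LocalHecke.order v φ))
          LocalHecke.simDivLT (LocalHecke.ModularInv v φ)) ∧
    -- the split hermitian modular case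
    LocalHecke.LeadingTermLaw
      (LocalHecke.RInvOrder (Fin (2 * n))
        (Valued.v : Valuation (𝔭.adicCompletion K) (WithZero (Multiplicative ℤ))))
      (LocalHecke.GLSplit (Fin (2 * n))
        (Valued.v : Valuation (𝔭.adicCompletion K) (WithZero (Multiplicative ℤ))))
      LocalHecke.simDivLT
      (LocalHecke.SplitInv
        (Valued.v : Valuation (𝔭.adicCompletion K) (WithZero (Multiplicative ℤ)))) := by
  have hint : ∀ x : 𝔭.adicCompletion K, x ∈ 𝔭.adicCompletionIntegers K ↔
      (Valued.v : Valuation (𝔭.adicCompletion K) (WithZero (Multiplicative ℤ))) x ≤ 1 := fun x =>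
    IsDedekindDomain.HeightOneSpectrum.mem_adicCompletionIntegers _ K 𝔭
  refine ⟨?_, LocalHecke.leadingTermLaw_split (LocalHecke.exists_finite_residues_exp
    (𝔭.valuedAdicCompletion_surjective K)
    (LocalHecke.exists_finite_residues_adicCompletion 𝔭)) (2 * n)⟩
  intro D _ _ _ v hsurj hv r hr A _ _ φ
  simp only [hint] at hv
  have hfin := LocalHecke.exists_finite_residues_exp hsurj
    (LocalHecke.exists_finite_residues_of_finiteDimensional hv
      (LocalHecke.exists_finite_residues_adicCompletion 𝔭))
  refine ⟨LocalHecke.leadingTermLaw_unimodular hfin n, ?_⟩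
  intro _ hA horder
  exact LocalHecke.leadingTermLaw_modular hfin hsurj hv hn hr hA horder
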